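/- Let $n\ge 1$ be an integer, $\beta\in(0,2]$, $\alpha\in(0,n)$, $p>\frac{n}{n-\alpha}$, and $\frac{n}{n-\alpha}<s<\frac{n(p-1)}{\alpha}$. Let $u_0\in L^s(\mathbb R^n)\cap L^\infty(\mathbb R^n)$ be real-valued. Consider the Cauchy problem $$u_t+(-\Delta)^{\beta/2}u=I_\alpha(|u|^p)\quad (x\in\mathbb R^n,\ t>0),\qquad u(\cdot,0)=u_0,\tag{1.1}$$ where $$I_\alpha f(x)=A_\alpha\int_{\mathbb R^n}\frac{f(y)}{|x-y|^{n-\alpha}}\,dy,\qquad A_\alpha=\frac{\Gamma(\frac{n-\alpha}{2})}{\Gamma(\frac{\alpha}{2})\,\pi^{n/2}\,2^{\alpha}}.$$ For $t>0$ let $S_\beta(t)v=S_\beta(\cdot,t)*v$ with $S_\beta(x,t)=(2\pi)^{-n}\int_{\mathbb R^n}e^{ix\cdot\xi-t|\xi|^\beta}\,d\xi$. For $T>0$, a *mild solution of (1.1) on $[0,T]$* is a function $u\in C([0,T],L^s(\mathbb R^n))\cap L^\infty((0,T),L^\infty(\mathbb R^n))$ with $u(0)=u_0$ and $$u(t)=S_\beta(t)u_0+\int_0^tS_\beta(t-\tau)\,I_\alpha(|u(\tau)|^p)\,d\tau\qquad\text{for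 all }t\in(0,T],$$ the integral being a Bochner integral in $L^s(\mathbb R^n)$. Then: **Local existence and uniqueness.** There exists $T=T(u_0)>0$ such that (1.1) has a unique mild solution on $[0,T]$. **(i) Maximal solution and blow-up alternative.** There are $T_{\max}=T_{\max}(u_0)\in(0,\infty]$ and $u:[0,T_{\max})\to L^s(\mathbb R^n)$ such that $u$ is a mild solution of (1.1) on $[0,T]$ for every $0<T<T_{\max}$, and such that every mild solution of (1.1) on an interval $[0,T]$, $T>0$, satisfies $T<T_{\max}$ and coincides with $u$ on $[0,T]$. Moreover, either $T_{\max}=\infty$, or $T_{\max}<\infty$ and $$\lim_{t\to T_{\max}^-}\bigl(\|u(t)\|_{L^\infty(\mathbb R^n)}+\|u(t)\|_{L^s(\mathbb R^n)}\bigr)=+\infty .$$ **(ii) Nonnegativity.** If $u_0\ge 0$ almost everywhere, then every mild solution $u$ of (1.1) on an interval $[0,T]$, $T>0$, satisfies $u(t)\ge 0$ almost everywhere on $\mathbb R^n$ for all $t\in[0,T]$. -/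

import Mathlib

open MeasureTheory Set Filter Topology
open scoped ENNReal

noncomputable section

namespace RieszHeat

/-- The normalization constant `A_α` of the Riesz potential on `ℝⁿ`. -/
def rieszConst (n : ℕ) (α : ℝ) : ℝ :=
  Real.Gamma (((n : ℝ) - α) / 2) / (Real.Gamma (α / 2) * Real.pi ^ ((n : ℝ) / 2) * 2 ^ α)

/-- The Riesz potential `I_α f (x) = A_α ∫ f(y) |x - y|^{-(n-α)} dy`. -/
def rieszPotential {n : ℕ} (α : ℝ) (f : EuclideanSpace ℝ (Fin n) → ℝ)
    (x : EuclideanSpace ℝ (Fin n)) : ℝ :=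
  rieszConst n α * ∫ y, f y / ‖x - y‖ ^ ((n : ℝ) - α)

/-- The fundamental solution of `u_t + (-Δ)^{β/2} u = 0` on `ℝⁿ`, for `t > 0`:
`S_β(x, t) = (2π)^{-n} ∫ exp(i x·ξ - t |ξ|^β) dξ`. The integral is real by symmetry in `ξ`. -/
def heatKernel {n : ℕ} (β t : ℝ) (x : EuclideanSpace ℝ (Fin n)) : ℝ :=
  (2 * Real.pi) ^ (-(n : ℝ)) *
    (∫ ξ : EuclideanSpace ℝ (Fin n),
      Complex.exp (Complex.I * ((inner ℝ x ξ : ℝ) : ℂ) - ((t * ‖ξ‖ ^ β : ℝ) : ℂ))).re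

/-- The fractional heat semigroup `S_β(t) v = S_β(·, t) ∗ v`, for `t > 0`. -/
def heatSemigroup {n : ℕ} (β t : ℝ) (v : EuclideanSpace ℝ (Fin n) → ℝ)
    (x : EuclideanSpace ℝ (Fin n)) : ℝ :=
  ∫ y, heatKernel β t (x - y) * v y

/-- A curve of elements of `L^s(ℝⁿ)` belongs to the Bochner space `L^∞((0,T), L^∞(ℝⁿ))`. -/
def MemLinftyLinfty {n : ℕ} {s : ℝ} (T : ℝ)
    (u : ℝ → Lp ℝ (ENNReal.ofReal s) (volume : Measure (EuclideanSpace ℝ (Fin n)))) : Prop :=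
  ∃ v : ℝ → Lp ℝ ∞ (volume : Measure (EuclideanSpace ℝ (Fin n))),
    MemLp v ∞ (volume.restrict (Ioo 0 T)) ∧
      ∀ᵐ t ∂(volume.restrict (Ioo 0 T)), (u t : EuclideanSpace ℝ (Fin n) → ℝ) =ᵐ[volume] v t

/-- `u` is a mild solution on `[0,T]`, in `C([0,T], L^s(ℝⁿ)) ∩ L^∞((0,T), L^∞(ℝⁿ))`, of
`u_t + (-Δ)^{β/2} u = I_α(|u|^p)`, `u(0) = u₀`. Only the values of `u` on `[0,T]` matter. The
time integral in the Duhamel formula is a Bochner integral in `L^s(ℝⁿ)`; its integrand `F` is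
determined almost everywhere by the first condition on it. -/
structure IsMildSolution {n : ℕ} (α β p s : ℝ) [Fact (1 ≤ ENNReal.ofReal s)]
    (u₀ : EuclideanSpace ℝ (Fin n) → ℝ) (T : ℝ)
    (u : ℝ → Lp ℝ (ENNReal.ofReal s) (volume : Measure (EuclideanSpace ℝ (Fin n)))) : Prop where
  continuousOn : ContinuousOn u (Icc 0 T)
  memLinfty : MemLinftyLinfty T u
  initial : (u 0 : EuclideanSpace ℝ (Fin n) → ℝ) =ᵐ[volume] u₀
  duhamel : ∀ t ∈ Ioc 0 T,
    ∃ F : ℝ → Lp ℝ (ENNReal.ofReal s) (volume : Measure (EuclideanSpace ℝ (Fin n))),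
      (∀ᵐ τ ∂(volume.restrict (Ioo 0 t)),
        (F τ : EuclideanSpace ℝ (Fin n) → ℝ) =ᵐ[volume]
          heatSemigroup β (t - τ) (rieszPotential α (fun y => |u τ y| ^ p))) ∧
      IntervalIntegrable F volume 0 t ∧
      (u t : EuclideanSpace ℝ (Fin n) → ℝ) =ᵐ[volume]
        fun x => heatSemigroup β t u₀ x + (∫ τ in (0 : ℝ)..t, F τ) x

/-- `u` is the maximal mild solution, with maximal existence time `Tmax ∈ (0, ∞]`: it is a mild
solution on `[0,T]` for all `0 < T < Tmax`, and every mild solution on some `[0,T]` is a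
restriction of it. -/
structure IsMaximalMildSolution {n : ℕ} (α β p s : ℝ) [Fact (1 ≤ ENNReal.ofReal s)]
    (u₀ : EuclideanSpace ℝ (Fin n) → ℝ) (Tmax : ℝ≥0∞)
    (u : ℝ → Lp ℝ (ENNReal.ofReal s) (volume : Measure (EuclideanSpace ℝ (Fin n)))) : Prop where
  pos : 0 < Tmax
  isMildSolution : ∀ T : ℝ, 0 < T → ENNReal.ofReal T < Tmax → IsMildSolution α β p s u₀ T u
  maximal : ∀ T : ℝ, 0 < T →
    ∀ v : ℝ → Lp ℝ (ENNReal.ofReal s) (volume : Measure (EuclideanSpace ℝ (Fin n))),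
      IsMildSolution α β p s u₀ T v → ENNReal.ofReal T < Tmax ∧ EqOn v u (Icc 0 T)

end RieszHeat

end

/-! The equation is solved by Picard iteration in `L^s`, with the `L^∞` bound carried as a
constraint rather than as part of the norm. Let `B(M)` be the set of `u ∈ L^s` with `‖u‖_s ≤ M` and
`|u| ≤ M` almost everywhere. It is convex and closed in `L^s`. Three facts suffice: the heat
semigroup is a strongly continuous contraction semigroup on `L^s` preserving each `B(M)`; `N(u) =
I_α(|u|^p)` is Lipschitz in the `L^s` norm on each `B(M)`; and `N` maps `B(M)` into some `B(C)`.
From these alone, `SemilinearProblem` yields local existence on a time depending only on `M`,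
uniqueness, and a maximal solution. A solution found in `B(M)` at a time too close to a finite
`Tmax` could be prolonged past it, so it eventually leaves every ball; hence a limit, and not only a
limsup, in the blow-up alternative.

The semigroup facts follow from the kernel being a probability density. Nonnegativity comes from
`r^γ`, `γ = β/2 ≤ 1`, being a limit of functions `a - J(r)` with `J` the Laplace transform of a
positive density of mass `a`; then `exp(-c(a - J))` is a limit of polynomials in `J` with
nonnegative coefficients, and Gaussians have positive Fourier transforms (`IsPositiveProfile`).
Fatou's lemma gives integrability, and Fourier inversion gives mass one and the semigroup law.

For `N`, the Riesz kernel is cut at radius one. The near part is in `L^1`; the far part is in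
`L^{1/(1-θ)}` when `θ > α/n`. If also `sθ ≤ p-1`, then `|u|^{p-1} ∈ L^{1/θ}`, so Hölder puts `|u|^p
- |v|^p` in `L^q` with `1/q = 1/s + θ`, and Young returns to `L^s`. The two bounds on `s` say
exactly that a suitable `θ` exists (`exists_admissible`).

It remains to match the abstract solutions with `IsMildSolution`. An essential bound in time holds
at all times since the constraint is closed in `L^s`; conversely, measurability into `L^∞` follows
from continuity into `L^∞` at positive times. Nonnegativity is read off from the Duhamel formula,
since `N(u) ≥ 0` whatever the sign of `u`. -/

noncomputable section

/-! ### Abstract semilinear evolution problems: Duhamel formula and uniqueness -/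

namespace RieszHeat

/-- A semilinear evolution problem `∂ₜu + A u = N(u)` in a Banach space: `S` is the contraction
semigroup generated by `-A`, and `B M` is a scale of bounded closed convex sets on which the
nonlinearity `N` is Lipschitz. -/
structure SemilinearProblem (E : Type*) [NormedAddCommGroup E] [NormedSpace ℝ E] where
  S : ℝ → E →L[ℝ] E
  B : ℝ → Set E
  N : E → E
  S_zero : ∀ x, S 0 x = x
  S_add : ∀ a b, 0 ≤ a → 0 ≤ b → ∀ x, S (a + b) x = S a (S b x)
  continuous_S : Continuous fun q : ℝ × E => S q.1 q.2
  norm_S_le : ∀ t x, ‖S t x‖ ≤ ‖x‖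
  isClosed_B : ∀ M, IsClosed (B M)
  convex_B : ∀ M, Convex ℝ (B M)
  mono_B : ∀ a b, a ≤ b → B a ⊆ B b
  zero_mem_B : ∀ M, 0 ≤ M → (0 : E) ∈ B M
  add_mem_B : ∀ a b x y, x ∈ B a → y ∈ B b → x + y ∈ B (a + b)
  smul_mem_B : ∀ c a x, 0 ≤ c → x ∈ B a → c • x ∈ B (c * a)
  S_mem_B : ∀ t a x, x ∈ B a → S t x ∈ B a
  lipschitz_N : ∀ M, ∃ L, 0 ≤ L ∧ ∀ x ∈ B M, ∀ y ∈ B M, ‖N x - N y‖ ≤ L * ‖x - y‖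
  N_mem_B : ∀ M, ∃ C, 0 ≤ C ∧ ∀ x ∈ B M, N x ∈ B C

namespace SemilinearProblem

variable {E : Type*} [NormedAddCommGroup E] [NormedSpace ℝ E] (P : SemilinearProblem E)

/-- Bounded continuous solutions of the Duhamel equation on `[0,T]`. -/
structure IsMild (u₀ : E) (T : ℝ) (u : ℝ → E) : Prop where
  continuousOn : ContinuousOn u (Icc 0 T)
  bounded : ∃ M, ∀ t ∈ Icc 0 T, u t ∈ P.B M
  duhamel : ∀ t ∈ Icc 0 T, u t = P.S t u₀ + ∫ τ in (0 : ℝ)..t, P.S (t - τ) (P.N (u τ))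

variable {P}

lemma continuousOn_N (M : ℝ) : ContinuousOn P.N (P.B M) := by
  obtain ⟨L, hL0, hL⟩ := P.lipschitz_N M
  lift L to NNReal using hL0
  exact (LipschitzOnWith.of_dist_le_mul (K := L) fun x hx y hy => by
    simpa [dist_eq_norm] using hL x hx y hy).continuousOn

lemma continuous_S_apply (x : E) : Continuous fun t => P.S t x :=
  P.continuous_S.comp (by fun_prop : Continuous fun t : ℝ => (t, x))

lemma continuousOn_S_comp {f : ℝ → E} {s : Set ℝ} (hf : ContinuousOn f s) (t : ℝ) :
    ContinuousOn (fun τ => P.S (t - τ) (f τ)) s :=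
  P.continuous_S.comp_continuousOn
    ((by fun_prop : ContinuousOn (fun τ : ℝ => t - τ) s).prodMk hf)

/-- Continuity of `S` on all of `ℝ × E`, negative times included, makes the integrand jointly
continuous without the restriction `τ ≤ t`. -/
lemma continuous_duhamel {f : ℝ → E} (hf : Continuous f) :
    Continuous fun t => ∫ τ in (0 : ℝ)..t, P.S (t - τ) (f τ) :=
  intervalIntegral.continuous_parametric_intervalIntegral_of_continuous
    (f := fun t τ => P.S (t - τ) (f τ))
    (P.continuous_S.comp (by fun_prop : Continuous fun q : ℝ × ℝ => (q.1 - q.2, f q.2)))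
    continuous_id

/-- The average of `g` stays in the closed convex set `B C`, and the integral is the average times
`b - a`. This is how a constraint unrelated to the norm of `E` passes through a Bochner integral. -/
lemma integral_mem_B [CompleteSpace E] {a b C : ℝ} (hab : a ≤ b) {g : ℝ → E}
    (hg : ∀ τ ∈ Ioc a b, g τ ∈ P.B C) (hi : IntervalIntegrable g volume a b) :
    ∫ τ in a..b, g τ ∈ P.B ((b - a) * C) := by
  rcases hab.eq_or_lt with rfl | hab
  · simpa using P.zero_mem_B 0 le_rfl
  have h := (P.convex_B C).set_average_mem (P.isClosed_B C) (μ := volume) (t := Ioc a b)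
    (f := g) (by simp [hab]) (by simp) ((ae_restrict_iff' measurableSet_Ioc).2
      (Eventually.of_forall hg)) hi.1
  rw [setAverage_eq, ← intervalIntegral.integral_of_le hab.le] at h
  have h2 := P.smul_mem_B (b - a) C _ (by linarith) h
  simpa [smul_smul, hab.le, sub_ne_zero.2 hab.ne'] using h2

namespace IsMild

variable {u₀ : E} {T : ℝ} {u v : ℝ → E}

lemma mono (h : P.IsMild u₀ T u) {T' : ℝ} (hT : T' ≤ T) : P.IsMild u₀ T' u where
  continuousOn := h.continuousOn.mono (Icc_subset_Icc_right hT)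
  bounded := h.bounded.imp fun _ hM t ht => hM t (Icc_subset_Icc_right hT ht)
  duhamel t ht := h.duhamel t (Icc_subset_Icc_right hT ht)

lemma congr (h : P.IsMild u₀ T u) (huv : EqOn u v (Icc 0 T)) : P.IsMild u₀ T v where
  continuousOn := h.continuousOn.congr huv.symm
  bounded := h.bounded.imp fun _ hM t ht => huv ht ▸ hM t ht
  duhamel t ht := by
    rw [← huv ht, h.duhamel t ht]
    congr 1
    refine intervalIntegral.integral_congr fun τ hτ => ?_
    rw [uIcc_of_le ht.1] at hτ
    simp only [huv ⟨hτ.1, hτ.2.trans ht.2⟩]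

lemma apply_zero (h : P.IsMild u₀ T u) (hT : 0 ≤ T) : u 0 = u₀ := by
  simpa [P.S_zero] using h.duhamel 0 ⟨le_rfl, hT⟩

lemma continuousOn_N (h : P.IsMild u₀ T u) : ContinuousOn (fun t => P.N (u t)) (Icc 0 T) := by
  obtain ⟨M, hM⟩ := h.bounded
  exact (SemilinearProblem.continuousOn_N M).comp h.continuousOn hM

lemma intervalIntegrable (h : P.IsMild u₀ T u) (r : ℝ) {a b : ℝ} (ha : a ∈ Icc 0 T)
    (hb : b ∈ Icc 0 T) :
    IntervalIntegrable (fun τ => P.S (r - τ) (P.N (u τ))) volume a b :=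
  ((continuousOn_S_comp h.continuousOn_N r).mono
    (ordConnected_Icc.uIcc_subset ha hb)).intervalIntegrable

/-- The semigroup law absorbs `S t` into the Duhamel formula at time `a`. Both restarting and gluing
reduce to this identity and additivity of the integral. -/
lemma S_apply [CompleteSpace E] (h : P.IsMild u₀ T u) {a t : ℝ} (ha : a ∈ Icc 0 T)
    (ht : 0 ≤ t) :
    P.S t (u a) = P.S (a + t) u₀ + ∫ τ in (0 : ℝ)..a, P.S (a + t - τ) (P.N (u τ)) := by
  rw [h.duhamel a ha, map_add, ← P.S_add t a ht ha.1, add_comm t a,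
    ← ContinuousLinearMap.intervalIntegral_comp_comm _
      (h.intervalIntegrable a ⟨le_rfl, ha.1.trans ha.2⟩ ha)]
  congr 1
  refine intervalIntegral.integral_congr fun τ hτ => ?_
  rw [uIcc_of_le ha.1] at hτ
  rw [← P.S_add t (a - τ) ht (by linarith [hτ.2])]
  congr 2
  ring

lemma shift [CompleteSpace E] (h : P.IsMild u₀ T u) {a : ℝ} (ha : a ∈ Icc 0 T) :
    P.IsMild (u a) (T - a) (fun t => u (a + t)) where
  continuousOn := h.continuousOn.comp (by fun_prop) fun t ht =>
    ⟨by linarith [ha.1, ht.1], by linarith [ht.2]⟩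
  bounded := h.bounded.imp fun _ hM t ht => hM _ ⟨by linarith [ha.1, ht.1], by linarith [ht.2]⟩
  duhamel t ht := by
    have h1 : a + t ∈ Icc 0 T := ⟨by linarith [ha.1, ht.1], by linarith [ht.2]⟩
    have h0 : (0 : ℝ) ∈ Icc 0 T := ⟨le_rfl, ha.1.trans ha.2⟩
    rw [h.duhamel _ h1, h.S_apply ha ht.1, add_assoc]
    congr 1
    rw [← intervalIntegral.integral_add_adjacent_intervals
      (h.intervalIntegrable (a + t) h0 ha) (h.intervalIntegrable (a + t) ha h1)]
    congr 1
    have := intervalIntegral.integral_comp_add_left (a := 0) (b := t)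
      (fun τ => P.S (a + t - τ) (P.N (u τ))) a
    rw [add_zero] at this
    rw [← this]
    congr 1
    ext τ
    congr 2
    ring

/-- By `S_apply`, the term `S (t - T) (u T)` contributes the Duhamel integral over `[0,T]`, and `w`
contributes the one over `[T,t]`. The two branches agree at `T` because `w 0 = u T`. -/
lemma glue [CompleteSpace E] (h : P.IsMild u₀ T u) (hT : 0 ≤ T) {δ : ℝ} (hδ : 0 ≤ δ)
    {w : ℝ → E} (hw : P.IsMild (u T) δ w) :
    P.IsMild u₀ (T + δ) (fun t => if t ≤ T then u t else w (t - T)) := by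
  set v : ℝ → E := fun t => if t ≤ T then u t else w (t - T) with hv
  have h1 : EqOn v u (Icc 0 T) := fun t ht => by simp [hv, ht.2]
  have h2 : EqOn v (fun t => w (t - T)) (Icc T (T + δ)) := fun t ht => by
    rcases ht.1.eq_or_lt with rfl | hlt
    · simp [hv, hw.apply_zero hδ]
    · simp [hv, not_le.2 hlt]
  have hun : Icc 0 (T + δ) = Icc 0 T ∪ Icc T (T + δ) :=
    (Icc_union_Icc_eq_Icc hT (by linarith)).symm
  have hmaps : ∀ t ∈ Icc T (T + δ), t - T ∈ Icc 0 δ := fun t ht =>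
    ⟨by linarith [ht.1], by linarith [ht.2]⟩
  refine ⟨?_, ?_, fun t ht => ?_⟩
  · rw [hun]
    refine ContinuousOn.union_of_isClosed (h.continuousOn.congr h1) ?_ isClosed_Icc isClosed_Icc
    exact (hw.continuousOn.comp (by fun_prop) hmaps).congr h2
  · obtain ⟨M, hM⟩ := h.bounded
    obtain ⟨M', hM'⟩ := hw.bounded
    refine ⟨max M M', fun t ht => ?_⟩
    rw [hun] at ht
    rcases ht with ht | ht
    · exact h1 ht ▸ P.mono_B _ _ (le_max_left _ _) (hM t ht)
    · exact h2 ht ▸ P.mono_B _ _ (le_max_right _ _) (hM' _ (hmaps t ht))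
  · rcases le_total t T with htT | htT
    · exact (h.congr h1.symm).duhamel t ⟨ht.1, htT⟩
    · have ht' : t ∈ Icc T (T + δ) := ⟨htT, ht.2⟩
      have hTT : T ∈ Icc 0 T := ⟨hT, le_rfl⟩
      rw [h2 ht']
      simp only
      rw [hw.duhamel _ (hmaps t ht'), h.S_apply hTT (by linarith), add_assoc]
      have e1 : T + (t - T) = t := by ring
      rw [e1]
      congr 1
      have i1 : IntervalIntegrable (fun τ => P.S (t - τ) (P.N (v τ))) volume 0 T :=
        (h.congr h1.symm).intervalIntegrable t ⟨le_rfl, hT⟩ hTT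
      have e2 : EqOn (fun τ => P.S (t - τ) (P.N (w (τ - T)))) (fun τ => P.S (t - τ) (P.N (v τ)))
          (Icc T t) := fun τ hτ => by simp only [h2 ⟨hτ.1, hτ.2.trans ht.2⟩]
      have i2 : IntervalIntegrable (fun τ => P.S (t - τ) (P.N (v τ))) volume T t := by
        refine ContinuousOn.intervalIntegrable ?_
        rw [uIcc_of_le htT]
        refine ContinuousOn.congr ?_ e2.symm
        exact continuousOn_S_comp (hw.continuousOn_N.comp (by fun_prop)
          fun τ hτ => ⟨by linarith [hτ.1], by linarith [hτ.2, ht.2]⟩) t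
      rw [← intervalIntegral.integral_add_adjacent_intervals i1 i2]
      congr 1
      · refine intervalIntegral.integral_congr fun τ hτ => ?_
        rw [uIcc_of_le hT] at hτ
        simp only [h1 hτ]
      · have := intervalIntegral.integral_comp_sub_right (a := T) (b := t)
          (fun τ => P.S (t - T - τ) (P.N (w τ))) T
        rw [sub_self] at this
        rw [← this]
        refine intervalIntegral.integral_congr fun τ hτ => ?_
        rw [uIcc_of_le htT] at hτ
        simpa only [sub_sub_sub_cancel_right] using e2 hτ

/-- After a restart at `a`, the difference is a Duhamel integral of length `t - a` with integrand in
a fixed `B C`. In the application this is a sup-norm estimate, small as `t - a → 0`. -/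
lemma exists_sub_S_mem_B [CompleteSpace E] (h : P.IsMild u₀ T u) :
    ∃ C, 0 ≤ C ∧ ∀ a t, 0 ≤ a → a ≤ t → t ≤ T → u t - P.S (t - a) (u a) ∈ P.B ((t - a) * C) := by
  obtain ⟨M, hM⟩ := h.bounded
  obtain ⟨C, hC0, hC⟩ := P.N_mem_B M
  refine ⟨C, hC0, fun a t ha hat htT => ?_⟩
  have haT : a ∈ Icc 0 T := ⟨ha, hat.trans htT⟩
  have h' := h.shift haT
  have ht : t - a ∈ Icc 0 (T - a) := ⟨by linarith, by linarith⟩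
  have e := h'.duhamel (t - a) ht
  rw [add_sub_cancel] at e
  rw [e, add_sub_cancel_left]
  have := integral_mem_B (P := P) ht.1 (C := C) (fun τ hτ => P.S_mem_B _ _ _ (hC _ (hM (a + τ)
    ⟨by linarith [hτ.1], by linarith [hτ.2]⟩))) (h'.intervalIntegrable (t - a) ⟨le_rfl, by
      linarith⟩ ht)
  rwa [sub_zero] at this

/-- Uniqueness of mild solutions, by iterating the Duhamel estimate. -/
lemma unique (hu : P.IsMild u₀ T u) (hv : P.IsMild u₀ T v) : EqOn u v (Icc 0 T) := by
  obtain ⟨M₁, hM₁⟩ := hu.bounded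
  obtain ⟨M₂, hM₂⟩ := hv.bounded
  obtain ⟨L, hL0, hL⟩ := P.lipschitz_N (max M₁ M₂)
  have hlip : ∀ t ∈ Icc 0 T, ‖P.N (u t) - P.N (v t)‖ ≤ L * ‖u t - v t‖ := fun t ht =>
    hL _ (P.mono_B _ _ (le_max_left _ _) (hM₁ t ht)) _
      (P.mono_B _ _ (le_max_right _ _) (hM₂ t ht))
  obtain ⟨K, hK⟩ := isCompact_Icc.exists_bound_of_continuousOn
    (hu.continuousOn.sub hv.continuousOn)
  -- Each use of the Duhamel formula integrates the previous bound once more, so the factorial beats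
  -- any Lipschitz constant and `T` need not be small.
  have key : ∀ k : ℕ, ∀ t ∈ Icc 0 T, ‖u t - v t‖ ≤ K * ((L * t) ^ k / k.factorial) := by
    intro k
    induction k with
    | zero => intro t ht; simpa using hK t ht
    | succ k ih =>
      intro t ht
      have h0 : (0 : ℝ) ∈ Icc 0 T := ⟨le_rfl, ht.1.trans ht.2⟩
      have e : u t - v t = ∫ τ in (0 : ℝ)..t, P.S (t - τ) (P.N (u τ) - P.N (v τ)) := by
        simp only [map_sub]
        rw [intervalIntegral.integral_sub (hu.intervalIntegrable t h0 ht)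
          (hv.intervalIntegrable t h0 ht), hu.duhamel t ht, hv.duhamel t ht]
        abel
      rw [e]
      have hb : ∀ τ ∈ Ioc 0 t, ‖P.S (t - τ) (P.N (u τ) - P.N (v τ))‖ ≤
          L * (K * ((L * τ) ^ k / k.factorial)) := fun τ hτ => by
        have hτ' : τ ∈ Icc 0 T := ⟨hτ.1.le, hτ.2.trans ht.2⟩
        exact (P.norm_S_le _ _).trans ((hlip τ hτ').trans
          (mul_le_mul_of_nonneg_left (ih τ hτ') hL0))
      refine (intervalIntegral.norm_integral_le_of_norm_le ht.1
        (Eventually.of_forall hb) (Continuous.intervalIntegrable (by fun_prop) _ _)).trans_eq ?_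
      have : ∀ τ : ℝ, L * (K * ((L * τ) ^ k / k.factorial)) =
          (L * K * L ^ k / k.factorial) * τ ^ k := fun τ => by rw [mul_pow]; ring
      simp only [this]
      rw [intervalIntegral.integral_const_mul, integral_pow, Nat.factorial_succ, mul_pow]
      have hk : ((k : ℝ) + 1) ≠ 0 := by positivity
      have hf : (k.factorial : ℝ) ≠ 0 := by positivity
      push_cast
      field_simp
      ring
  intro t ht
  have hlim : Tendsto (fun k : ℕ => K * ((L * t) ^ k / k.factorial)) atTop (𝓝 (K * 0)) :=
    (FloorSemiring.tendsto_pow_div_factorial_atTop (L * t)).const_mul K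
  rw [mul_zero] at hlim
  exact sub_eq_zero.1 (norm_le_zero_iff.1 (ge_of_tendsto' hlim fun k => key k t ht))

end IsMild

/-! ### Picard iteration, continuation and blow-up -/

section Existence

variable (P)

/-- The Duhamel map on continuous curves over `[0,T]`. -/
def duhamelMap {T : ℝ} (hT : 0 ≤ T) (M : ℝ) (u₀ : E)
    (φ : {φ : C(Icc (0 : ℝ) T, E) // ∀ t, φ t ∈ P.B M}) : C(Icc (0 : ℝ) T, E) where
  -- `projIcc` extends the curve to `ℝ` by its endpoint values, so the integrand is continuous
  -- everywhere; for `t ∈ [0,T]` only the original values enter.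
  toFun t := P.S t u₀ + ∫ τ in (0 : ℝ)..t, P.S (t - τ) (P.N (φ.1 (projIcc 0 T hT τ)))
  continuous_toFun := by
    have h1 : Continuous fun τ => P.N (φ.1 (projIcc 0 T hT τ)) := by
      rw [← continuousOn_univ]
      exact (SemilinearProblem.continuousOn_N M).comp
        (by fun_prop : Continuous fun τ => φ.1 (projIcc 0 T hT τ)).continuousOn
        fun τ _ => φ.2 _
    exact ((continuous_S_apply u₀).comp continuous_subtype_val).add
      ((continuous_duhamel h1).comp continuous_subtype_val)

lemma intervalIntegrable_duhamelMap {T : ℝ} (hT : 0 ≤ T) (M : ℝ)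
    (φ : {φ : C(Icc (0 : ℝ) T, E) // ∀ t, φ t ∈ P.B M}) (r a b : ℝ) :
    IntervalIntegrable (fun τ => P.S (r - τ) (P.N (φ.1 (projIcc 0 T hT τ)))) volume a b := by
  refine ContinuousOn.intervalIntegrable ((continuousOn_S_comp ?_ r))
  exact (SemilinearProblem.continuousOn_N M).comp
    (by fun_prop : Continuous fun τ => φ.1 (projIcc 0 T hT τ)).continuousOn fun τ _ => φ.2 _

variable [CompleteSpace E]

/-- Local existence, on a time interval whose length depends only on the size of the data. -/
lemma exists_isMild {M : ℝ} (hM : 0 ≤ M) :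
    ∃ T, 0 < T ∧ ∀ u₀ ∈ P.B M, ∃ u, P.IsMild u₀ T u := by
  obtain ⟨L, hL0, hL⟩ := P.lipschitz_N (M + 1)
  obtain ⟨C, hC0, hC⟩ := P.N_mem_B (M + 1)
  have hLC : 0 < L + C + 2 := by positivity
  -- `L` and `C` belong to the ball of radius `M + 1`. This `T` makes `T * L ≤ 1/2`, for the
  -- contraction, and `T * C ≤ 1`, so that the Duhamel integral fits in the unit of room above `M`.
  -- It does not depend on the datum, which is what continuation needs.
  set T : ℝ := 1 / (2 * (L + C + 2)) with hTdef
  have hT0 : 0 < T := by positivity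
  have hmul : T * (2 * (L + C + 2)) = 1 := by rw [hTdef]; field_simp
  have hTL : T * L ≤ 1 / 2 := by nlinarith [mul_nonneg hT0.le hC0]
  have hTC : T * C ≤ 1 := by nlinarith [mul_nonneg hT0.le hL0]
  refine ⟨T, hT0, fun u₀ hu₀ => ?_⟩
  let X := {φ : C(Icc (0 : ℝ) T, E) // ∀ t, φ t ∈ P.B (M + 1)}
  have hclosed : IsClosed {φ : C(Icc (0 : ℝ) T, E) | ∀ t, φ t ∈ P.B (M + 1)} := by
    simp only [ofPred_forall]
    exact isClosed_iInter fun t => (P.isClosed_B _).preimage (by fun_prop)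
  have : CompleteSpace X := hclosed.completeSpace_coe
  have : Nonempty X := ⟨⟨0, fun t => P.zero_mem_B _ (by linarith)⟩⟩
  have hmaps : ∀ φ : X, ∀ t, P.duhamelMap hT0.le (M + 1) u₀ φ t ∈ P.B (M + 1) := by
    intro φ t
    have h1 : ∫ τ in (0 : ℝ)..t, P.S (t - τ) (P.N (φ.1 (projIcc 0 T hT0.le τ))) ∈
        P.B ((t - 0) * C) :=
      integral_mem_B t.2.1 (fun τ _ => P.S_mem_B _ _ _ (hC _ (φ.2 _)))
        (P.intervalIntegrable_duhamelMap hT0.le _ φ _ _ _)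
    refine P.mono_B _ _ ?_ (P.add_mem_B _ _ _ _ (P.S_mem_B t _ _ hu₀) h1)
    have := mul_le_mul_of_nonneg_right t.2.2 hC0
    linarith
  let Φ : X → X := fun φ => ⟨P.duhamelMap hT0.le (M + 1) u₀ φ, hmaps φ⟩
  have hcontr : ContractingWith (1 / 2) Φ := by
    refine ⟨by simpa using NNReal.half_lt_self one_ne_zero,
      LipschitzWith.of_dist_le_mul fun φ ψ => ?_⟩
    rw [Subtype.dist_eq, ContinuousMap.dist_le (by positivity)]
    intro t
    simp only [Φ, duhamelMap, ContinuousMap.coe_mk]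
    rw [dist_eq_norm, add_sub_add_left_eq_sub, ← intervalIntegral.integral_sub
      (P.intervalIntegrable_duhamelMap hT0.le _ φ _ _ _)
      (P.intervalIntegrable_duhamelMap hT0.le _ ψ _ _ _)]
    have hb : ∀ τ ∈ uIoc 0 (t : ℝ), ‖P.S (t - τ) (P.N (φ.1 (projIcc 0 T hT0.le τ))) -
        P.S (t - τ) (P.N (ψ.1 (projIcc 0 T hT0.le τ)))‖ ≤ L * dist φ ψ := fun τ _ => by
      rw [← map_sub]
      refine (P.norm_S_le _ _).trans ((hL _ (φ.2 _) _ (ψ.2 _)).trans ?_)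
      rw [← dist_eq_norm]
      exact mul_le_mul_of_nonneg_left (ContinuousMap.dist_apply_le_dist _) hL0
    refine (intervalIntegral.norm_integral_le_of_norm_le_const hb).trans ?_
    rw [sub_zero, abs_of_nonneg t.2.1]
    have h2 : L * (t : ℝ) ≤ 1 / 2 :=
      (mul_le_mul_of_nonneg_left t.2.2 hL0).trans (by linarith)
    calc L * dist φ ψ * t = (L * t) * dist φ ψ := by ring
      _ ≤ (1 / 2) * dist φ ψ := mul_le_mul_of_nonneg_right h2 dist_nonneg
      _ = _ := by norm_num
  let φ : X := hcontr.fixedPoint Φ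
  have hφ : ∀ t, φ.1 t = P.duhamelMap hT0.le (M + 1) u₀ φ t := fun t => by
    have : Φ φ = φ := hcontr.fixedPoint_isFixedPt
    conv_lhs => rw [← this]
  refine ⟨fun t => φ.1 (projIcc 0 T hT0.le t), Continuous.continuousOn ?_,
    ⟨M + 1, fun t _ => φ.2 _⟩, fun t ht => ?_⟩
  · exact φ.1.continuous.comp continuous_projIcc
  rw [projIcc_of_mem hT0.le ht, hφ]
  rfl

/-- Existence of a maximal solution, and the blow-up alternative. -/
lemma exists_maximal {M₀ : ℝ} (hM₀ : 0 ≤ M₀) {u₀ : E} (hu₀ : u₀ ∈ P.B M₀) :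
    ∃ Tmax : ℝ≥0∞, ∃ U : ℝ → E, 0 < Tmax ∧
      (∀ T, 0 < T → ENNReal.ofReal T < Tmax → P.IsMild u₀ T U) ∧
      (∀ T, 0 < T → ∀ v, P.IsMild u₀ T v → ENNReal.ofReal T < Tmax ∧ EqOn v U (Icc 0 T)) ∧
      (Tmax < ∞ → ∀ M, 0 ≤ M → ∀ᶠ t in 𝓝[<] Tmax.toReal, U t ∉ P.B M) := by
  classical
  let A : Set ℝ := {T | 0 < T ∧ ∃ u, P.IsMild u₀ T u}
  let Q : ℝ → (ℝ → E) → Prop := fun t u => ∃ T, t ≤ T ∧ P.IsMild u₀ T u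
  -- The value at `t` of any solution reaching `t`; uniqueness makes the choice immaterial. The
  -- default `0` is used only at times no solution reaches.
  let U : ℝ → E := fun t => if h : ∃ u, Q t u then h.choose t else 0
  let Tmax : ℝ≥0∞ := ⨆ T ∈ A, ENNReal.ofReal T
  have hU : ∀ T v, P.IsMild u₀ T v → EqOn v U (Icc 0 T) := by
    intro T v hv t ht
    have hex : ∃ u, Q t u := ⟨v, T, ht.2, hv⟩
    obtain ⟨T', hT', hu⟩ := hex.choose_spec
    have : U t = hex.choose t := dif_pos hex
    rw [this]
    exact (hv.mono ht.2).unique (hu.mono hT') ⟨ht.1, le_rfl⟩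
  -- A solution in `B M` at time `T` can be prolonged by the step `δ` attached to `M`.
  have hext : ∀ T, 0 ≤ T → ∀ v, P.IsMild u₀ T v → ∀ M, 0 ≤ M → ∀ δ, 0 < δ →
      (∀ x ∈ P.B M, ∃ u, P.IsMild x δ u) → v T ∈ P.B M →
      ENNReal.ofReal (T + δ) ≤ Tmax := by
    intro T hT v hv M hM δ hδ hex hvT
    obtain ⟨w, hw⟩ := hex _ hvT
    exact le_iSup₂ (f := fun T (_ : T ∈ A) => ENNReal.ofReal T) (T + δ)
      ⟨by linarith, _, hv.glue hT hδ.le hw⟩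
  have hlt : ∀ T, 0 < T → ∀ v, P.IsMild u₀ T v → ENNReal.ofReal T < Tmax := by
    intro T hT v hv
    obtain ⟨M, hM⟩ := hv.bounded
    have hx := P.mono_B _ _ (le_max_left M 0) (hM T ⟨hT.le, le_rfl⟩)
    have hM' : 0 ≤ max M 0 := le_max_right _ _
    obtain ⟨δ, hδ, hex⟩ := P.exists_isMild hM'
    refine lt_of_lt_of_le ?_ (hext T hT.le v hv _ hM' δ hδ hex hx)
    exact (ENNReal.ofReal_lt_ofReal_iff (by linarith)).2 (by linarith)
  have hmild : ∀ T, ENNReal.ofReal T < Tmax → P.IsMild u₀ T U := by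
    intro T hT
    obtain ⟨T', hT'A, hTT'⟩ : ∃ T' ∈ A, ENNReal.ofReal T < ENNReal.ofReal T' := by
      simpa [Tmax, lt_iSup_iff] using hT
    obtain ⟨hT'0, v, hv⟩ := hT'A
    have := (ENNReal.ofReal_lt_ofReal_iff hT'0).1 hTT'
    exact (hv.congr (hU _ _ hv)).mono this.le
  have hpos : 0 < Tmax := by
    obtain ⟨T, hT, hex⟩ := P.exists_isMild hM₀
    obtain ⟨v, hv⟩ := hex u₀ hu₀
    exact lt_of_le_of_lt zero_le (hlt T hT v hv)
  refine ⟨Tmax, U, hpos, fun T _ hT => hmild T hT, fun T hT v hv => ⟨hlt T hT v hv, hU T v hv⟩,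
    fun hfin M hM => ?_⟩
  obtain ⟨δ, hδ, hex⟩ := P.exists_isMild hM
  have hpos' : 0 < Tmax.toReal := ENNReal.toReal_pos hpos.ne' hfin.ne
  have hnhds : Ioo (max 0 (Tmax.toReal - δ)) Tmax.toReal ∈ 𝓝[<] Tmax.toReal :=
    Ioo_mem_nhdsLT (max_lt hpos' (by linarith))
  -- Being in `B M` at a time later than `Tmax - δ` would give a solution beyond `Tmax`.
  filter_upwards [hnhds] with t ht htB
  have ht0 : 0 < t := lt_of_le_of_lt (le_max_left _ _) ht.1
  have htδ : Tmax.toReal - δ < t := lt_of_le_of_lt (le_max_right _ _) ht.1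
  have h1 : ENNReal.ofReal t < Tmax := by
    rw [← ENNReal.ofReal_toReal hfin.ne]
    exact (ENNReal.ofReal_lt_ofReal_iff hpos').2 ht.2
  have h2 := hext t ht0.le U (hmild t h1) M hM δ hδ hex htB
  rw [← ENNReal.ofReal_toReal hfin.ne, ENNReal.ofReal_le_ofReal_iff hpos'.le] at h2
  linarith

end Existence

end SemilinearProblem

/-! ### Radial profiles with nonnegative Fourier transform -/

section PositiveDefinite

variable {V : Type*} [NormedAddCommGroup V] [InnerProductSpace ℝ V] [FiniteDimensional ℝ V]
  [MeasurableSpace V] [BorelSpace V]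

lemma integrable_exp_neg_mul_sq_norm {δ : ℝ} (hδ : 0 < δ) :
    Integrable (fun ξ : V => Real.exp (-δ * ‖ξ‖ ^ 2)) := by
  have h := (GaussianFourier.integrable_cexp_neg_mul_sq_norm_add (V := V) (b := (δ : ℂ))
    (by simpa using hδ) 0 0).norm
  refine h.congr (Eventually.of_forall fun ξ => ?_)
  simp only [Complex.norm_exp]
  congr 1
  simp [← Complex.ofReal_pow]

lemma integral_cos_mul_exp_neg_mul_sq_norm {δ : ℝ} (hδ : 0 < δ) (x : V) :
    ∫ ξ : V, Real.cos (inner ℝ x ξ) * Real.exp (-δ * ‖ξ‖ ^ 2) =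
      (Real.pi / δ) ^ (Module.finrank ℝ V / 2 : ℝ) * Real.exp (-‖x‖ ^ 2 / (4 * δ)) := by
  have hb : 0 < ((δ : ℂ)).re := by simpa using hδ
  have h := GaussianFourier.integral_cexp_neg_mul_sq_norm_add (V := V) hb Complex.I x
  have hi := GaussianFourier.integrable_cexp_neg_mul_sq_norm_add (V := V) hb Complex.I x
  have h' := congrArg Complex.re h
  have h2 : (∫ v : V, Complex.exp (-(δ : ℂ) * ‖v‖ ^ 2 + Complex.I * (inner ℝ x v : ℝ))).re =
      ∫ v : V, (Complex.exp (-(δ : ℂ) * ‖v‖ ^ 2 + Complex.I * (inner ℝ x v : ℝ))).re :=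
    (integral_re hi).symm
  rw [h2] at h'
  refine Eq.trans ?_ (h'.trans ?_)
  · refine integral_congr_ae (Eventually.of_forall fun ξ => ?_)
    simp only [Complex.exp_re]
    rw [mul_comm]
    simp [← Complex.ofReal_pow]
  · have e1 : ((Real.pi : ℂ) / δ) ^ (Module.finrank ℝ V / 2 : ℂ) =
        (((Real.pi / δ) ^ (Module.finrank ℝ V / 2 : ℝ) : ℝ) : ℂ) := by
      rw [Complex.ofReal_cpow (by positivity)]
      push_cast
      rfl
    have e2 : Complex.exp (Complex.I ^ 2 * (‖x‖ : ℂ) ^ 2 / (4 * δ)) =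
        ((Real.exp (-‖x‖ ^ 2 / (4 * δ)) : ℝ) : ℂ) := by
      push_cast
      rw [Complex.I_sq]
      congr 1
      ring
    rw [e1, e2, ← Complex.ofReal_mul, Complex.ofReal_re]

variable (V) in
/-- Bounded radial profiles `φ` such that `φ(|ξ|²) exp(-δ|ξ|²)` has a nonnegative Fourier
transform on `V` for every `δ > 0`. -/
structure IsPositiveProfile (φ : ℝ → ℝ) : Prop where
  measurable : Measurable φ
  bounded : ∃ C, ∀ r, 0 ≤ r → |φ r| ≤ C
  nonneg : ∀ δ, 0 < δ → ∀ x : V,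
    0 ≤ ∫ ξ : V, Real.cos (inner ℝ x ξ) * (φ (‖ξ‖ ^ 2) * Real.exp (-δ * ‖ξ‖ ^ 2))

lemma integrable_cos_mul_profile {φ : ℝ → ℝ} (hφ : Measurable φ) {C : ℝ}
    (hC : ∀ r, 0 ≤ r → |φ r| ≤ C) {δ : ℝ} (hδ : 0 < δ) (x : V) :
    Integrable fun ξ : V =>
      Real.cos (inner ℝ x ξ) * (φ (‖ξ‖ ^ 2) * Real.exp (-δ * ‖ξ‖ ^ 2)) := by
  refine ((integrable_exp_neg_mul_sq_norm (V := V) hδ).const_mul C).mono'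
    (by fun_prop) (Eventually.of_forall fun ξ => ?_)
  rw [norm_mul, norm_mul, Real.norm_of_nonneg (Real.exp_nonneg _)]
  calc _ ≤ 1 * (C * Real.exp (-δ * ‖ξ‖ ^ 2)) := by
        gcongr
        · exact Real.abs_cos_le_one _
        · exact hC _ (by positivity)
    _ = _ := one_mul _

namespace IsPositiveProfile

lemma exp_neg_mul {t : ℝ} (ht : 0 ≤ t) : IsPositiveProfile V fun r => Real.exp (-t * r) where
  measurable := by fun_prop
  bounded := ⟨1, fun r hr => by
    rw [abs_of_nonneg (Real.exp_nonneg _), Real.exp_le_one_iff]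
    nlinarith [mul_nonneg ht hr]⟩
  nonneg δ hδ x := by
    have h := integral_cos_mul_exp_neg_mul_sq_norm (show 0 < t + δ by linarith) x
    have e : ∀ ξ : V, Real.exp (-t * ‖ξ‖ ^ 2) * Real.exp (-δ * ‖ξ‖ ^ 2) =
        Real.exp (-(t + δ) * ‖ξ‖ ^ 2) := fun ξ => by
      rw [← Real.exp_add]; congr 1; ring
    simp only [e, h]
    positivity

lemma one : IsPositiveProfile V fun _ => 1 := by
  simpa using exp_neg_mul (V := V) le_rfl

lemma add {φ ψ : ℝ → ℝ} (hφ : IsPositiveProfile V φ) (hψ : IsPositiveProfile V ψ) :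
    IsPositiveProfile V fun r => φ r + ψ r where
  measurable := hφ.measurable.add hψ.measurable
  bounded := by
    obtain ⟨C, hC⟩ := hφ.bounded
    obtain ⟨D, hD⟩ := hψ.bounded
    exact ⟨C + D, fun r hr => (abs_add_le _ _).trans (add_le_add (hC r hr) (hD r hr))⟩
  nonneg δ hδ x := by
    obtain ⟨C, hC⟩ := hφ.bounded
    obtain ⟨D, hD⟩ := hψ.bounded
    simp only [add_mul, mul_add]
    rw [integral_add (integrable_cos_mul_profile hφ.measurable hC hδ x)
      (integrable_cos_mul_profile hψ.measurable hD hδ x)]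
    exact add_nonneg (hφ.nonneg δ hδ x) (hψ.nonneg δ hδ x)

lemma const_mul {φ : ℝ → ℝ} (hφ : IsPositiveProfile V φ) {c : ℝ} (hc : 0 ≤ c) :
    IsPositiveProfile V fun r => c * φ r where
  measurable := hφ.measurable.const_mul c
  bounded := by
    obtain ⟨C, hC⟩ := hφ.bounded
    exact ⟨c * C, fun r hr => by
      rw [abs_mul, abs_of_nonneg hc]; exact mul_le_mul_of_nonneg_left (hC r hr) hc⟩
  nonneg δ hδ x := by
    have e : ∀ ξ : V, Real.cos (inner ℝ x ξ) * (c * φ (‖ξ‖ ^ 2) * Real.exp (-δ * ‖ξ‖ ^ 2)) =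
        c * (Real.cos (inner ℝ x ξ) * (φ (‖ξ‖ ^ 2) * Real.exp (-δ * ‖ξ‖ ^ 2))) :=
      fun ξ => by ring
    simp only [e, integral_const_mul]
    exact mul_nonneg hc (hφ.nonneg δ hδ x)

/-- The Gaussian factor in the definition supplies the dominating function `C exp(-δ|ξ|²)`, so
uniformly bounded pointwise limits are admissible with no decay of the profiles themselves. -/
lemma of_tendsto {φ : ℕ → ℝ → ℝ} {ψ : ℝ → ℝ} {C : ℝ}
    (hφ : ∀ᶠ k in atTop, IsPositiveProfile V (φ k))
    (hC : ∀ᶠ k in atTop, ∀ r, 0 ≤ r → |φ k r| ≤ C) (hψ : Measurable ψ)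
    (hlim : ∀ r, 0 ≤ r → Tendsto (fun k => φ k r) atTop (𝓝 (ψ r))) :
    IsPositiveProfile V ψ where
  measurable := hψ
  bounded := ⟨C, fun r hr => le_of_tendsto (hlim r hr).abs (hC.mono fun k hk => hk r hr)⟩
  nonneg δ hδ x := by
    refine ge_of_tendsto (f := fun k => ∫ ξ : V, Real.cos (inner ℝ x ξ) *
      (φ k (‖ξ‖ ^ 2) * Real.exp (-δ * ‖ξ‖ ^ 2))) ?_ (hφ.mono fun k hk => hk.nonneg δ hδ x)
    refine tendsto_integral_filter_of_dominated_convergence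
      (fun ξ => C * Real.exp (-δ * ‖ξ‖ ^ 2)) ?_ ?_
      ((integrable_exp_neg_mul_sq_norm (V := V) hδ).const_mul C) ?_
    · filter_upwards [hφ] with k hk
      have := hk.measurable
      fun_prop
    · filter_upwards [hC] with k hk
      refine Eventually.of_forall fun ξ => ?_
      rw [norm_mul, norm_mul, Real.norm_of_nonneg (Real.exp_nonneg _)]
      calc _ ≤ 1 * (C * Real.exp (-δ * ‖ξ‖ ^ 2)) := by
            gcongr
            · exact Real.abs_cos_le_one _
            · exact hk _ (by positivity)
        _ = _ := one_mul _
    · exact Eventually.of_forall fun ξ =>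
        ((hlim _ (by positivity)).mul_const _).const_mul _

/-- Multiplying by `exp(-l r)` only raises the Gaussian parameter from `δ` to `δ + l`, and
positivity is assumed for every parameter. Fubini then integrates over `l` against the nonnegative
weight. -/
lemma mul_laplace {φ w : ℝ → ℝ} (hφ : IsPositiveProfile V φ) {A : Set ℝ} (hA : MeasurableSet A)
    (hA0 : A ⊆ Ioi 0) (hw : IntegrableOn w A) (hw0 : ∀ l ∈ A, 0 ≤ w l) :
    IsPositiveProfile V fun r => (∫ l in A, Real.exp (-l * r) * w l) * φ r := by
  have hbd : ∀ r, 0 ≤ r → |∫ l in A, Real.exp (-l * r) * w l| ≤ ∫ l in A, ‖w l‖ := by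
    intro r hr
    refine norm_integral_le_of_norm_le (f := fun l => Real.exp (-l * r) * w l) hw.norm ?_
    refine (ae_restrict_iff' hA).2 (Eventually.of_forall fun l hl => ?_)
    rw [norm_mul, Real.norm_of_nonneg (Real.exp_nonneg _)]
    refine mul_le_of_le_one_left (norm_nonneg _) (Real.exp_le_one_iff.2 ?_)
    nlinarith [mul_nonneg (le_of_lt (hA0 hl)) hr]
  obtain ⟨C, hC⟩ := hφ.bounded
  have hC0 : 0 ≤ C := (abs_nonneg _).trans (hC 0 le_rfl)
  refine ⟨Measurable.mul ?_ hφ.measurable, ⟨(∫ l in A, ‖w l‖) * C, fun r hr => ?_⟩, ?_⟩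
  -- The weight is only almost everywhere measurable; a measurable representative has the same
  -- Laplace transform for every `r`.
  · obtain ⟨w', hw', hww'⟩ := hw.1
    have e : (fun r : ℝ => ∫ l in A, Real.exp (-l * r) * w l) =
        fun r : ℝ => ∫ l in A, Real.exp (-l * r) * w' l := by
      ext r
      refine integral_congr_ae ?_
      filter_upwards [hww'] with l hl
      rw [hl]
    rw [e]
    have := hw'.measurable
    exact (StronglyMeasurable.integral_prod_right (f := fun r l : ℝ => Real.exp (-l * r) * w' l)
      (Measurable.stronglyMeasurable (by fun_prop))).measurable
  · rw [abs_mul]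
    exact mul_le_mul (hbd r hr) (hC r hr) (abs_nonneg _)
      (integral_nonneg fun _ => norm_nonneg _)
  · intro δ hδ x
    have hint : Integrable (Function.uncurry fun (ξ : V) (l : ℝ) => Real.cos (inner ℝ x ξ) *
        (Real.exp (-l * ‖ξ‖ ^ 2) * w l * φ (‖ξ‖ ^ 2) * Real.exp (-δ * ‖ξ‖ ^ 2)))
        (volume.prod (volume.restrict A)) := by
      refine (((integrable_exp_neg_mul_sq_norm (V := V) hδ).const_mul C).mul_prod
        (Integrable.norm hw)).mono' ?_ ?_
      · have h1 : AEStronglyMeasurable (fun q : V × ℝ => w q.2)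
          (volume.prod (volume.restrict A)) := hw.1.comp_snd
        have h2 := hφ.measurable
        have m1 : Measurable fun q : V × ℝ => Real.cos (inner ℝ x q.1) := by fun_prop
        have m2 : Measurable fun q : V × ℝ => Real.exp (-q.2 * ‖q.1‖ ^ 2) := by fun_prop
        have m3 : Measurable fun q : V × ℝ => φ (‖q.1‖ ^ 2) := by fun_prop
        have m4 : Measurable fun q : V × ℝ => Real.exp (-δ * ‖q.1‖ ^ 2) := by fun_prop
        exact m1.aestronglyMeasurable.mul (((m2.aestronglyMeasurable.mul h1).mul
          m3.aestronglyMeasurable).mul m4.aestronglyMeasurable)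
      · have hae : ∀ᵐ q : V × ℝ ∂(volume.prod (volume.restrict A)), q.2 ∈ A := by
          exact Measure.quasiMeasurePreserving_snd.ae (ae_restrict_mem hA)
        filter_upwards [hae] with q hq
        simp only [Function.uncurry_def, norm_mul, Real.norm_of_nonneg (Real.exp_nonneg _)]
        have h1 : ‖Real.cos (inner ℝ x q.1)‖ ≤ 1 := Real.abs_cos_le_one _
        have h2 : Real.exp (-q.2 * ‖q.1‖ ^ 2) ≤ 1 := Real.exp_le_one_iff.2 (by
          nlinarith [mul_nonneg (le_of_lt (hA0 hq)) (sq_nonneg ‖q.1‖)])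
        have h3 : ‖φ (‖q.1‖ ^ 2)‖ ≤ C := hC _ (by positivity)
        calc _ ≤ 1 * (1 * ‖w q.2‖ * C * Real.exp (-δ * ‖q.1‖ ^ 2)) := by gcongr
          _ = _ := by ring
    have e1 : ∀ ξ : V, Real.cos (inner ℝ x ξ) * ((∫ l in A, Real.exp (-l * ‖ξ‖ ^ 2) * w l) *
        φ (‖ξ‖ ^ 2) * Real.exp (-δ * ‖ξ‖ ^ 2)) = ∫ l in A, Real.cos (inner ℝ x ξ) *
        (Real.exp (-l * ‖ξ‖ ^ 2) * w l * φ (‖ξ‖ ^ 2) * Real.exp (-δ * ‖ξ‖ ^ 2)) := fun ξ => by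
      rw [← integral_mul_const, ← integral_mul_const, ← integral_const_mul]
    simp only [e1]
    rw [integral_integral_swap hint]
    refine setIntegral_nonneg hA fun l hl => ?_
    have e2 : ∀ ξ : V, Real.cos (inner ℝ x ξ) *
        (Real.exp (-l * ‖ξ‖ ^ 2) * w l * φ (‖ξ‖ ^ 2) * Real.exp (-δ * ‖ξ‖ ^ 2)) =
        w l * (Real.cos (inner ℝ x ξ) * (φ (‖ξ‖ ^ 2) * Real.exp (-(δ + l) * ‖ξ‖ ^ 2))) :=
      fun ξ => by
        rw [show -(δ + l) * ‖ξ‖ ^ 2 = -l * ‖ξ‖ ^ 2 + -δ * ‖ξ‖ ^ 2 by ring, Real.exp_add]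
        ring
    simp only [e2, integral_const_mul]
    exact mul_nonneg (hw0 l hl) (hφ.nonneg _ (add_pos hδ (hA0 hl)) x)

end IsPositiveProfile

end PositiveDefinite

/-! ### Subordination: `exp(-t r^γ)` for `0 < γ ≤ 1` -/

section Stable

variable {γ : ℝ}

/-- Near `0` the factor `1 - e^{-l} ≤ l` leaves `l^{-γ}`, where `γ < 1` is needed; at infinity
`l^{-1-γ}` suffices, where `γ > 0` is needed. -/
lemma integrableOn_one_sub_exp_mul_rpow (hγ0 : 0 < γ) (hγ1 : γ < 1) :
    IntegrableOn (fun l : ℝ => (1 - Real.exp (-l)) * l ^ (-1 - γ)) (Ioi 0) := by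
  have hm : AEStronglyMeasurable (fun l : ℝ => (1 - Real.exp (-l)) * l ^ (-1 - γ)) volume :=
    Measurable.aestronglyMeasurable (by fun_prop)
  rw [← Ioc_union_Ioi_eq_Ioi (zero_le_one' ℝ)]
  refine IntegrableOn.union ?_ ?_
  · have h1 : IntegrableOn (fun l : ℝ => l ^ (-γ)) (Ioc 0 1) :=
      (intervalIntegral.intervalIntegrable_rpow' (a := 0) (b := 1) (by linarith)).1
    refine Integrable.mono' h1 hm.restrict ((ae_restrict_iff' measurableSet_Ioc).2
      (Eventually.of_forall fun l hl => ?_))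
    have hl0 : 0 < l := hl.1
    have h2 : 0 ≤ 1 - Real.exp (-l) := by
      rw [sub_nonneg, Real.exp_le_one_iff]; linarith
    have h3 : 1 - Real.exp (-l) ≤ l := by linarith [Real.add_one_le_exp (-l)]
    rw [Real.norm_of_nonneg (mul_nonneg h2 (by positivity))]
    calc _ ≤ l * l ^ (-1 - γ) := mul_le_mul_of_nonneg_right h3 (by positivity)
      _ = l ^ (-γ) := by
        rw [← Real.rpow_one_add' hl0.le (by ring_nf; linarith)]; congr 1; ring
  · have h1 : IntegrableOn (fun l : ℝ => l ^ (-1 - γ)) (Ioi 1) :=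
      integrableOn_Ioi_rpow_of_lt (by linarith) one_pos
    refine Integrable.mono' h1 hm.restrict ((ae_restrict_iff' measurableSet_Ioi).2
      (Eventually.of_forall fun l hl => ?_))
    have hl0 : 0 < l := one_pos.trans hl
    have h2 : 0 ≤ 1 - Real.exp (-l) := by
      rw [sub_nonneg, Real.exp_le_one_iff]; linarith
    rw [Real.norm_of_nonneg (mul_nonneg h2 (by positivity))]
    exact mul_le_of_le_one_left (by positivity) (by linarith [Real.exp_pos (-l)])

/-- The constant in `∫₀^∞ (1 - e^{-λr}) λ^{-1-γ} dλ = κ r^γ`. -/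
def stableConst (γ : ℝ) : ℝ := ∫ l in Ioi (0 : ℝ), (1 - Real.exp (-l)) * l ^ (-1 - γ)

lemma stableConst_pos (hγ0 : 0 < γ) (hγ1 : γ < 1) : 0 < stableConst γ := by
  have hpos : ∀ l ∈ Ioi (0 : ℝ), 0 < (1 - Real.exp (-l)) * l ^ (-1 - γ) := fun l hl =>
    mul_pos (by rw [sub_pos, Real.exp_lt_one_iff]; simpa using hl) (Real.rpow_pos_of_pos hl _)
  rw [stableConst, setIntegral_pos_iff_support_of_nonneg_ae
    ((ae_restrict_iff' measurableSet_Ioi).2 (Eventually.of_forall fun l hl => (hpos l hl).le))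
    (integrableOn_one_sub_exp_mul_rpow hγ0 hγ1)]
  rw [inter_eq_right.2 (show Ioi (0 : ℝ) ⊆ Function.support _ from fun l hl => (hpos l hl).ne')]
  simp

lemma integral_one_sub_exp_mul_rpow (hγ0 : 0 < γ) {r : ℝ} (hr : 0 ≤ r) :
    ∫ l in Ioi (0 : ℝ), (1 - Real.exp (-l * r)) * l ^ (-1 - γ) = stableConst γ * r ^ γ := by
  rcases hr.eq_or_lt with rfl | hr
  · simp [Real.zero_rpow hγ0.ne']
  have h := integral_comp_mul_left_Ioi
    (fun l : ℝ => (1 - Real.exp (-l)) * l ^ (-1 - γ)) 0 hr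
  rw [mul_zero] at h
  have e : ∀ l ∈ Ioi (0 : ℝ), (1 - Real.exp (-l * r)) * l ^ (-1 - γ) =
      r ^ (1 + γ) * ((1 - Real.exp (-(r * l))) * (r * l) ^ (-1 - γ)) := fun l hl => by
    rw [Real.mul_rpow hr.le (le_of_lt hl), show -1 - γ = -(1 + γ) by ring,
      Real.rpow_neg hr.le, show -l * r = -(r * l) by ring]
    have : r ^ (1 + γ) ≠ 0 := (Real.rpow_pos_of_pos hr _).ne'
    field_simp
  rw [setIntegral_congr_fun measurableSet_Ioi e, integral_const_mul, h, smul_eq_mul,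
    Real.rpow_add hr, Real.rpow_one, stableConst]
  field_simp

lemma integrableOn_one_sub_exp_mul_rpow' (hγ0 : 0 < γ) (hγ1 : γ < 1) {r : ℝ} (hr : 0 ≤ r) :
    IntegrableOn (fun l : ℝ => (1 - Real.exp (-l * r)) * l ^ (-1 - γ)) (Ioi 0) := by
  rcases hr.eq_or_lt with rfl | hr
  · simp
  have h := (integrableOn_Ioi_comp_mul_left_iff
    (fun l : ℝ => (1 - Real.exp (-l)) * l ^ (-1 - γ)) 0 hr).2
    (by simpa using integrableOn_one_sub_exp_mul_rpow hγ0 hγ1)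
  refine IntegrableOn.congr_fun (h.const_mul (r ^ (1 + γ))) (fun l hl => ?_) measurableSet_Ioi
  rw [Real.mul_rpow hr.le (le_of_lt hl), show -1 - γ = -(1 + γ) by ring,
      Real.rpow_neg hr.le, show -l * r = -(r * l) by ring]
  have : r ^ (1 + γ) ≠ 0 := (Real.rpow_pos_of_pos hr _).ne'
  field_simp

lemma integrableOn_rpow_Ioi_inv (hγ0 : 0 < γ) (k : ℕ) :
    IntegrableOn (fun l : ℝ => l ^ (-1 - γ)) (Ioi (1 / ((k : ℝ) + 1))) :=
  integrableOn_Ioi_rpow_of_lt (by linarith) (by positivity)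

/-- Cutting at `1/(k+1)` makes the total mass finite, so the terms `1` and `exp(-l r)` can be
integrated separately. This gives the form `a - J(r)` required by `exp_neg_sub_laplace`; the cut-off
domains exhaust `(0,∞)`. -/
lemma tendsto_truncated_stable (hγ0 : 0 < γ) (hγ1 : γ < 1) {r : ℝ} (hr : 0 ≤ r) :
    Tendsto (fun k : ℕ => (∫ l in Ioi (1 / ((k : ℝ) + 1)), l ^ (-1 - γ)) -
      ∫ l in Ioi (1 / ((k : ℝ) + 1)), Real.exp (-l * r) * l ^ (-1 - γ)) atTop
      (𝓝 (stableConst γ * r ^ γ)) := by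
  rw [← integral_one_sub_exp_mul_rpow hγ0 hr]
  have hU : ⋃ k : ℕ, Ioi (1 / ((k : ℝ) + 1)) = Ioi 0 := by
    ext l
    simp only [mem_iUnion, mem_Ioi]
    exact ⟨fun ⟨k, hk⟩ => lt_trans (by positivity) hk, fun hl => exists_nat_one_div_lt hl⟩
  have h := tendsto_setIntegral_of_monotone (μ := volume)
    (f := fun l : ℝ => (1 - Real.exp (-l * r)) * l ^ (-1 - γ))
    (s := fun k : ℕ => Ioi (1 / ((k : ℝ) + 1))) (fun k => measurableSet_Ioi)
    (fun i j hij => Ioi_subset_Ioi (one_div_le_one_div_of_le (by positivity) (by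
      have : (i : ℝ) ≤ j := by exact_mod_cast hij
      linarith)))
    (by rw [hU]; exact integrableOn_one_sub_exp_mul_rpow' hγ0 hγ1 hr)
  rw [hU] at h
  refine h.congr fun k => ?_
  have h1 := integrableOn_rpow_Ioi_inv hγ0 k
  rw [← integral_sub h1]
  · congr 1; ext l; ring
  · refine h1.mono' (Measurable.aestronglyMeasurable (by fun_prop))
      ((ae_restrict_iff' measurableSet_Ioi).2 (Eventually.of_forall fun l hl => ?_))
    have hl0 : 0 < l := lt_trans (by positivity) hl
    rw [Real.norm_of_nonneg (by positivity)]
    exact mul_le_of_le_one_left (by positivity)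
      (Real.exp_le_one_iff.2 (by nlinarith [mul_nonneg hl0.le hr]))

variable {V : Type*} [NormedAddCommGroup V] [InnerProductSpace ℝ V] [FiniteDimensional ℝ V]
  [MeasurableSpace V] [BorelSpace V]

namespace IsPositiveProfile

/-- Exponentials `exp (-c (a - J))`, where `J` is the Laplace transform of a positive density of
total mass `a` on a half-line away from `0`. -/
lemma exp_neg_sub_laplace {w : ℝ → ℝ} {A : Set ℝ} (hA : MeasurableSet A) (hA0 : A ⊆ Ioi 0)
    (hw : IntegrableOn w A) (hw0 : ∀ l ∈ A, 0 ≤ w l) {c : ℝ} (hc : 0 ≤ c) :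
    IsPositiveProfile V fun r =>
      Real.exp (-c * ((∫ l in A, w l) - ∫ l in A, Real.exp (-l * r) * w l)) := by
  set a : ℝ := ∫ l in A, w l with ha
  set J : ℝ → ℝ := fun r => ∫ l in A, Real.exp (-l * r) * w l with hJ
  have hJm : Measurable J := by
    simpa [hJ] using ((one (V := V)).mul_laplace hA hA0 hw hw0).measurable
  have hJ0 : ∀ r, 0 ≤ J r := fun r => setIntegral_nonneg hA fun l hl =>
    mul_nonneg (Real.exp_nonneg _) (hw0 l hl)
  have hJa : ∀ r, 0 ≤ r → J r ≤ a := fun r hr => by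
    refine integral_mono_of_nonneg ((ae_restrict_iff' hA).2 (Eventually.of_forall fun l hl =>
      mul_nonneg (Real.exp_nonneg _) (hw0 l hl))) hw
      ((ae_restrict_iff' hA).2 (Eventually.of_forall fun l hl => ?_))
    exact mul_le_of_le_one_left (hw0 l hl) (Real.exp_le_one_iff.2 (by
      nlinarith [mul_nonneg (le_of_lt (hA0 hl)) hr]))
  have ha0 : 0 ≤ a := setIntegral_nonneg hA hw0
  have hlarge : ∀ᶠ k : ℕ in atTop, 0 < (k : ℝ) ∧ c * a / k ≤ 1 := by
    filter_upwards [eventually_gt_atTop 0, eventually_ge_atTop (Nat.ceil (c * a))] with k h0 hk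
    have h0' : (0 : ℝ) < k := by exact_mod_cast h0
    exact ⟨h0', (div_le_one h0').2 (Nat.ceil_le.1 hk)⟩
  -- Euler's limit for the exponential. The base equals `(1 - c a / k) + (c / k) J`, whose
  -- coefficients are nonnegative once `k ≥ c a`, so its powers are positive profiles by induction
  -- with `mul_laplace`; it also lies in `[0,1]`, which bounds them uniformly.
  refine of_tendsto (φ := fun k r => (1 + (-c * (a - J r)) / k) ^ k) (C := 1) ?_ ?_
    ?_ fun r _ => Real.tendsto_one_add_div_pow_exp _
  · filter_upwards [hlarge] with k hk
    have hpow : ∀ m : ℕ, IsPositiveProfile V fun r => (1 + (-c * (a - J r)) / k) ^ m := by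
      intro m
      induction m with
      | zero => simpa using one (V := V)
      | succ m ih =>
        have h1 := (ih.const_mul (c := 1 - c * a / k) (by linarith [hk.2])).add
          ((ih.mul_laplace hA hA0 hw hw0).const_mul (c := c / k) (div_nonneg hc hk.1.le))
        convert h1 using 2 with r
        simp only [hJ]
        ring
    exact hpow k
  · filter_upwards [hlarge] with k hk r hr
    have e : 1 + (-c * (a - J r)) / k = 1 - c * a / k + c * J r / k := by ring
    have h1 : 0 ≤ c * J r / k := div_nonneg (mul_nonneg hc (hJ0 r)) hk.1.le
    have h2 : c * J r / k ≤ c * a / k := by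
      gcongr
      exact hJa r hr
    rw [e, abs_of_nonneg (pow_nonneg (by linarith [hk.2]) _)]
    exact pow_le_one₀ (by linarith [hk.2]) (by linarith)
  · exact Real.measurable_exp.comp ((hJm.const_sub a).const_mul (-c))

lemma exp_neg_mul_rpow (hγ0 : 0 < γ) (hγ1 : γ ≤ 1) {t : ℝ} (ht : 0 ≤ t) :
    IsPositiveProfile V fun r => Real.exp (-t * r ^ γ) := by
  rcases hγ1.eq_or_lt with rfl | hγ1
  · simpa using exp_neg_mul (V := V) ht
  have hκ := stableConst_pos hγ0 hγ1
  have hsub : ∀ k : ℕ, Ioi (1 / ((k : ℝ) + 1)) ⊆ Ioi 0 := fun k =>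
    Ioi_subset_Ioi (by positivity)
  refine of_tendsto (C := 1) (Eventually.of_forall fun k : ℕ =>
    exp_neg_sub_laplace measurableSet_Ioi (hsub k) (integrableOn_rpow_Ioi_inv hγ0 k)
      (fun l hl => Real.rpow_nonneg (le_of_lt (hsub k hl)) _)
      (c := t / stableConst γ) (div_nonneg ht hκ.le)) ?_ (by fun_prop) ?_
  · refine Eventually.of_forall fun k r hr => ?_
    rw [abs_of_nonneg (Real.exp_nonneg _), Real.exp_le_one_iff, neg_mul, neg_nonpos]
    refine mul_nonneg (div_nonneg ht hκ.le) (sub_nonneg.2 ?_)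
    refine integral_mono_of_nonneg ((ae_restrict_iff' measurableSet_Ioi).2
      (Eventually.of_forall fun l hl => mul_nonneg (Real.exp_nonneg _)
        (Real.rpow_nonneg (le_of_lt (hsub k hl)) _))) (integrableOn_rpow_Ioi_inv hγ0 k)
      ((ae_restrict_iff' measurableSet_Ioi).2 (Eventually.of_forall fun l hl => ?_))
    have hl0 : 0 < l := hsub k hl
    exact mul_le_of_le_one_left (by positivity) (Real.exp_le_one_iff.2 (by
      nlinarith [mul_nonneg hl0.le hr]))
  · intro r hr
    have h := ((tendsto_truncated_stable hγ0 hγ1 hr).const_mul (-(t / stableConst γ))).rexp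
    convert h using 3
    field_simp

end IsPositiveProfile

lemma integrable_exp_neg_mul_norm_rpow [Nontrivial V] {β t : ℝ} (hβ : 0 < β) (ht : 0 < t) :
    Integrable fun ξ : V => Real.exp (-t * ‖ξ‖ ^ β) := by
  rw [integrable_fun_norm_addHaar (volume : Measure V) (f := fun r => Real.exp (-t * r ^ β))]
  have h := integrableOn_rpow_mul_exp_neg_mul_rpow
    (s := ((Module.finrank ℝ V - 1 : ℕ) : ℝ)) (p := β) (b := t)
    (lt_of_lt_of_le neg_one_lt_zero (Nat.cast_nonneg _)) hβ ht
  refine h.congr_fun (fun l _ => ?_) measurableSet_Ioi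
  simp [Real.rpow_natCast]

/-- Nonnegativity of the fractional heat kernel, for `0 < β ≤ 2`. -/
lemma integral_cos_mul_exp_neg_mul_norm_rpow_nonneg [Nontrivial V] {β t : ℝ} (hβ : 0 < β)
    (hβ2 : β ≤ 2) (ht : 0 < t) (x : V) :
    0 ≤ ∫ ξ : V, Real.cos (inner ℝ x ξ) * Real.exp (-t * ‖ξ‖ ^ β) := by
  -- Profiles are functions of `|ξ|²`, so the exponent is `β/2`, and `β ≤ 2` is the condition `γ ≤
  -- 1`. The Gaussian regularization is then removed by letting `δ = 1/(k+1)` tend to `0`, now that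
  -- `exp(-t|ξ|^β)` itself is integrable.
  have hP := IsPositiveProfile.exp_neg_mul_rpow (V := V) (γ := β / 2) (by linarith)
    (by linarith) ht.le
  have e : ∀ ξ : V, (‖ξ‖ ^ 2) ^ (β / 2) = ‖ξ‖ ^ β := fun ξ => by
    rw [← Real.rpow_natCast, ← Real.rpow_mul (norm_nonneg _)]
    congr 1
    push_cast
    ring
  have hlim : Tendsto (fun k : ℕ => ∫ ξ : V, Real.cos (inner ℝ x ξ) *
      (Real.exp (-t * (‖ξ‖ ^ 2) ^ (β / 2)) * Real.exp (-(1 / ((k : ℝ) + 1)) * ‖ξ‖ ^ 2))) atTop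
      (𝓝 (∫ ξ : V, Real.cos (inner ℝ x ξ) * Real.exp (-t * ‖ξ‖ ^ β))) := by
    refine tendsto_integral_of_dominated_convergence _ (fun k => by fun_prop)
      (integrable_exp_neg_mul_norm_rpow (V := V) hβ ht) (fun k => ?_) ?_
    · refine Eventually.of_forall fun ξ => ?_
      rw [norm_mul, norm_mul, Real.norm_of_nonneg (Real.exp_nonneg _),
        Real.norm_of_nonneg (Real.exp_nonneg _), e]
      have h1 : Real.exp (-(1 / ((k : ℝ) + 1)) * ‖ξ‖ ^ 2) ≤ 1 := Real.exp_le_one_iff.2 (by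
        rw [neg_mul, neg_nonpos]; positivity)
      have h2 : ‖Real.cos (inner ℝ x ξ)‖ ≤ 1 := Real.abs_cos_le_one _
      calc _ ≤ 1 * (Real.exp (-t * ‖ξ‖ ^ β) * 1) := by gcongr
        _ = _ := by ring
    · refine Eventually.of_forall fun ξ => ?_
      have h1 : Tendsto (fun k : ℕ => Real.exp (-(1 / ((k : ℝ) + 1)) * ‖ξ‖ ^ 2)) atTop
          (𝓝 1) := by
        have := ((tendsto_one_div_add_atTop_nhds_zero_nat (𝕜 := ℝ)).neg.mul_const
          (‖ξ‖ ^ 2)).rexp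
        simpa using this
      simpa [e] using ((h1.const_mul (Real.exp (-t * ‖ξ‖ ^ β))).const_mul
        (Real.cos (inner ℝ x ξ)))
  exact ge_of_tendsto' hlim fun k => hP.nonneg _ (by positivity) x

end Stable

/-! ### The fractional heat kernel as a probability density -/

section Kernel

open FourierTransform

variable {n : ℕ} {β t : ℝ}

lemma norm_heat_integrand (x ξ : EuclideanSpace ℝ (Fin n)) :
    ‖Complex.exp (Complex.I * ((inner ℝ x ξ : ℝ) : ℂ) - ((t * ‖ξ‖ ^ β : ℝ) : ℂ))‖ =
      Real.exp (-t * ‖ξ‖ ^ β) := by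
  rw [Complex.norm_exp, Complex.sub_re, Complex.ofReal_re]
  simp

/-- Replacing `ξ` by `-ξ` conjugates the integrand, so the integral is real and taking the real part
loses nothing. -/
lemma ofReal_heatKernel (x : EuclideanSpace ℝ (Fin n)) :
    (heatKernel β t x : ℂ) = (((2 * Real.pi) ^ (-(n : ℝ)) : ℝ) : ℂ) *
      ∫ ξ : EuclideanSpace ℝ (Fin n),
        Complex.exp (Complex.I * ((inner ℝ x ξ : ℝ) : ℂ) - ((t * ‖ξ‖ ^ β : ℝ) : ℂ)) := by
  rw [heatKernel, Complex.ofReal_mul]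
  congr 1
  rw [← Complex.conj_eq_iff_re, ← integral_conj, ← integral_neg_eq_self]
  refine integral_congr_ae (Eventually.of_forall fun ξ => ?_)
  simp only [← Complex.exp_conj, map_sub, map_mul, Complex.conj_I, Complex.conj_ofReal,
    inner_neg_right, norm_neg]
  congr 1
  push_cast
  ring

/-- The Fourier multiplier of the fractional heat semigroup, in the normalization `e^{2πi x·η}`. -/
def heatSymbol (n : ℕ) (β t : ℝ) (η : EuclideanSpace ℝ (Fin n)) : ℂ :=
  ((Real.exp (-t * ‖(2 * Real.pi) • η‖ ^ β) : ℝ) : ℂ)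

lemma continuous_heatSymbol (hβ : 0 < β) : Continuous (heatSymbol n β t) := by
  have : Continuous fun η : EuclideanSpace ℝ (Fin n) => ‖(2 * Real.pi) • η‖ ^ β :=
    (by fun_prop : Continuous fun η : EuclideanSpace ℝ (Fin n) =>
      ‖(2 * Real.pi) • η‖).rpow_const fun _ => Or.inr hβ.le
  unfold heatSymbol
  fun_prop

lemma fourierInv_heatSymbol (x : EuclideanSpace ℝ (Fin n)) :
    𝓕⁻ (heatSymbol n β t) x = (heatKernel β t x : ℂ) := by
  rw [Real.fourierInv_eq', ofReal_heatKernel]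
  have h := Measure.integral_comp_smul (volume : Measure (EuclideanSpace ℝ (Fin n)))
    (fun ξ => Complex.exp (Complex.I * ((inner ℝ x ξ : ℝ) : ℂ) - ((t * ‖ξ‖ ^ β : ℝ) : ℂ)))
    (2 * Real.pi)
  rw [finrank_euclideanSpace_fin] at h
  have hc : |((2 * Real.pi) ^ n)⁻¹| = (2 * Real.pi) ^ (-(n : ℝ)) := by
    rw [Real.rpow_neg (by positivity), Real.rpow_natCast, abs_of_nonneg (by positivity)]
  rw [hc, Complex.real_smul] at h
  rw [← h]
  refine integral_congr_ae (Eventually.of_forall fun η => ?_)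
  simp only [heatSymbol, smul_eq_mul, Complex.ofReal_exp]
  rw [← Complex.exp_add]
  congr 1
  rw [inner_smul_right, real_inner_comm]
  push_cast
  ring

variable [NeZero n]

lemma integrable_heat_integrand (hβ : 0 < β) (ht : 0 < t) (x : EuclideanSpace ℝ (Fin n)) :
    Integrable fun ξ : EuclideanSpace ℝ (Fin n) =>
      Complex.exp (Complex.I * ((inner ℝ x ξ : ℝ) : ℂ) - ((t * ‖ξ‖ ^ β : ℝ) : ℂ)) :=
  (integrable_exp_neg_mul_norm_rpow (V := EuclideanSpace ℝ (Fin n)) hβ ht).mono'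
    (Measurable.aestronglyMeasurable (by fun_prop))
    (Eventually.of_forall fun ξ => (norm_heat_integrand x ξ).le)

lemma heatKernel_eq (hβ : 0 < β) (ht : 0 < t) (x : EuclideanSpace ℝ (Fin n)) :
    heatKernel β t x = (2 * Real.pi) ^ (-(n : ℝ)) *
      ∫ ξ : EuclideanSpace ℝ (Fin n), Real.cos (inner ℝ x ξ) * Real.exp (-t * ‖ξ‖ ^ β) := by
  have h := integral_re (integrable_heat_integrand hβ ht x)
  rw [heatKernel]
  congr 1
  refine h.symm.trans (integral_congr_ae (Eventually.of_forall fun ξ => ?_))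
  simp only
  change (Complex.exp _).re = _
  rw [Complex.exp_re, mul_comm, Complex.sub_re, Complex.sub_im, Complex.ofReal_re,
    Complex.ofReal_im]
  simp

lemma heatKernel_nonneg (hβ : 0 < β) (hβ2 : β ≤ 2) (ht : 0 < t)
    (x : EuclideanSpace ℝ (Fin n)) : 0 ≤ heatKernel β t x := by
  rw [heatKernel_eq hβ ht]
  exact mul_nonneg (by positivity)
    (integral_cos_mul_exp_neg_mul_norm_rpow_nonneg hβ hβ2 ht x)

lemma integrable_heatSymbol (hβ : 0 < β) (ht : 0 < t) : Integrable (heatSymbol n β t) :=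
  ((integrable_exp_neg_mul_norm_rpow (V := EuclideanSpace ℝ (Fin n)) hβ ht).comp_smul
    (by positivity : (2 * Real.pi) ≠ 0)).ofReal

lemma continuous_heatKernel (hβ : 0 < β) (ht : 0 < t) :
    Continuous (heatKernel β t : EuclideanSpace ℝ (Fin n) → ℝ) := by
  have h : (heatKernel β t : EuclideanSpace ℝ (Fin n) → ℝ) = fun x =>
      (2 * Real.pi) ^ (-(n : ℝ)) * ∫ ξ : EuclideanSpace ℝ (Fin n),
        Real.cos (inner ℝ x ξ) * Real.exp (-t * ‖ξ‖ ^ β) :=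
    funext fun x => heatKernel_eq hβ ht x
  rw [h]
  refine continuous_const.mul (continuous_of_dominated (fun x => by fun_prop)
    (fun x => Eventually.of_forall fun ξ => ?_)
    (integrable_exp_neg_mul_norm_rpow (V := EuclideanSpace ℝ (Fin n)) hβ ht)
    (Eventually.of_forall fun ξ => by fun_prop))
  rw [norm_mul, Real.norm_of_nonneg (Real.exp_nonneg _)]
  exact mul_le_of_le_one_left (Real.exp_nonneg _) (Real.abs_cos_le_one _)

/-- Testing the heat kernel against a Gaussian. -/
lemma integral_heatKernel_mul_gaussian_le (hβ : 0 < β) (ht : 0 < t) {δ : ℝ} (hδ : 0 < δ) :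
    ∫ x : EuclideanSpace ℝ (Fin n), heatKernel β t x * Real.exp (-δ * ‖x‖ ^ 2) ≤ 1 := by
  have hg := integrable_exp_neg_mul_sq_norm (V := EuclideanSpace ℝ (Fin n)) hδ
  have hs := integrable_exp_neg_mul_norm_rpow (V := EuclideanSpace ℝ (Fin n)) hβ ht
  have hint : Integrable (Function.uncurry fun (x ξ : EuclideanSpace ℝ (Fin n)) =>
      Real.exp (-t * ‖ξ‖ ^ β) * (Real.cos (inner ℝ ξ x) * Real.exp (-δ * ‖x‖ ^ 2)))
      (volume.prod volume) := by
    refine (hg.mul_prod hs).mono' (Measurable.aestronglyMeasurable ?_)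
      (Eventually.of_forall fun q => ?_)
    · simp only [Function.uncurry_def]; fun_prop
    · simp only [Function.uncurry_def, norm_mul, Real.norm_of_nonneg (Real.exp_nonneg _)]
      have : ‖Real.cos (inner ℝ q.2 q.1)‖ ≤ 1 := Real.abs_cos_le_one _
      calc _ ≤ Real.exp (-t * ‖q.2‖ ^ β) * (1 * Real.exp (-δ * ‖q.1‖ ^ 2)) := by gcongr
        _ = _ := by ring
  have e1 : ∀ x : EuclideanSpace ℝ (Fin n), heatKernel β t x * Real.exp (-δ * ‖x‖ ^ 2) =
      (2 * Real.pi) ^ (-(n : ℝ)) * ∫ ξ : EuclideanSpace ℝ (Fin n), Real.exp (-t * ‖ξ‖ ^ β) *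
        (Real.cos (inner ℝ ξ x) * Real.exp (-δ * ‖x‖ ^ 2)) := fun x => by
    rw [heatKernel_eq hβ ht, mul_assoc, ← integral_mul_const]
    congr 2
    ext ξ
    rw [real_inner_comm]
    ring
  simp only [e1]
  rw [integral_const_mul, integral_integral_swap hint]
  simp only [integral_const_mul]
  simp only [integral_cos_mul_exp_neg_mul_sq_norm hδ, finrank_euclideanSpace_fin]
  have hδ' : 0 < 1 / (4 * δ) := by positivity
  have hg' := integrable_exp_neg_mul_sq_norm (V := EuclideanSpace ℝ (Fin n)) hδ'
  have hG := integral_cos_mul_exp_neg_mul_sq_norm (V := EuclideanSpace ℝ (Fin n)) hδ' 0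
  simp only [inner_zero_left, Real.cos_zero, one_mul, norm_zero, finrank_euclideanSpace_fin,
    ne_eq, OfNat.ofNat_ne_zero, not_false_eq_true, zero_pow, neg_zero, zero_div, Real.exp_zero,
    mul_one] at hG
  have hle : ∫ ξ : EuclideanSpace ℝ (Fin n), Real.exp (-t * ‖ξ‖ ^ β) *
      ((Real.pi / δ) ^ ((n : ℝ) / 2) * Real.exp (-‖ξ‖ ^ 2 / (4 * δ))) ≤
      ∫ ξ : EuclideanSpace ℝ (Fin n), (Real.pi / δ) ^ ((n : ℝ) / 2) *
        Real.exp (-(1 / (4 * δ)) * ‖ξ‖ ^ 2) := by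
    refine integral_mono_of_nonneg (Eventually.of_forall fun ξ => by positivity)
      (hg'.const_mul _) (Eventually.of_forall fun ξ => ?_)
    have h1 : Real.exp (-t * ‖ξ‖ ^ β) ≤ 1 := Real.exp_le_one_iff.2 (by
      rw [neg_mul, neg_nonpos]; positivity)
    have h2 : -‖ξ‖ ^ 2 / (4 * δ) = -(1 / (4 * δ)) * ‖ξ‖ ^ 2 := by ring
    simp only [h2]
    exact mul_le_of_le_one_left (by positivity) h1
  refine (mul_le_mul_of_nonneg_left hle (by positivity)).trans_eq ?_
  rw [integral_const_mul, hG, ← Real.mul_rpow (by positivity) (by positivity)]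
  -- After bounding the symbol by one, the two Gaussian constants multiply to `(2π)^n`, which
  -- cancels the normalization of the kernel.
  have e2 : Real.pi / δ * (Real.pi / (1 / (4 * δ))) = (2 * Real.pi) ^ (2 : ℝ) := by
    rw [Real.rpow_two]
    field_simp
    ring
  rw [e2, ← Real.rpow_mul (by positivity), ← Real.rpow_add (by positivity)]
  ring_nf
  simp

lemma exists_norm_heatKernel_le (hβ : 0 < β) (ht : 0 < t) :
    ∃ C, ∀ x : EuclideanSpace ℝ (Fin n), ‖heatKernel β t x‖ ≤ C := by
  refine ⟨(2 * Real.pi) ^ (-(n : ℝ)) *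
    ∫ ξ : EuclideanSpace ℝ (Fin n), Real.exp (-t * ‖ξ‖ ^ β), fun x => ?_⟩
  rw [heatKernel_eq hβ ht, norm_mul, Real.norm_of_nonneg (by positivity)]
  refine mul_le_mul_of_nonneg_left (norm_integral_le_of_norm_le
    (integrable_exp_neg_mul_norm_rpow (V := EuclideanSpace ℝ (Fin n)) hβ ht)
    (Eventually.of_forall fun ξ => ?_)) (by positivity)
  rw [norm_mul, Real.norm_of_nonneg (Real.exp_nonneg _)]
  exact mul_le_of_le_one_left (Real.exp_nonneg _) (Real.abs_cos_le_one _)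

/-- No decay estimate is used: the kernel is nonnegative, its masses against `exp(-δ|x|²)` are at
most `1`, and Fatou's lemma lets `δ → 0`. -/
lemma integrable_heatKernel (hβ : 0 < β) (hβ2 : β ≤ 2) (ht : 0 < t) :
    Integrable (heatKernel β t : EuclideanSpace ℝ (Fin n) → ℝ) := by
  have hcont := continuous_heatKernel (n := n) hβ ht
  have hnn := heatKernel_nonneg (n := n) hβ hβ2 ht
  refine ⟨hcont.aestronglyMeasurable, ?_⟩
  let f : ℕ → EuclideanSpace ℝ (Fin n) → ℝ := fun k x =>
    heatKernel β t x * Real.exp (-(1 / ((k : ℝ) + 1)) * ‖x‖ ^ 2)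
  have hf0 : ∀ k x, 0 ≤ f k x := fun k x => mul_nonneg (hnn x) (Real.exp_nonneg _)
  obtain ⟨C, hC⟩ := exists_norm_heatKernel_le (n := n) hβ ht
  have hfi : ∀ k, Integrable (f k) := fun k =>
    (integrable_exp_neg_mul_sq_norm (V := EuclideanSpace ℝ (Fin n))
      (by positivity : 0 < 1 / ((k : ℝ) + 1))).bdd_mul hcont.aestronglyMeasurable
      (Eventually.of_forall hC)
  have hlim : ∀ x, Tendsto (fun k => ENNReal.ofReal (f k x)) atTop
      (𝓝 (ENNReal.ofReal (heatKernel β t x))) := fun x => by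
    refine ENNReal.tendsto_ofReal ?_
    have := (((tendsto_one_div_add_atTop_nhds_zero_nat (𝕜 := ℝ)).neg.mul_const
      (‖x‖ ^ 2)).rexp).const_mul (heatKernel β t x)
    simpa [f] using this
  have hfm : ∀ k, Measurable fun x => ENNReal.ofReal (f k x) := fun k => by
    have := hcont.measurable
    fun_prop
  rw [hasFiniteIntegral_iff_ofReal (Eventually.of_forall hnn)]
  calc ∫⁻ x, ENNReal.ofReal (heatKernel β t x)
      = ∫⁻ x, liminf (fun k => ENNReal.ofReal (f k x)) atTop :=
        lintegral_congr fun x => (hlim x).liminf_eq.symm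
    _ ≤ liminf (fun k => ∫⁻ x, ENNReal.ofReal (f k x)) atTop := lintegral_liminf_le hfm
    _ ≤ 1 := by
        refine liminf_le_of_le (by isBoundedDefault) fun b hb => ?_
        obtain ⟨k, hk⟩ := hb.exists
        refine hk.trans ?_
        rw [← ofReal_integral_eq_lintegral_ofReal (hfi k) (Eventually.of_forall (hf0 k))]
        exact ENNReal.ofReal_le_one.2
          (integral_heatKernel_mul_gaussian_le hβ ht (by positivity))
    _ < ∞ := ENNReal.one_lt_top

/-- Fourier inversion, available since both symbol and kernel are integrable. Its value at `0` is
the total mass, and multiplicativity of the symbol in time gives the semigroup law. -/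
lemma fourier_heatKernel (hβ : 0 < β) (hβ2 : β ≤ 2) (ht : 0 < t) :
    𝓕 (fun x : EuclideanSpace ℝ (Fin n) => (heatKernel β t x : ℂ)) = heatSymbol n β t := by
  have hK : 𝓕⁻ (heatSymbol n β t) = fun x => (heatKernel β t x : ℂ) :=
    funext fourierInv_heatSymbol
  have hK' : 𝓕 (heatSymbol n β t) = fun x => (heatKernel β t (-x) : ℂ) := by
    ext x
    rw [← fourierInv_heatSymbol, Real.fourierInv_eq_fourier_neg, neg_neg]
  rw [← hK]
  refine (continuous_heatSymbol hβ).fourier_fourierInv_eq (integrable_heatSymbol hβ ht) ?_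
  rw [hK']
  exact ((integrable_heatKernel (n := n) hβ hβ2 ht).comp_neg).ofReal

lemma integral_heatKernel (hβ : 0 < β) (hβ2 : β ≤ 2) (ht : 0 < t) :
    ∫ x : EuclideanSpace ℝ (Fin n), heatKernel β t x = 1 := by
  have h := congrFun (fourier_heatKernel (n := n) hβ hβ2 ht) 0
  rw [Real.fourier_eq'] at h
  simp only [inner_zero_right, mul_zero, Complex.ofReal_zero, zero_mul, Complex.exp_zero,
    one_smul, heatSymbol, smul_zero, norm_zero, Real.zero_rpow hβ.ne', Real.exp_zero,
    Complex.ofReal_one] at h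
  rw [integral_complex_ofReal] at h
  exact_mod_cast h

/-- With the first factor written as an inverse Fourier integral, Fubini leaves the Fourier
transform of the second factor, and the symbols multiply. -/
lemma heatKernel_conv (hβ : 0 < β) (hβ2 : β ≤ 2) (ht : 0 < t) {r : ℝ} (hr : 0 < r)
    (x : EuclideanSpace ℝ (Fin n)) :
    ∫ y, heatKernel β t (x - y) * heatKernel β r y = heatKernel β (t + r) x := by
  have hK := integrable_heatKernel (n := n) hβ hβ2 hr
  have hg := integrable_heatSymbol (n := n) hβ ht
  have hint : Integrable (Function.uncurry fun (y η : EuclideanSpace ℝ (Fin n)) =>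
      Complex.exp (↑(2 * Real.pi * inner ℝ η (x - y)) * Complex.I) * heatSymbol n β t η *
        (heatKernel β r y : ℂ)) (volume.prod volume) := by
    refine (hK.norm.mul_prod hg.norm).mono' ?_ (Eventually.of_forall fun q => ?_)
    · have m1 := (continuous_heatSymbol (n := n) (t := t) hβ).measurable
      have m2 := (continuous_heatKernel (n := n) hβ hr).measurable
      simp only [Function.uncurry_def]
      exact Measurable.aestronglyMeasurable (by fun_prop)
    · simp only [Function.uncurry_def, norm_mul, Complex.norm_exp_ofReal_mul_I,
        Complex.norm_real]
      rw [one_mul, mul_comm]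
  rw [← Complex.ofReal_inj, ← integral_complex_ofReal, ← fourierInv_heatSymbol,
    Real.fourierInv_eq']
  have e1 : ∀ y : EuclideanSpace ℝ (Fin n),
      ((heatKernel β t (x - y) * heatKernel β r y : ℝ) : ℂ) =
      ∫ η : EuclideanSpace ℝ (Fin n), Complex.exp (↑(2 * Real.pi * inner ℝ η (x - y)) *
        Complex.I) * heatSymbol n β t η * (heatKernel β r y : ℂ) := fun y => by
    rw [integral_mul_const, Complex.ofReal_mul, ← fourierInv_heatSymbol, Real.fourierInv_eq']
    rfl
  simp only [e1]
  rw [integral_integral_swap hint]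
  refine integral_congr_ae (Eventually.of_forall fun η => ?_)
  have e2 : ∀ y : EuclideanSpace ℝ (Fin n),
      Complex.exp (↑(2 * Real.pi * inner ℝ η (x - y)) * Complex.I) * heatSymbol n β t η *
        (heatKernel β r y : ℂ) =
      (Complex.exp (↑(2 * Real.pi * inner ℝ η x) * Complex.I) * heatSymbol n β t η) *
        (Complex.exp (↑(-2 * Real.pi * inner ℝ y η) * Complex.I) • (heatKernel β r y : ℂ)) :=
    fun y => by
      rw [inner_sub_right, real_inner_comm y η, smul_eq_mul]
      have : Complex.exp (↑(2 * Real.pi * (inner ℝ η x - inner ℝ y η)) * Complex.I) =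
          Complex.exp (↑(2 * Real.pi * inner ℝ η x) * Complex.I) *
          Complex.exp (↑(-2 * Real.pi * inner ℝ y η) * Complex.I) := by
        rw [← Complex.exp_add]
        congr 1
        push_cast
        ring
      rw [this]
      ring
  simp only [e2]
  rw [integral_const_mul, ← Real.fourier_eq', fourier_heatKernel hβ hβ2 hr, mul_assoc,
    smul_eq_mul]
  congr 1
  simp only [heatSymbol, ← Complex.ofReal_mul, ← Real.exp_add]
  congr 2
  ring

lemma heatKernel_scaling (hβ : 0 < β) {R : ℝ} (hR : 0 < R) (x : EuclideanSpace ℝ (Fin n)) :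
    heatKernel β (R ^ β) (R • x) = (R ^ n)⁻¹ * heatKernel β 1 x := by
  rw [heatKernel_eq hβ (by positivity), heatKernel_eq hβ one_pos]
  have h := Measure.integral_comp_smul (volume : Measure (EuclideanSpace ℝ (Fin n)))
    (fun ξ => Real.cos (inner ℝ x ξ) * Real.exp (-1 * ‖ξ‖ ^ β)) R
  rw [finrank_euclideanSpace_fin, abs_of_nonneg (by positivity), smul_eq_mul] at h
  rw [mul_left_comm, ← h]
  congr 2
  ext ξ
  rw [inner_smul_left, inner_smul_right, norm_smul, Real.norm_of_nonneg hR.le,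
    Real.mul_rpow hR.le (norm_nonneg _)]
  simp

/-- Scaling moves the time dependence from the kernel to the test function, so that dominated
convergence as `t → 0` runs against the fixed kernel at time one. -/
lemma integral_heatKernel_mul (hβ : 0 < β) (ht : 0 < t) (w : EuclideanSpace ℝ (Fin n) → ℝ) :
    ∫ y, heatKernel β t y * w y = ∫ z, heatKernel β 1 z * w (t ^ β⁻¹ • z) := by
  set R : ℝ := t ^ β⁻¹ with hRdef
  have hR : 0 < R := by positivity
  have hRt : R ^ β = t := by
    rw [hRdef, ← Real.rpow_mul ht.le, inv_mul_cancel₀ hβ.ne', Real.rpow_one]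
  have h := Measure.integral_comp_smul (volume : Measure (EuclideanSpace ℝ (Fin n)))
    (fun y => heatKernel β t y * w y) R
  rw [finrank_euclideanSpace_fin, abs_of_nonneg (by positivity), smul_eq_mul] at h
  have hRn : R ^ n ≠ 0 := by positivity
  have e : ∀ z : EuclideanSpace ℝ (Fin n), heatKernel β t (R • z) * w (R • z) =
      (R ^ n)⁻¹ * (heatKernel β 1 z * w (R • z)) := fun z => by
    rw [← hRt, heatKernel_scaling hβ hR, mul_assoc]
  simp only [e, integral_const_mul] at h
  exact (mul_left_cancel₀ (inv_ne_zero hRn) h).symm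

lemma tendsto_integral_heatKernel_mul (hβ : 0 < β) (hβ2 : β ≤ 2)
    {w : EuclideanSpace ℝ (Fin n) → ℝ} (hw : Continuous w) {C : ℝ} (hC : ∀ x, ‖w x‖ ≤ C) :
    Tendsto (fun t => ∫ y, heatKernel β t y * w y) (𝓝[>] 0) (𝓝 (w 0)) := by
  have hK := integrable_heatKernel (n := n) hβ hβ2 one_pos
  have h : Tendsto (fun t : ℝ => ∫ z, heatKernel β 1 z * w (t ^ β⁻¹ • z)) (𝓝[>] 0)
      (𝓝 (∫ z : EuclideanSpace ℝ (Fin n), heatKernel β 1 z * w 0)) := by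
    refine tendsto_integral_filter_of_dominated_convergence
      (fun z => ‖heatKernel β 1 z‖ * C) (Eventually.of_forall fun t => ?_)
      (Eventually.of_forall fun t => Eventually.of_forall fun z => ?_) (hK.norm.mul_const C)
      (Eventually.of_forall fun z => ?_)
    · exact hK.1.mul (by fun_prop : Continuous fun z => w (t ^ β⁻¹ • z)).aestronglyMeasurable
    · rw [norm_mul]
      exact mul_le_mul_of_nonneg_left (hC _) (norm_nonneg _)
    · refine Tendsto.const_mul _ ?_
      have h0 : Tendsto (fun t : ℝ => t ^ β⁻¹) (𝓝[>] 0) (𝓝 0) := by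
        have := (Real.continuousAt_rpow_const 0 β⁻¹ (Or.inr (inv_pos.2 hβ).le)).tendsto
        rw [Real.zero_rpow (inv_pos.2 hβ).ne'] at this
        exact this.mono_left nhdsWithin_le_nhds
      have h1 := h0.smul_const z
      rw [zero_smul] at h1
      exact (hw.tendsto 0).comp h1
  rw [integral_mul_const, integral_heatKernel hβ hβ2 one_pos, one_mul] at h
  refine h.congr' ?_
  filter_upwards [self_mem_nhdsWithin] with t ht
  exact (integral_heatKernel_mul hβ ht w).symm

lemma tendsto_heatKernel_time (hβ : 0 < β) (ht : 0 < t) (x : EuclideanSpace ℝ (Fin n)) :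
    Tendsto (fun r => heatKernel β r x) (𝓝 t) (𝓝 (heatKernel β t x)) := by
  have hev : ∀ᶠ r in 𝓝 t, t / 2 < r := lt_mem_nhds (by linarith)
  have h : Tendsto (fun r => (2 * Real.pi) ^ (-(n : ℝ)) * ∫ ξ : EuclideanSpace ℝ (Fin n),
      Real.cos (inner ℝ x ξ) * Real.exp (-r * ‖ξ‖ ^ β)) (𝓝 t)
      (𝓝 ((2 * Real.pi) ^ (-(n : ℝ)) * ∫ ξ : EuclideanSpace ℝ (Fin n),
      Real.cos (inner ℝ x ξ) * Real.exp (-t * ‖ξ‖ ^ β))) := by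
    refine Tendsto.const_mul _ (tendsto_integral_filter_of_dominated_convergence
      (fun ξ => Real.exp (-(t / 2) * ‖ξ‖ ^ β))
      (Eventually.of_forall fun r => by fun_prop) ?_
      (integrable_exp_neg_mul_norm_rpow (V := EuclideanSpace ℝ (Fin n)) hβ (by linarith))
      (Eventually.of_forall fun ξ => ?_))
    · filter_upwards [hev] with r hr
      refine Eventually.of_forall fun ξ => ?_
      rw [norm_mul, Real.norm_of_nonneg (Real.exp_nonneg _)]
      refine (mul_le_of_le_one_left (Real.exp_nonneg _) (Real.abs_cos_le_one _)).trans ?_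
      gcongr
    · exact Continuous.tendsto (by fun_prop) t
  rw [← heatKernel_eq hβ ht] at h
  refine h.congr' ?_
  filter_upwards [hev] with r hr
  exact (heatKernel_eq hβ (by linarith) x).symm

/-- `L¹`-continuity in time of the heat kernel away from `t = 0`, by Scheffé's argument. -/
lemma tendsto_integral_abs_heatKernel_sub (hβ : 0 < β) (hβ2 : β ≤ 2) (ht : 0 < t) :
    Tendsto (fun r => ∫ x : EuclideanSpace ℝ (Fin n), |heatKernel β r x - heatKernel β t x|)
      (𝓝 t) (𝓝 0) := by
  have hK := integrable_heatKernel (n := n) hβ hβ2 ht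
  have hev : ∀ᶠ r in 𝓝 t, 0 < r := lt_mem_nhds ht
  have h : Tendsto (fun r => ∫ x : EuclideanSpace ℝ (Fin n),
      2 * max (heatKernel β t x - heatKernel β r x) 0) (𝓝 t)
      (𝓝 (∫ x : EuclideanSpace ℝ (Fin n), 2 * max (heatKernel β t x - heatKernel β t x) 0)) := by
    refine tendsto_integral_filter_of_dominated_convergence
      (fun x => 2 * heatKernel β t x) ?_ ?_ (hK.const_mul 2) (Eventually.of_forall fun x => ?_)
    · filter_upwards [hev] with r hr
      have m1 := (continuous_heatKernel (n := n) hβ ht).measurable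
      have m2 := (continuous_heatKernel (n := n) hβ hr).measurable
      exact Measurable.aestronglyMeasurable (by fun_prop)
    · filter_upwards [hev] with r hr
      refine Eventually.of_forall fun x => ?_
      rw [Real.norm_of_nonneg (by positivity)]
      have h1 := heatKernel_nonneg hβ hβ2 hr x
      have h2 := heatKernel_nonneg hβ hβ2 ht x
      exact mul_le_mul_of_nonneg_left (max_le (by linarith) h2) (by norm_num)
    · exact (((tendsto_heatKernel_time hβ ht x).const_sub _).max tendsto_const_nhds).const_mul 2
  simp only [sub_self, max_self, mul_zero, integral_zero] at h
  refine h.congr' ?_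
  filter_upwards [hev] with r hr
  have hK' := integrable_heatKernel (n := n) hβ hβ2 hr
  -- The signed difference integrates to zero because both masses are one. What remains is a
  -- positive part dominated by twice the kernel at time `t`, uniformly in `r`.
  have e : ∀ x : EuclideanSpace ℝ (Fin n), |heatKernel β r x - heatKernel β t x| =
      2 * max (heatKernel β t x - heatKernel β r x) 0 +
        (heatKernel β r x - heatKernel β t x) := fun x => by
    rcases le_total (heatKernel β r x) (heatKernel β t x) with hle | hle
    · rw [abs_of_nonpos (by linarith), max_eq_left (by linarith)]; ring
    · rw [abs_of_nonneg (by linarith), max_eq_right (by linarith)]; ring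
  have i1 : Integrable fun x : EuclideanSpace ℝ (Fin n) =>
      2 * max (heatKernel β t x - heatKernel β r x) 0 := (hK.sub hK').pos_part.const_mul 2
  have i2 : Integrable fun x : EuclideanSpace ℝ (Fin n) =>
      heatKernel β r x - heatKernel β t x := hK'.sub hK
  simp only [e]
  rw [integral_add i1 i2, integral_sub hK' hK,
    integral_heatKernel hβ hβ2 hr, integral_heatKernel hβ hβ2 ht, sub_self, add_zero]

end Kernel

/-! ### Young's inequality and convolution operators on `L^s` -/

section Convolution

variable {V : Type*} [NormedAddCommGroup V] [InnerProductSpace ℝ V] [FiniteDimensional ℝ V]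
  [MeasurableSpace V] [BorelSpace V]

/-- Young's convolution inequality for nonnegative functions. -/
lemma lintegral_conv_rpow_le {K f : V → ℝ≥0∞} (hK : Measurable K) (hf : AEMeasurable f)
    {r q s : ℝ} (hr : 0 < r) (hq : 0 < q) (hs : 0 < s) (hrs : r ≤ s) (hqs : q ≤ s)
    (h : 1 / r + 1 / q = 1 + 1 / s) :
    ∫⁻ x, (∫⁻ y, K (x - y) * f y) ^ s ≤
      (∫⁻ x, K x ^ r) ^ (s / r) * (∫⁻ x, f x ^ q) ^ (s / q) := by
  set A : ℝ≥0∞ := ∫⁻ x, K x ^ r with hA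
  set B : ℝ≥0∞ := ∫⁻ x, f x ^ q with hB
  have ha0 : 0 ≤ 1 / s := by positivity
  have ha1 : 0 ≤ 1 / r - 1 / s := sub_nonneg.2 (one_div_le_one_div_of_le hr hrs)
  have ha2 : 0 ≤ 1 / q - 1 / s := sub_nonneg.2 (one_div_le_one_div_of_le hq hqs)
  have hAx : ∀ x, ∫⁻ y, K (x - y) ^ r = A := fun x =>
    lintegral_sub_left_eq_self (fun y => K y ^ r) x
  have hpt : ∀ x, (∫⁻ y, K (x - y) * f y) ^ s ≤
      (∫⁻ y, K (x - y) ^ r * f y ^ q) * (A ^ (s * (1 / r - 1 / s)) * B ^ (s * (1 / q - 1 / s))) := by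
    intro x
    have hKx : Measurable fun y => K (x - y) := by fun_prop
    -- Hölder for the three functions `K^r f^q`, `K^r`, `f^q` with weights `1/s`, `1/r - 1/s`, `1/q
    -- - 1/s`, which sum to one by the exponent relation. Zero weights are allowed, so `r = s` and
    -- `q = s` are included.
    have h3 := ENNReal.lintegral_prod_norm_pow_le (μ := (volume : Measure V))
      (Finset.univ : Finset (Fin 3))
      (f := ![fun y => K (x - y) ^ r * f y ^ q, fun y => K (x - y) ^ r, fun y => f y ^ q])
      (p := ![1 / s, 1 / r - 1 / s, 1 / q - 1 / s])
      (by
        intro i _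
        fin_cases i
        · exact (hKx.pow_const r).aemeasurable.mul (hf.pow_const q)
        · exact (hKx.pow_const r).aemeasurable
        · exact hf.pow_const q)
      (by simp [Fin.sum_univ_three]; simp at h; linarith)
      (by intro i _; fin_cases i <;> simp_all)
    simp only [Fin.prod_univ_three, Matrix.cons_val_zero, Matrix.cons_val_one,
      Matrix.cons_val] at h3
    rw [hAx x, ← hB] at h3
    have e : ∀ y, (K (x - y) ^ r * f y ^ q) ^ (1 / s) * (K (x - y) ^ r) ^ (1 / r - 1 / s) *
        (f y ^ q) ^ (1 / q - 1 / s) = K (x - y) * f y := fun y => by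
      rw [ENNReal.mul_rpow_of_nonneg _ _ ha0]
      have e1 : (K (x - y) ^ r) ^ (1 / s) * (K (x - y) ^ r) ^ (1 / r - 1 / s) = K (x - y) := by
        rw [← ENNReal.rpow_add_of_nonneg _ _ ha0 ha1, ← ENNReal.rpow_mul]
        have : r * (1 / s + (1 / r - 1 / s)) = 1 := by field_simp; ring
        rw [this, ENNReal.rpow_one]
      have e2 : (f y ^ q) ^ (1 / s) * (f y ^ q) ^ (1 / q - 1 / s) = f y := by
        rw [← ENNReal.rpow_add_of_nonneg _ _ ha0 ha2, ← ENNReal.rpow_mul]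
        have : q * (1 / s + (1 / q - 1 / s)) = 1 := by field_simp; ring
        rw [this, ENNReal.rpow_one]
      calc _ = ((K (x - y) ^ r) ^ (1 / s) * (K (x - y) ^ r) ^ (1 / r - 1 / s)) *
            ((f y ^ q) ^ (1 / s) * (f y ^ q) ^ (1 / q - 1 / s)) := by ring
        _ = _ := by rw [e1, e2]
    simp only [e] at h3
    refine (ENNReal.rpow_le_rpow h3 hs.le).trans_eq ?_
    rw [ENNReal.mul_rpow_of_nonneg _ _ hs.le, ENNReal.mul_rpow_of_nonneg _ _ hs.le,
      ← ENNReal.rpow_mul, ← ENNReal.rpow_mul, ← ENNReal.rpow_mul,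
      show 1 / s * s = 1 by field_simp, ENNReal.rpow_one, mul_assoc, mul_comm _ s, mul_comm _ s]
  have hprod : AEMeasurable (fun q' : V × V => K (q'.1 - q'.2) ^ r * f q'.2 ^ q)
      (volume.prod volume) :=
    (by fun_prop : Measurable fun q' : V × V => K (q'.1 - q'.2) ^ r).aemeasurable.mul
      ((hf.pow_const q).comp_snd)
  calc ∫⁻ x, (∫⁻ y, K (x - y) * f y) ^ s
      ≤ ∫⁻ x, (∫⁻ y, K (x - y) ^ r * f y ^ q) *
          (A ^ (s * (1 / r - 1 / s)) * B ^ (s * (1 / q - 1 / s))) := lintegral_mono hpt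
    _ = (∫⁻ x, ∫⁻ y, K (x - y) ^ r * f y ^ q) *
          (A ^ (s * (1 / r - 1 / s)) * B ^ (s * (1 / q - 1 / s))) :=
        lintegral_mul_const'' _ hprod.lintegral_prod_right'
    _ = (A * B) * (A ^ (s * (1 / r - 1 / s)) * B ^ (s * (1 / q - 1 / s))) := by
        congr 1
        rw [lintegral_lintegral_swap hprod]
        have : ∀ y, ∫⁻ x, K (x - y) ^ r * f y ^ q = A * f y ^ q := fun y => by
          rw [lintegral_mul_const _ (by fun_prop),
            lintegral_sub_right_eq_self (fun x => K x ^ r) y]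
        simp only [this]
        rw [lintegral_const_mul'' _ (hf.pow_const q)]
    _ = A ^ (s / r) * B ^ (s / q) := by
        have e1 : A * A ^ (s * (1 / r - 1 / s)) = A ^ (s / r) := by
          conv_lhs => enter [1]; rw [← ENNReal.rpow_one A]
          rw [← ENNReal.rpow_add_of_nonneg _ _ zero_le_one (mul_nonneg hs.le ha1)]
          congr 1; field_simp; ring
        have e2 : B * B ^ (s * (1 / q - 1 / s)) = B ^ (s / q) := by
          conv_lhs => enter [1]; rw [← ENNReal.rpow_one B]
          rw [← ENNReal.rpow_add_of_nonneg _ _ zero_le_one (mul_nonneg hs.le ha2)]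
          congr 1; field_simp; ring
        rw [← e1, ← e2]
        ring

/-- The convolution `k ∗ v`. -/
def conv (k v : V → ℝ) (x : V) : ℝ := ∫ y, k (x - y) * v y

lemma conv_congr {k v w : V → ℝ} (h : v =ᵐ[volume] w) : conv k v = conv k w := by
  ext x
  exact integral_congr_ae (h.mono fun y hy => by simp only [hy])

lemma aestronglyMeasurable_conv_integrand {k v : V → ℝ} (hk : Measurable k)
    (hv : AEStronglyMeasurable v) :
    AEStronglyMeasurable (fun q : V × V => k (q.1 - q.2) * v q.2) (volume.prod volume) :=
  (by fun_prop : Measurable fun q : V × V => k (q.1 - q.2)).aestronglyMeasurable.mul hv.comp_snd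

lemma aestronglyMeasurable_conv {k v : V → ℝ} (hk : Measurable k)
    (hv : AEStronglyMeasurable v) : AEStronglyMeasurable (conv k v) :=
  (aestronglyMeasurable_conv_integrand hk hv).integral_prod_right'

lemma enorm_conv_le (k v : V → ℝ) (x : V) : ‖conv k v x‖ₑ ≤ ∫⁻ y, ‖k (x - y)‖ₑ * ‖v y‖ₑ :=
  (enorm_integral_le_lintegral_enorm _).trans_eq (by simp only [enorm_mul])

lemma eLpNorm_ofReal_eq {f : V → ℝ} {s : ℝ} (hs : 0 < s) :
    eLpNorm f (ENNReal.ofReal s) volume = (∫⁻ x, ‖f x‖ₑ ^ s) ^ (1 / s) := by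
  rw [eLpNorm_eq_lintegral_rpow_enorm_toReal (by simpa using hs) ENNReal.ofReal_ne_top,
    ENNReal.toReal_ofReal hs.le]

section Young

variable {r q s : ℝ} {k v : V → ℝ}

lemma lintegral_conv_enorm_rpow_le (hk : Measurable k) (hv : AEStronglyMeasurable v)
    (hr : 0 < r) (hq : 0 < q) (hs : 0 < s) (hrs : r ≤ s) (hqs : q ≤ s)
    (h : 1 / r + 1 / q = 1 + 1 / s) :
    (∫⁻ x, (∫⁻ y, ‖k (x - y)‖ₑ * ‖v y‖ₑ) ^ s) ^ (1 / s) ≤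
      eLpNorm k (ENNReal.ofReal r) volume * eLpNorm v (ENNReal.ofReal q) volume := by
  have h1 := lintegral_conv_rpow_le hk.enorm hv.enorm hr hq hs hrs hqs h
  refine (ENNReal.rpow_le_rpow h1 (by positivity)).trans_eq ?_
  rw [ENNReal.mul_rpow_of_nonneg _ _ (by positivity), ← ENNReal.rpow_mul, ← ENNReal.rpow_mul,
    eLpNorm_ofReal_eq hr, eLpNorm_ofReal_eq hq]
  congr 2 <;> field_simp

/-- Young's convolution inequality. -/
lemma eLpNorm_conv_le (hk : Measurable k) (hv : AEStronglyMeasurable v)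
    (hr : 0 < r) (hq : 0 < q) (hs : 0 < s) (hrs : r ≤ s) (hqs : q ≤ s)
    (h : 1 / r + 1 / q = 1 + 1 / s) :
    eLpNorm (conv k v) (ENNReal.ofReal s) volume ≤
      eLpNorm k (ENNReal.ofReal r) volume * eLpNorm v (ENNReal.ofReal q) volume := by
  rw [eLpNorm_ofReal_eq hs]
  refine le_trans ?_ (lintegral_conv_enorm_rpow_le hk hv hr hq hs hrs hqs h)
  gcongr with x
  exact enorm_conv_le k v x

/-- Young's inequality applied to absolute values shows that the absolute convolution is finite
almost everywhere. Linearity of the convolution integral depends on this, since divergent integrals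
take the value `0`. -/
lemma ae_integrable_conv (hk : Measurable k) (hr : 0 < r) (hq : 0 < q) (hs : 0 < s)
    (hrs : r ≤ s) (hqs : q ≤ s) (h : 1 / r + 1 / q = 1 + 1 / s)
    (hkr : MemLp k (ENNReal.ofReal r)) (hvq : MemLp v (ENNReal.ofReal q)) :
    ∀ᵐ x : V, Integrable fun y => k (x - y) * v y := by
  have h1 := lintegral_conv_enorm_rpow_le hk hvq.1 hr hq hs hrs hqs h
  have h2 : ∫⁻ x, (∫⁻ y, ‖k (x - y)‖ₑ * ‖v y‖ₑ) ^ s ≠ ∞ := by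
    intro htop
    rw [htop, ENNReal.top_rpow_of_pos (by positivity), top_le_iff] at h1
    exact (ENNReal.mul_lt_top hkr.2 hvq.2).ne h1
  have hm : AEMeasurable fun x : V => (∫⁻ y, ‖k (x - y)‖ₑ * ‖v y‖ₑ) ^ s := by
    refine AEMeasurable.pow_const ?_ s
    have := (aestronglyMeasurable_conv_integrand hk hvq.1).enorm.lintegral_prod_right'
    simpa only [enorm_mul] using this
  filter_upwards [ae_lt_top' hm h2] with x hx
  refine ⟨(by fun_prop : Measurable fun y => k (x - y)).aestronglyMeasurable.mul hvq.1, ?_⟩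
  rw [hasFiniteIntegral_iff_enorm]
  simp only [enorm_mul]
  exact (ENNReal.rpow_lt_top_iff_of_pos hs).1 hx

end Young

lemma one_le_of_one_le_ofReal {s : ℝ} (h : 1 ≤ ENNReal.ofReal s) : 1 ≤ s := by
  by_contra hs
  exact absurd h (not_le.2 (ENNReal.ofReal_lt_one.2 (not_le.1 hs)))

section Operator

variable {s : ℝ} {k v w : V → ℝ}

lemma eLpNorm_conv_le_of_integrable (hs : 1 ≤ s) (hk : Measurable k)
    (hv : AEStronglyMeasurable v) :
    eLpNorm (conv k v) (ENNReal.ofReal s) volume ≤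
      eLpNorm k 1 volume * eLpNorm v (ENNReal.ofReal s) volume := by
  have := eLpNorm_conv_le hk hv one_pos (by linarith) (by linarith) hs le_rfl
    (show 1 / (1 : ℝ) + 1 / s = 1 + 1 / s by norm_num)
  rwa [ENNReal.ofReal_one] at this

lemma memLp_conv (hs : 1 ≤ s) (hk : Measurable k) (hki : Integrable k)
    (hv : MemLp v (ENNReal.ofReal s)) : MemLp (conv k v) (ENNReal.ofReal s) :=
  ⟨aestronglyMeasurable_conv hk hv.1, (eLpNorm_conv_le_of_integrable hs hk hv.1).trans_lt
    (ENNReal.mul_lt_top (memLp_one_iff_integrable.2 hki).2 hv.2)⟩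

lemma ae_integrable_conv_of_integrable (hs : 1 ≤ s) (hk : Measurable k) (hki : Integrable k)
    (hv : MemLp v (ENNReal.ofReal s)) : ∀ᵐ x : V, Integrable fun y => k (x - y) * v y :=
  ae_integrable_conv hk one_pos (by linarith) (by linarith) hs le_rfl
    (show 1 / (1 : ℝ) + 1 / s = 1 + 1 / s by norm_num)
    (by rw [ENNReal.ofReal_one]; exact memLp_one_iff_integrable.2 hki) hv

variable (s) in
/-- Convolution with an integrable kernel, as a bounded operator on `L^s`. -/
def convCLM [hs : Fact (1 ≤ ENNReal.ofReal s)] (k : V → ℝ) (hk : Measurable k)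
    (hki : Integrable k) :
    Lp ℝ (ENNReal.ofReal s) (volume : Measure V) →L[ℝ]
      Lp ℝ (ENNReal.ofReal s) (volume : Measure V) :=
  LinearMap.mkContinuous
    { toFun := fun v =>
        (memLp_conv (one_le_of_one_le_ofReal hs.out) hk hki (Lp.memLp v)).toLp (conv k v)
      map_add' := fun v w => by
        have hs' := one_le_of_one_le_ofReal hs.out
        rw [← MemLp.toLp_add]
        refine MemLp.toLp_congr _ _ ?_
        rw [conv_congr (Lp.coeFn_add v w)]
        filter_upwards [ae_integrable_conv_of_integrable hs' hk hki (Lp.memLp v),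
          ae_integrable_conv_of_integrable hs' hk hki (Lp.memLp w)] with x hv hw
        simp only [conv, Pi.add_apply, mul_add]
        exact integral_add hv hw
      map_smul' := fun c v => by
        rw [RingHom.id_apply, ← MemLp.toLp_const_smul]
        refine MemLp.toLp_congr _ _ ?_
        rw [conv_congr (Lp.coeFn_smul c v)]
        refine Eventually.of_forall fun x => ?_
        simp only [conv, Pi.smul_apply, smul_eq_mul, mul_left_comm _ c]
        exact integral_const_mul _ _ }
    (eLpNorm k 1 volume).toReal fun v => by
      have hs' := one_le_of_one_le_ofReal hs.out
      have h := eLpNorm_conv_le_of_integrable hs' hk (Lp.memLp v).1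
      simp only [LinearMap.coe_mk, AddHom.coe_mk]
      rw [Lp.norm_toLp, Lp.norm_def, ← ENNReal.toReal_mul]
      exact ENNReal.toReal_mono (ENNReal.mul_lt_top (memLp_one_iff_integrable.2 hki).2
        (Lp.memLp v).2).ne h

section

variable [hs : Fact (1 ≤ ENNReal.ofReal s)] {hk : Measurable k} {hki : Integrable k}

lemma convCLM_coeFn (v : Lp ℝ (ENNReal.ofReal s) (volume : Measure V)) :
    convCLM s k hk hki v =ᵐ[volume] conv k v :=
  MemLp.coeFn_toLp (memLp_conv (one_le_of_one_le_ofReal hs.out) hk hki (Lp.memLp v))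

lemma norm_convCLM_le (v : Lp ℝ (ENNReal.ofReal s) (volume : Measure V)) :
    ‖convCLM s k hk hki v‖ ≤ (∫ x, ‖k x‖) * ‖v‖ := by
  have h : ‖convCLM s k hk hki v‖ ≤ (eLpNorm k 1 volume).toReal * ‖v‖ :=
    (convCLM s k hk hki).le_of_opNorm_le (LinearMap.mkContinuous_norm_le _ ENNReal.toReal_nonneg _)
      v
  rwa [eLpNorm_one_eq_lintegral_enorm, ← integral_norm_eq_lintegral_enorm hki.1] at h

end

lemma abs_conv_le (hki : Integrable k) {R : ℝ} (hv : ∀ᵐ x, |v x| ≤ R) (x : V) :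
    |conv k v x| ≤ (∫ y, ‖k y‖) * R := by
  have h : ∫ y, ‖k (x - y)‖ * R = (∫ y, ‖k y‖) * R := by
    rw [integral_mul_const, integral_sub_left_eq_self (fun y => ‖k y‖) volume x]
  rw [← h]
  refine norm_integral_le_of_norm_le (f := fun y => k (x - y) * v y)
    ((hki.comp_sub_left x).norm.mul_const R) ?_
  filter_upwards [hv] with y hy
  rw [norm_mul]
  exact mul_le_mul_of_nonneg_left hy (norm_nonneg _)

lemma conv_nonneg (hk : ∀ x, 0 ≤ k x) (hv : ∀ᵐ x, 0 ≤ v x) (x : V) : 0 ≤ conv k v x :=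
  integral_nonneg_of_ae (hv.mono fun _ hy => mul_nonneg (hk _) hy)

lemma conv_sub_kernel {k' : V → ℝ} (hk : Integrable k) (hk' : Integrable k')
    (hv : AEStronglyMeasurable v) {R : ℝ} (hvR : ∀ᵐ x, |v x| ≤ R) (x : V) :
    conv k v x - conv k' v x = conv (fun y => k y - k' y) v x := by
  have hi : ∀ {k : V → ℝ}, Integrable k → Integrable fun y => k (x - y) * v y := fun h =>
    (h.comp_sub_left x).mul_bdd hv hvR
  simp only [conv, sub_mul]
  exact (integral_sub (hi hk) (hi hk')).symm

end Operator

/-! ### Averages of translates -/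

section ApproximateIdentity

variable {s : ℝ}

/-- Translation on `L^s`. -/
def translate (y : V) (v : Lp ℝ (ENNReal.ofReal s) (volume : Measure V)) :
    Lp ℝ (ENNReal.ofReal s) (volume : Measure V) :=
  DomAddAct.mk (-y) +ᵥ v

lemma translate_coeFn (y : V) (v : Lp ℝ (ENNReal.ofReal s) (volume : Measure V)) :
    translate y v =ᵐ[volume] fun x => v (x - y) := by
  refine (DomAddAct.vadd_Lp_ae_eq (DomAddAct.mk (-y)) v).trans
    (Eventually.of_forall fun x => ?_)
  simp [sub_eq_neg_add]

lemma translate_zero (v : Lp ℝ (ENNReal.ofReal s) (volume : Measure V)) :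
    translate 0 v = v := by
  refine Lp.ext ((translate_coeFn 0 v).trans (Eventually.of_forall fun x => ?_))
  simp

lemma norm_translate (y : V) (v : Lp ℝ (ENNReal.ofReal s) (volume : Measure V)) :
    ‖translate y v‖ = ‖v‖ :=
  DomAddAct.norm_vadd_Lp _ _

variable [hs : Fact (1 ≤ ENNReal.ofReal s)]

lemma continuous_translate (v : Lp ℝ (ENNReal.ofReal s) (volume : Measure V)) :
    Continuous fun y => translate y v := by
  have : Fact (ENNReal.ofReal s ≠ ∞) := ⟨ENNReal.ofReal_ne_top⟩
  have h : Continuous fun y : V => DomAddAct.mk (-y) :=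
    DomAddAct.continuous_mk.comp continuous_neg
  exact h.vadd continuous_const

/-- Jensen's inequality for the averages defining a convolution. -/
lemma norm_convCLM_sub_rpow_le {k : V → ℝ} (hk : Measurable k) (hki : Integrable k)
    (hk0 : ∀ x, 0 ≤ k x) (hk1 : ∫ x, k x = 1)
    (v : Lp ℝ (ENNReal.ofReal s) (volume : Measure V)) :
    ‖convCLM s k hk hki v - v‖ ^ s ≤ ∫ y, k y * ‖translate y v - v‖ ^ s := by
  have hs1 : 1 ≤ s := one_le_of_one_le_ofReal hs.out
  have hs0 : 0 < s := by linarith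
  set K : V → ℝ≥0∞ := fun y => ENNReal.ofReal (k y) with hK
  have hKm : Measurable K := by fun_prop
  have hK1 : ∫⁻ y, K y = 1 := by
    rw [hK, ← ofReal_integral_eq_lintegral_ofReal hki (Eventually.of_forall hk0), hk1,
      ENNReal.ofReal_one]
  have hvm : StronglyMeasurable v := Lp.stronglyMeasurable v
  have hvm' : Measurable v := hvm.measurable
  have hpow : ∀ u : Lp ℝ (ENNReal.ofReal s) (volume : Measure V),
      ENNReal.ofReal (‖u‖ ^ s) = ∫⁻ x, ‖u x‖ₑ ^ s := fun u => by
    rw [← ENNReal.ofReal_rpow_of_nonneg (norm_nonneg _) hs0.le, Lp.norm_def,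
      ENNReal.ofReal_toReal (Lp.memLp u).2.ne, eLpNorm_ofReal_eq hs0, ← ENNReal.rpow_mul]
    rw [one_div_mul_cancel hs0.ne', ENNReal.rpow_one]
  have hw : Continuous fun y => ‖translate y v - v‖ ^ s :=
    ((continuous_translate v).sub continuous_const).norm.rpow_const fun _ => Or.inr hs0.le
  have hwb : ∀ y, ‖‖translate y v - v‖ ^ s‖ ≤ (2 * ‖v‖) ^ s := fun y => by
    rw [Real.norm_of_nonneg (by positivity)]
    refine Real.rpow_le_rpow (norm_nonneg _) ((norm_sub_le _ _).trans ?_) hs0.le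
    rw [norm_translate]; linarith
  have hwi : Integrable fun y => k y * ‖translate y v - v‖ ^ s :=
    hki.mul_bdd hw.aestronglyMeasurable (Eventually.of_forall hwb)
  have hw0 : ∀ y, 0 ≤ k y * ‖translate y v - v‖ ^ s := fun y =>
    mul_nonneg (hk0 y) (by positivity)
  rw [← ENNReal.ofReal_le_ofReal_iff (integral_nonneg hw0), hpow,
    ofReal_integral_eq_lintegral_ofReal hwi (Eventually.of_forall hw0)]
  have hpt : ∀ᵐ x, ‖(convCLM s k hk hki v - v : Lp ℝ (ENNReal.ofReal s) volume) x‖ₑ ^ s ≤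
      ∫⁻ y, K y * ‖v (x - y) - v x‖ₑ ^ s := by
    filter_upwards [Lp.coeFn_sub (convCLM s k hk hki v) v,
      convCLM_coeFn (hk := hk) (hki := hki) v,
      ae_integrable_conv_of_integrable hs1 hk hki (Lp.memLp v)] with x h1 h2 h3
    have h3' : Integrable fun y => k y * v (x - y) := by
      have := h3.comp_sub_left x
      simpa using this
    have e1 : conv k v x = ∫ y, k y * v (x - y) := by
      rw [conv, ← integral_sub_left_eq_self _ volume x]
      simp
    have e2 : (convCLM s k hk hki v - v : Lp ℝ (ENNReal.ofReal s) volume) x =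
        ∫ y, k y * (v (x - y) - v x) := by
      rw [h1, Pi.sub_apply, h2, e1]
      simp only [mul_sub]
      rw [integral_sub h3' (hki.mul_const _), integral_mul_const, hk1, one_mul]
    have h4 : ‖∫ y, k y * (v (x - y) - v x)‖ₑ ≤ ∫⁻ y, K y * ‖v (x - y) - v x‖ₑ := by
      refine (enorm_integral_le_lintegral_enorm _).trans_eq (lintegral_congr fun y => ?_)
      rw [enorm_mul, Real.enorm_of_nonneg (hk0 y)]
    have hm : Measurable fun y => ‖v (x - y) - v x‖ₑ := by fun_prop
    have hq0 : 0 ≤ 1 - 1 / s := sub_nonneg.2 ((div_le_one hs0).2 hs1)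
    -- Hölder with the splitting `K = K^{1-1/s} K^{1/s}` for the probability density `K`; the weight
    -- `1 - 1/s` may vanish, so `s = 1` is covered.
    have h5 := ENNReal.lintegral_mul_norm_pow_le (μ := (volume : Measure V))
      (f := fun y => K y) (g := fun y => K y * ‖v (x - y) - v x‖ₑ ^ s)
      hKm.aemeasurable (by fun_prop) hq0 (by positivity : 0 ≤ 1 / s) (by ring)
    rw [hK1, ENNReal.one_rpow, one_mul] at h5
    have e3 : ∀ y, K y ^ (1 - 1 / s) * (K y * ‖v (x - y) - v x‖ₑ ^ s) ^ (1 / s) =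
        K y * ‖v (x - y) - v x‖ₑ := fun y => by
      rw [ENNReal.mul_rpow_of_nonneg _ _ (by positivity : 0 ≤ 1 / s), ← ENNReal.rpow_mul,
        mul_one_div_cancel hs0.ne', ENNReal.rpow_one, ← mul_assoc,
        ← ENNReal.rpow_add_of_nonneg _ _ hq0 (by positivity), sub_add_cancel, ENNReal.rpow_one]
    simp only [e3] at h5
    rw [e2]
    refine (ENNReal.rpow_le_rpow (h4.trans h5) hs0.le).trans_eq ?_
    rw [← ENNReal.rpow_mul, one_div_mul_cancel hs0.ne', ENNReal.rpow_one]
  refine (lintegral_mono_ae hpt).trans_eq ?_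
  rw [lintegral_lintegral_swap]
  · refine lintegral_congr fun y => ?_
    rw [lintegral_const_mul _ (by fun_prop), ENNReal.ofReal_mul (hk0 y), hpow]
    congr 1
    refine lintegral_congr_ae ?_
    filter_upwards [Lp.coeFn_sub (translate y v) v, translate_coeFn y v] with x h1 h2
    rw [h1, Pi.sub_apply, h2]
  · exact Measurable.aemeasurable (by simp only [Function.uncurry_def]; fun_prop)

end ApproximateIdentity

end Convolution

/-! ### The fractional heat semigroup on `L^s` -/

section HeatOperator

variable {n : ℕ} [NeZero n] {β : ℝ} {s : ℝ} [hs : Fact (1 ≤ ENNReal.ofReal s)]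

variable (n s) in
/-- The fractional heat semigroup on `L^s(ℝⁿ)`, extended by the identity to `t ≤ 0`. -/
def heatOp (hβ : 0 < β) (hβ2 : β ≤ 2) (t : ℝ) :
    Lp ℝ (ENNReal.ofReal s) (volume : Measure (EuclideanSpace ℝ (Fin n))) →L[ℝ]
      Lp ℝ (ENNReal.ofReal s) (volume : Measure (EuclideanSpace ℝ (Fin n))) :=
  if ht : 0 < t then
    convCLM s (heatKernel β t) (continuous_heatKernel hβ ht).measurable
      (integrable_heatKernel hβ hβ2 ht)
  else ContinuousLinearMap.id ℝ _

variable {hβ : 0 < β} {hβ2 : β ≤ 2} {t : ℝ}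

lemma heatOp_of_pos (ht : 0 < t) : heatOp n s hβ hβ2 t =
    convCLM s (heatKernel β t) (continuous_heatKernel hβ ht).measurable
      (integrable_heatKernel hβ hβ2 ht) := dif_pos ht

lemma heatOp_of_nonpos (ht : t ≤ 0) : heatOp n s hβ hβ2 t = ContinuousLinearMap.id ℝ _ :=
  dif_neg (not_lt.2 ht)

lemma heatOp_coeFn (ht : 0 < t)
    (v : Lp ℝ (ENNReal.ofReal s) (volume : Measure (EuclideanSpace ℝ (Fin n)))) :
    heatOp n s hβ hβ2 t v =ᵐ[volume] heatSemigroup β t v := by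
  rw [heatOp_of_pos ht]
  exact convCLM_coeFn v

lemma integral_norm_heatKernel (hβ : 0 < β) (hβ2 : β ≤ 2) (ht : 0 < t) :
    ∫ x : EuclideanSpace ℝ (Fin n), ‖heatKernel β t x‖ = 1 := by
  rw [← integral_heatKernel (n := n) hβ hβ2 ht]
  exact integral_congr_ae (Eventually.of_forall fun x =>
    Real.norm_of_nonneg (heatKernel_nonneg hβ hβ2 ht x))

lemma norm_heatOp_le (t : ℝ)
    (v : Lp ℝ (ENNReal.ofReal s) (volume : Measure (EuclideanSpace ℝ (Fin n)))) :
    ‖heatOp n s hβ hβ2 t v‖ ≤ ‖v‖ := by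
  rcases lt_or_ge 0 t with ht | ht
  · rw [heatOp_of_pos ht]
    refine (norm_convCLM_le v).trans_eq ?_
    rw [integral_norm_heatKernel hβ hβ2 ht, one_mul]
  · rw [heatOp_of_nonpos ht]
    exact le_rfl

lemma heatOp_abs_le {R : ℝ}
    {v : Lp ℝ (ENNReal.ofReal s) (volume : Measure (EuclideanSpace ℝ (Fin n)))}
    (hv : ∀ᵐ x, |v x| ≤ R) : ∀ᵐ x, |heatOp n s hβ hβ2 t v x| ≤ R := by
  rcases lt_or_ge 0 t with ht | ht
  · filter_upwards [heatOp_coeFn (hβ := hβ) (hβ2 := hβ2) ht v] with x hx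
    rw [hx]
    refine (abs_conv_le (integrable_heatKernel hβ hβ2 ht) hv x).trans_eq ?_
    rw [integral_norm_heatKernel hβ hβ2 ht, one_mul]
  · rw [heatOp_of_nonpos ht]
    exact hv

lemma heatOp_nonneg
    {v : Lp ℝ (ENNReal.ofReal s) (volume : Measure (EuclideanSpace ℝ (Fin n)))}
    (hv : ∀ᵐ x, 0 ≤ v x) : ∀ᵐ x, 0 ≤ heatOp n s hβ hβ2 t v x := by
  rcases lt_or_ge 0 t with ht | ht
  · filter_upwards [heatOp_coeFn (hβ := hβ) (hβ2 := hβ2) ht v] with x hx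
    rw [hx]
    exact conv_nonneg (heatKernel_nonneg hβ hβ2 ht) hv x
  · rw [heatOp_of_nonpos ht]
    exact hv

lemma heatOp_sub_abs_le {r R : ℝ} (ht : 0 < t) (hr : 0 < r)
    {v : Lp ℝ (ENNReal.ofReal s) (volume : Measure (EuclideanSpace ℝ (Fin n)))}
    (hv : ∀ᵐ x, |v x| ≤ R) :
    ∀ᵐ x, |(heatOp n s hβ hβ2 r v - heatOp n s hβ hβ2 t v : Lp ℝ (ENNReal.ofReal s) volume) x| ≤
      (∫ x : EuclideanSpace ℝ (Fin n), |heatKernel β r x - heatKernel β t x|) * R := by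
  filter_upwards [heatOp_coeFn (hβ := hβ) (hβ2 := hβ2) ht v,
    heatOp_coeFn (hβ := hβ) (hβ2 := hβ2) hr v,
    Lp.coeFn_sub (heatOp n s hβ hβ2 r v) (heatOp n s hβ hβ2 t v)] with x h1 h2 h3
  have i1 := integrable_heatKernel (n := n) hβ hβ2 ht
  have i2 := integrable_heatKernel (n := n) hβ hβ2 hr
  rw [h3, Pi.sub_apply, h1, h2]
  change |conv (heatKernel β r) v x - conv (heatKernel β t) v x| ≤ _
  rw [conv_sub_kernel i2 i1 (Lp.memLp v).1 hv]
  exact abs_conv_le (i2.sub i1) hv x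

lemma norm_heatOp_sub_le {r : ℝ} (ht : 0 < t) (hr : 0 < r)
    (v : Lp ℝ (ENNReal.ofReal s) (volume : Measure (EuclideanSpace ℝ (Fin n)))) :
    ‖heatOp n s hβ hβ2 r v - heatOp n s hβ hβ2 t v‖ ≤
      (∫ x : EuclideanSpace ℝ (Fin n), |heatKernel β r x - heatKernel β t x|) * ‖v‖ := by
  have hs1 := one_le_of_one_le_ofReal hs.out
  have i1 := integrable_heatKernel (n := n) hβ hβ2 ht
  have i2 := integrable_heatKernel (n := n) hβ hβ2 hr
  have m1 := (continuous_heatKernel (n := n) hβ ht).measurable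
  have m2 := (continuous_heatKernel (n := n) hβ hr).measurable
  have e : heatOp n s hβ hβ2 r v - heatOp n s hβ hβ2 t v =
      convCLM s (fun x => heatKernel β r x - heatKernel β t x) (m2.sub m1) (i2.sub i1) v := by
    refine Lp.ext ?_
    filter_upwards [heatOp_coeFn (hβ := hβ) (hβ2 := hβ2) ht v,
      heatOp_coeFn (hβ := hβ) (hβ2 := hβ2) hr v,
      Lp.coeFn_sub (heatOp n s hβ hβ2 r v) (heatOp n s hβ hβ2 t v),
      convCLM_coeFn (hk := m2.sub m1) (hki := i2.sub i1) v,
      ae_integrable_conv_of_integrable hs1 m1 i1 (Lp.memLp v),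
      ae_integrable_conv_of_integrable hs1 m2 i2 (Lp.memLp v)] with x h1 h2 h3 h4 h5 h6
    refine (h3.trans ?_).trans h4.symm
    rw [Pi.sub_apply, h1, h2]
    simp only [conv, Pi.sub_apply, sub_mul]
    exact (integral_sub h6 h5).symm
  rw [e]
  exact norm_convCLM_le v

lemma heatOp_add {a b : ℝ} (ha : 0 ≤ a) (hb : 0 ≤ b)
    (v : Lp ℝ (ENNReal.ofReal s) (volume : Measure (EuclideanSpace ℝ (Fin n)))) :
    heatOp n s hβ hβ2 (a + b) v = heatOp n s hβ hβ2 a (heatOp n s hβ hβ2 b v) := by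
  rcases ha.eq_or_lt with rfl | ha
  · rw [zero_add, heatOp_of_nonpos le_rfl]; rfl
  rcases hb.eq_or_lt with rfl | hb
  · rw [add_zero, heatOp_of_nonpos (t := 0) le_rfl]; rfl
  have hs1 := one_le_of_one_le_ofReal hs.out
  have hab : 0 < a + b := add_pos ha hb
  have ca := continuous_heatKernel (n := n) hβ ha
  have cb := continuous_heatKernel (n := n) hβ hb
  have ia := integrable_heatKernel (n := n) hβ hβ2 ha
  have ib := integrable_heatKernel (n := n) hβ hβ2 hb
  have iab := integrable_heatKernel (n := n) hβ hβ2 hab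
  have mab := (continuous_heatKernel (n := n) hβ hab).measurable
  have hconv : ∀ x z : EuclideanSpace ℝ (Fin n),
      ∫ y, heatKernel β a (x - y) * heatKernel β b (y - z) = heatKernel β (a + b) (x - z) :=
    fun x z => by
      rw [← heatKernel_conv hβ hβ2 ha hb, ← integral_sub_right_eq_self
        (fun y => heatKernel β a (x - z - y) * heatKernel β b y) z]
      simp only [sub_sub_sub_cancel_right]
  refine Lp.ext ?_
  refine (heatOp_coeFn hab v).trans ?_
  refine EventuallyEq.trans ?_ (heatOp_coeFn ha _).symm
  have e0 : heatSemigroup β a (heatOp n s hβ hβ2 b v) =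
      heatSemigroup β a (heatSemigroup β b v) := conv_congr (heatOp_coeFn hb v)
  rw [e0]
  filter_upwards [ae_integrable_conv_of_integrable hs1 mab iab (Lp.memLp v)] with x hx
  have hvm : Measurable v := (Lp.stronglyMeasurable v).measurable
  have hmeas : Measurable (Function.uncurry fun (z y : EuclideanSpace ℝ (Fin n)) =>
      heatKernel β a (x - y) * heatKernel β b (y - z) * v z) := by
    have := ca.measurable
    have := cb.measurable
    simp only [Function.uncurry_def]
    fun_prop
  obtain ⟨C, hC⟩ := exists_norm_heatKernel_le (n := n) hβ ha
  have hiy : ∀ z : EuclideanSpace ℝ (Fin n),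
      Integrable fun y => heatKernel β a (x - y) * heatKernel β b (y - z) := fun z =>
    (ib.comp_sub_right z).bdd_mul (ca.comp (by fun_prop)).aestronglyMeasurable
      (Eventually.of_forall fun y => hC _)
  -- Nonnegativity of the kernels turns the inner integral of the norm into `heatKernel β (a + b) (x
  -- - z) * ‖v z‖`, which is integrable in `z` for almost every `x`.
  have hint : Integrable (Function.uncurry fun (z y : EuclideanSpace ℝ (Fin n)) =>
      heatKernel β a (x - y) * heatKernel β b (y - z) * v z) (volume.prod volume) := by
    rw [integrable_prod_iff hmeas.aestronglyMeasurable]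
    refine ⟨Eventually.of_forall fun z => (hiy z).mul_const (v z), ?_⟩
    refine hx.norm.congr (Eventually.of_forall fun z => ?_)
    simp only [Function.uncurry_apply_pair]
    have : ∀ y, ‖heatKernel β a (x - y) * heatKernel β b (y - z) * v z‖ =
        heatKernel β a (x - y) * heatKernel β b (y - z) * ‖v z‖ := fun y => by
      rw [norm_mul, Real.norm_of_nonneg (mul_nonneg (heatKernel_nonneg hβ hβ2 ha _)
        (heatKernel_nonneg hβ hβ2 hb _))]
    simp only [this]
    rw [integral_mul_const, hconv, norm_mul, Real.norm_of_nonneg (heatKernel_nonneg hβ hβ2 hab _)]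
  calc heatSemigroup β (a + b) v x
      = ∫ z, ∫ y, heatKernel β a (x - y) * heatKernel β b (y - z) * v z := by
        simp only [integral_mul_const, hconv]
        rfl
    _ = ∫ y, ∫ z, heatKernel β a (x - y) * heatKernel β b (y - z) * v z :=
        integral_integral_swap hint
    _ = heatSemigroup β a (heatSemigroup β b v) x := by
        simp only [mul_assoc, integral_const_mul]
        rfl

lemma tendsto_heatOp_zero
    (v : Lp ℝ (ENNReal.ofReal s) (volume : Measure (EuclideanSpace ℝ (Fin n)))) :
    Tendsto (fun t => heatOp n s hβ hβ2 t v) (𝓝[>] 0) (𝓝 v) := by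
  have hs0 : 0 < s := by linarith [one_le_of_one_le_ofReal hs.out]
  have hw : Continuous fun y => ‖translate y v - v‖ ^ s :=
    ((continuous_translate v).sub continuous_const).norm.rpow_const fun _ => Or.inr hs0.le
  have hwb : ∀ y, ‖‖translate y v - v‖ ^ s‖ ≤ (2 * ‖v‖) ^ s := fun y => by
    rw [Real.norm_of_nonneg (by positivity)]
    refine Real.rpow_le_rpow (norm_nonneg _) ((norm_sub_le _ _).trans ?_) hs0.le
    rw [norm_translate]; linarith
  -- The test function `y ↦ ‖translate y v - v‖ ^ s` is bounded, continuous and zero at the origin;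
  -- by Jensen its average against the kernel dominates `‖S(t)v - v‖ ^ s`.
  have h := tendsto_integral_heatKernel_mul hβ hβ2 hw hwb
  rw [translate_zero, sub_self, norm_zero, Real.zero_rpow hs0.ne'] at h
  have h1 : Tendsto (fun t => ‖heatOp n s hβ hβ2 t v - v‖ ^ s) (𝓝[>] 0) (𝓝 0) := by
    refine squeeze_zero' (Eventually.of_forall fun t => by positivity) ?_ h
    filter_upwards [self_mem_nhdsWithin] with t ht
    rw [heatOp_of_pos ht]
    exact norm_convCLM_sub_rpow_le _ _ (heatKernel_nonneg hβ hβ2 ht)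
      (integral_heatKernel hβ hβ2 ht) v
  have h2 := h1.rpow_const (p := 1 / s) (Or.inr (by positivity))
  rw [Real.zero_rpow (by positivity)] at h2
  rw [tendsto_iff_norm_sub_tendsto_zero]
  refine h2.congr fun t => ?_
  rw [← Real.rpow_mul (norm_nonneg _), mul_one_div_cancel hs0.ne', Real.rpow_one]

lemma continuous_heatOp_apply
    (v : Lp ℝ (ENNReal.ofReal s) (volume : Measure (EuclideanSpace ℝ (Fin n)))) :
    Continuous fun t => heatOp n s hβ hβ2 t v := by
  rw [continuous_iff_continuousAt]
  intro t
  rcases lt_trichotomy t 0 with ht | rfl | ht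
  · refine (continuousAt_const (y := v)).congr ?_
    filter_upwards [gt_mem_nhds ht] with r hr
    rw [heatOp_of_nonpos hr.le]; rfl
  · rw [continuousAt_iff_continuous_left'_right']
    have h0 : heatOp n s hβ hβ2 0 v = v := by rw [heatOp_of_nonpos le_rfl]; rfl
    constructor
    · refine (continuousWithinAt_const (b := v)).congr (fun r hr => ?_) h0
      rw [heatOp_of_nonpos (le_of_lt hr)]; rfl
    · change Tendsto (fun t => heatOp n s hβ hβ2 t v) (𝓝[>] 0) (𝓝 (heatOp n s hβ hβ2 0 v))
      rw [h0]
      exact tendsto_heatOp_zero v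
  · unfold ContinuousAt
    rw [tendsto_iff_norm_sub_tendsto_zero]
    have h := (tendsto_integral_abs_heatKernel_sub (n := n) hβ hβ2 ht).mul_const ‖v‖
    rw [zero_mul] at h
    refine squeeze_zero' (Eventually.of_forall fun r => norm_nonneg _) ?_ h
    filter_upwards [lt_mem_nhds ht] with r hr
    exact norm_heatOp_sub_le ht hr v

/-- All the operators are contractions, so continuity in time for fixed `v` upgrades to joint
continuity. -/
lemma continuous_heatOp :
    Continuous fun q : ℝ × Lp ℝ (ENNReal.ofReal s)
      (volume : Measure (EuclideanSpace ℝ (Fin n))) => heatOp n s hβ hβ2 q.1 q.2 := by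
  refine continuous_prod_of_continuous_lipschitzWith' _ 1 (fun t => ?_) continuous_heatOp_apply
  refine LipschitzWith.of_dist_le_mul fun v w => ?_
  rw [dist_eq_norm, dist_eq_norm, ← map_sub, NNReal.coe_one, one_mul]
  exact norm_heatOp_le t _

end HeatOperator

/-! ### Estimates for the Riesz potential of `|u|^p` -/

section Riesz

lemma abs_rpow_sub_rpow_le {p : ℝ} (hp : 1 ≤ p) {a b : ℝ} (ha : 0 ≤ a) (hb : 0 ≤ b) :
    |a ^ p - b ^ p| ≤ p * (a ^ (p - 1) + b ^ (p - 1)) * |a - b| := by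
  have key : ∀ a b : ℝ, 0 ≤ a → a ≤ b →
      |a ^ p - b ^ p| ≤ p * (a ^ (p - 1) + b ^ (p - 1)) * |a - b| := by
    intro a b ha hab
    rcases ha.trans hab |>.eq_or_lt with hb | hb
    · have : a = 0 := le_antisymm (hab.trans hb.ge) ha
      simp [this, ← hb]
    -- Bernoulli's inequality at `a / b` is the tangent line bound `a^p ≥ b^p - p b^{p-1} (b - a)`.
    have h1 := one_add_mul_self_le_rpow_one_add (s := a / b - 1) (by
      have := div_nonneg ha hb.le; linarith) hp
    rw [add_sub_cancel, Real.div_rpow ha hb.le, le_div_iff₀ (by positivity)] at h1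
    have e : b ^ p = b ^ (p - 1) * b := by
      rw [← Real.rpow_add_one hb.ne', sub_add_cancel]
    have h2 : (1 + p * (a / b - 1)) * b ^ p = b ^ p - p * b ^ (p - 1) * (b - a) := by
      rw [e]; field_simp; ring
    have h3 : a ^ p ≤ b ^ p := Real.rpow_le_rpow ha hab (by linarith)
    rw [abs_of_nonpos (by linarith), abs_of_nonpos (by linarith)]
    have h4 : 0 ≤ p * a ^ (p - 1) * (b - a) :=
      mul_nonneg (by positivity) (by linarith)
    linarith
  rcases le_total a b with h | h
  · exact key a b ha h
  · have := key b a hb h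
    rwa [abs_sub_comm, abs_sub_comm b a, add_comm] at this

variable {n : ℕ} {α s p θ : ℝ}

/-- The unnormalized Riesz kernel. -/
def rieszKernel (n : ℕ) (α : ℝ) (z : EuclideanSpace ℝ (Fin n)) : ℝ := ‖z‖ ^ (-((n : ℝ) - α))

/-- The singular part of the Riesz kernel. -/
def rieszNear (n : ℕ) (α : ℝ) : EuclideanSpace ℝ (Fin n) → ℝ :=
  (Metric.ball 0 1).indicator (rieszKernel n α)

/-- The part at infinity of the Riesz kernel. -/
def rieszFar (n : ℕ) (α : ℝ) : EuclideanSpace ℝ (Fin n) → ℝ :=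
  (Metric.ball 0 1)ᶜ.indicator (rieszKernel n α)

lemma rieszPotential_eq (f : EuclideanSpace ℝ (Fin n) → ℝ) (x : EuclideanSpace ℝ (Fin n)) :
    rieszPotential α f x = rieszConst n α * conv (rieszKernel n α) f x := by
  simp only [rieszPotential, conv, rieszKernel]
  congr 2
  ext y
  rw [Real.rpow_neg (norm_nonneg _), div_eq_inv_mul]

lemma rieszConst_pos (hα : 0 < α) (hαn : α < n) : 0 < rieszConst n α := by
  have h1 := Real.Gamma_pos_of_pos (show 0 < ((n : ℝ) - α) / 2 by linarith)
  have h2 := Real.Gamma_pos_of_pos (show 0 < α / 2 by linarith)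
  unfold rieszConst
  positivity

lemma rieszKernel_nonneg (z : EuclideanSpace ℝ (Fin n)) : 0 ≤ rieszKernel n α z := by
  unfold rieszKernel; positivity

lemma measurable_rieszKernel : Measurable (rieszKernel n α) := by
  unfold rieszKernel; fun_prop

lemma measurable_rieszNear : Measurable (rieszNear n α) :=
  measurable_rieszKernel.indicator measurableSet_ball

lemma measurable_rieszFar : Measurable (rieszFar n α) :=
  measurable_rieszKernel.indicator measurableSet_ball.compl

lemma rieszNear_add_rieszFar (z : EuclideanSpace ℝ (Fin n)) :
    rieszNear n α z + rieszFar n α z = rieszKernel n α z :=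
  congrFun (indicator_self_add_compl (Metric.ball 0 1) (rieszKernel n α)) z

lemma integrable_rieszNear (hα : 0 < α) (hαn : α < n) : Integrable (rieszNear n α) := by
  have hn : 0 < n := by
    have : (0 : ℝ) < n := hα.trans hαn
    exact_mod_cast this
  rw [rieszNear, integrable_indicator_iff measurableSet_ball]
  refine integrableOn_ball_of_norm_le_rpow (C := 1) (α := (n : ℝ) - α)
    (by rw [finrank_euclideanSpace_fin]; exact hn)
    (by rw [finrank_euclideanSpace_fin]; linarith) (Eventually.of_forall fun x => ?_)
    measurable_rieszKernel.aestronglyMeasurable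
  rw [Real.norm_of_nonneg (rieszKernel_nonneg x), one_mul, rieszKernel]

lemma memLp_rieszFar {r : ℝ} (hr : 0 < r) (hαn : α < n) (h : (n : ℝ) < (n - α) * r) :
    MemLp (rieszFar n α) (ENNReal.ofReal r) := by
  rw [← integrable_norm_rpow_iff measurable_rieszFar.aestronglyMeasurable (by simpa using hr)
    ENNReal.ofReal_ne_top, ENNReal.toReal_ofReal hr.le]
  have hJ := integrable_one_add_norm (E := EuclideanSpace ℝ (Fin n)) (μ := volume)
    (r := (n - α) * r) (by rw [finrank_euclideanSpace_fin]; exact h)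
  have hm : Measurable (rieszFar n α) := measurable_rieszFar
  refine (hJ.const_mul (2 ^ ((n - α) * r))).mono'
    (Measurable.aestronglyMeasurable (by fun_prop)) (Eventually.of_forall fun x => ?_)
  rw [Real.norm_of_nonneg (by positivity)]
  by_cases hx : x ∈ Metric.ball (0 : EuclideanSpace ℝ (Fin n)) 1
  · rw [rieszFar, indicator_of_notMem (by simpa using hx), norm_zero, Real.zero_rpow hr.ne']
    positivity
  · have hx1 : 1 ≤ ‖x‖ := by simpa using hx
    rw [rieszFar, indicator_of_mem (by simpa using hx1),
      Real.norm_of_nonneg (rieszKernel_nonneg x), rieszKernel, ← Real.rpow_mul (norm_nonneg _),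
      neg_mul]
    have h2 : (1 + ‖x‖) / 2 ≤ ‖x‖ := by linarith
    calc ‖x‖ ^ (-((n - α) * r)) ≤ ((1 + ‖x‖) / 2) ^ (-((n - α) * r)) :=
          Real.rpow_le_rpow_of_nonpos (by positivity) h2 (by
            have := mul_pos (sub_pos.2 hαn) hr; linarith)
      _ = 2 ^ ((n - α) * r) * (1 + ‖x‖) ^ (-((n - α) * r)) := by
          rw [Real.div_rpow (by positivity) (by norm_num), Real.rpow_neg (by norm_num : (0:ℝ) ≤ 2)]
          field_simp

/-- Admissible exponents: the far part of the Riesz kernel lies in `L^{1/(1-θ)}`, and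
`|u|^{p-1}` lies in `L^{1/θ}` for bounded `u ∈ L^s`. -/
structure Admissible (n : ℕ) (α p s θ : ℝ) : Prop where
  α_pos : 0 < α
  α_lt : α < n
  s_ge : 1 ≤ s
  p_ge : 1 ≤ p
  lt_θ : α / n < θ
  θ_lt : θ < 1 - 1 / s
  sθ_le : s * θ ≤ p - 1

/-- The lower bound on `s` is equivalent to `α/n < 1 - 1/s`, the upper bound to `α/n < (p-1)/s`; `θ`
is taken strictly between `α/n` and the smaller right-hand side. -/
lemma exists_admissible (hα : 0 < α) (hαn : α < n) (hp : (n : ℝ) / (n - α) < p)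
    (hs : (n : ℝ) / (n - α) < s) (hs' : s < n * (p - 1) / α) : ∃ θ, Admissible n α p s θ := by
  have hn : (0 : ℝ) < n := hα.trans hαn
  have hna : 0 < (n : ℝ) - α := by linarith
  have h1 : 1 < (n : ℝ) / (n - α) := (one_lt_div hna).2 (by linarith)
  have hs0 : 0 < s := by linarith
  have ha : α / n < 1 - 1 / s := by
    rw [div_lt_iff₀ hna] at hs
    rw [lt_sub_iff_add_lt, div_add_div _ _ hn.ne' hs0.ne', div_lt_one (by positivity)]
    linarith
  have hb : α / n < (p - 1) / s := by
    rw [lt_div_iff₀ hα] at hs'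
    rw [div_lt_div_iff₀ hn hs0]
    linarith
  obtain ⟨θ, h2, h3⟩ := exists_between (lt_min ha hb)
  refine ⟨θ, hα, hαn, by linarith, by linarith, h2, h3.trans_le (min_le_left _ _), ?_⟩
  have := (h3.trans_le (min_le_right _ _)).le
  rw [le_div_iff₀ hs0] at this
  linarith

/-- `u` lies in the ball of radius `M` of `L^s ∩ L^∞`. -/
structure Bounded (s M : ℝ) (u : EuclideanSpace ℝ (Fin n) → ℝ) : Prop where
  meas : AEStronglyMeasurable u
  abs_le : ∀ᵐ x, |u x| ≤ M
  eLpNorm_le : eLpNorm u (ENNReal.ofReal s) volume ≤ ENNReal.ofReal M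

namespace Admissible

lemma θ_pos (h : Admissible n α p s θ) : 0 < θ :=
  (div_nonneg h.α_pos.le (Nat.cast_nonneg n)).trans_lt h.lt_θ

lemma s_pos (h : Admissible n α p s θ) : 0 < s := zero_lt_one.trans_le h.s_ge

lemma θ_lt_one (h : Admissible n α p s θ) : θ < 1 := h.θ_lt.trans (by
  have := one_div_pos.2 h.s_pos; linarith)

lemma memLp_far (h : Admissible n α p s θ) :
    MemLp (rieszFar n α) (ENNReal.ofReal (1 - θ)⁻¹) := by
  have h1 : 0 < 1 - θ := sub_pos.2 h.θ_lt_one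
  have hn : (0 : ℝ) < n := h.α_pos.trans h.α_lt
  refine memLp_rieszFar (inv_pos.2 h1) h.α_lt ?_
  have := h.lt_θ
  rw [div_lt_iff₀ hn] at this
  rw [← div_eq_mul_inv, lt_div_iff₀ h1]
  linarith

variable {g u v : EuclideanSpace ℝ (Fin n) → ℝ}

/-- The Young triple for the far part: `(1 - θ) + (1/s + θ) = 1 + 1/s`. The bound `θ < 1 - 1/s`
keeps the first exponent at most `s`. -/
lemma exponents (h : Admissible n α p s θ) :
    0 < (1 - θ)⁻¹ ∧ 0 < (1 / s + θ)⁻¹ ∧ (1 - θ)⁻¹ ≤ s ∧ (1 / s + θ)⁻¹ ≤ s ∧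
      1 / (1 - θ)⁻¹ + 1 / (1 / s + θ)⁻¹ = 1 + 1 / s := by
  have h0 := h.s_pos
  have h1 : 0 < 1 - θ := sub_pos.2 h.θ_lt_one
  have h2 : 0 < 1 / s + θ := add_pos (by positivity) h.θ_pos
  refine ⟨inv_pos.2 h1, inv_pos.2 h2, ?_, ?_, ?_⟩
  · rw [inv_le_comm₀ h1 h0, ← one_div]; linarith [h.θ_lt]
  · rw [inv_le_comm₀ h2 h0, ← one_div]; linarith [h.θ_pos]
  · simp only [one_div, inv_inv]; ring

lemma ae_integrable_near (h : Admissible n α p s θ) (hg : MemLp g (ENNReal.ofReal s)) :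
    ∀ᵐ x, Integrable fun y => rieszNear n α (x - y) * g y :=
  ae_integrable_conv_of_integrable h.s_ge measurable_rieszNear
    (integrable_rieszNear h.α_pos h.α_lt) hg

lemma ae_integrable_far (h : Admissible n α p s θ)
    (hgq : MemLp g (ENNReal.ofReal (1 / s + θ)⁻¹)) :
    ∀ᵐ x, Integrable fun y => rieszFar n α (x - y) * g y := by
  obtain ⟨e1, e2, e3, e4, e5⟩ := h.exponents
  exact ae_integrable_conv measurable_rieszFar e1 e2 h.s_pos e3 e4 e5 h.memLp_far hgq

lemma ae_integrable_kernel (h : Admissible n α p s θ) (hg : MemLp g (ENNReal.ofReal s))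
    (hgq : MemLp g (ENNReal.ofReal (1 / s + θ)⁻¹)) :
    ∀ᵐ x, Integrable fun y => rieszKernel n α (x - y) * g y := by
  filter_upwards [h.ae_integrable_near hg, h.ae_integrable_far hgq] with x h1 h2
  refine (h1.add h2).congr (Eventually.of_forall fun y => ?_)
  simp only [Pi.add_apply]
  rw [← add_mul, rieszNear_add_rieszFar]

lemma eLpNorm_conv_riesz_le (h : Admissible n α p s θ) (hg : MemLp g (ENNReal.ofReal s))
    (hgq : MemLp g (ENNReal.ofReal (1 / s + θ)⁻¹)) :
    eLpNorm (conv (rieszKernel n α) g) (ENNReal.ofReal s) volume ≤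
      eLpNorm (rieszNear n α) 1 volume * eLpNorm g (ENNReal.ofReal s) volume +
      eLpNorm (rieszFar n α) (ENNReal.ofReal (1 - θ)⁻¹) volume *
        eLpNorm g (ENNReal.ofReal (1 / s + θ)⁻¹) volume := by
  obtain ⟨e1, e2, e3, e4, e5⟩ := h.exponents
  have e : conv (rieszKernel n α) g =ᵐ[volume]
      conv (rieszNear n α) g + conv (rieszFar n α) g := by
    filter_upwards [h.ae_integrable_near hg, h.ae_integrable_far hgq] with x h1 h2
    simp only [conv, Pi.add_apply]
    rw [← integral_add h1 h2]
    refine integral_congr_ae (Eventually.of_forall fun y => ?_)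
    simp only
    rw [← add_mul, rieszNear_add_rieszFar]
  rw [eLpNorm_congr_ae e]
  refine (eLpNorm_add_le (aestronglyMeasurable_conv measurable_rieszNear hg.1)
    (aestronglyMeasurable_conv measurable_rieszFar hg.1) ?_).trans (add_le_add ?_ ?_)
  · simpa using h.s_ge
  · exact eLpNorm_conv_le_of_integrable h.s_ge measurable_rieszNear hg.1
  · exact eLpNorm_conv_le measurable_rieszFar hg.1 e1 e2 h.s_pos e3 e4 e5

/-- Pointwise bound for the Riesz potential of a bounded function in `L^{1/θ}`. -/
lemma enorm_conv_riesz_le (h : Admissible n α p s θ) (hg : AEStronglyMeasurable g) {R : ℝ}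
    (hR : ∀ᵐ x, |g x| ≤ R) (x : EuclideanSpace ℝ (Fin n)) :
    ‖conv (rieszKernel n α) g x‖ₑ ≤
      eLpNorm (rieszNear n α) 1 volume * ENNReal.ofReal R +
      eLpNorm (rieszFar n α) (ENNReal.ofReal (1 - θ)⁻¹) volume *
        eLpNorm g (ENNReal.ofReal θ⁻¹) volume := by
  have h1 : 0 < 1 - θ := sub_pos.2 h.θ_lt_one
  have mN : Measurable (rieszNear n α) := measurable_rieszNear
  have mF : Measurable (rieszFar n α) := measurable_rieszFar
  refine (enorm_conv_le _ _ x).trans ?_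
  calc ∫⁻ y, ‖rieszKernel n α (x - y)‖ₑ * ‖g y‖ₑ
      ≤ ∫⁻ y, (‖rieszNear n α (x - y)‖ₑ * ‖g y‖ₑ + ‖rieszFar n α (x - y)‖ₑ * ‖g y‖ₑ) := by
        refine lintegral_mono fun y => ?_
        rw [← add_mul, ← rieszNear_add_rieszFar]
        exact mul_le_mul_left (enorm_add_le _ _) _
    _ = (∫⁻ y, ‖rieszNear n α (x - y)‖ₑ * ‖g y‖ₑ) +
          ∫⁻ y, ‖rieszFar n α (x - y)‖ₑ * ‖g y‖ₑ :=
        lintegral_add_left' ((by fun_prop : Measurable fun y =>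
          ‖rieszNear n α (x - y)‖ₑ).aemeasurable.mul hg.enorm) _
    _ ≤ _ := by
        refine add_le_add ?_ ?_
        · calc ∫⁻ y, ‖rieszNear n α (x - y)‖ₑ * ‖g y‖ₑ
              ≤ ∫⁻ y, ‖rieszNear n α (x - y)‖ₑ * ENNReal.ofReal R := by
                refine lintegral_mono_ae (hR.mono fun y hy => ?_)
                refine mul_le_mul_right ?_ _
                rw [← ofReal_norm]
                exact ENNReal.ofReal_le_ofReal hy
            _ = _ := by
                rw [lintegral_mul_const _ (by fun_prop),
                  lintegral_sub_left_eq_self (fun y => ‖rieszNear n α y‖ₑ) x,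
                  eLpNorm_one_eq_lintegral_enorm]
        · have hc : ((1 - θ)⁻¹).HolderConjugate θ⁻¹ := by
            rw [Real.holderConjugate_iff]
            refine ⟨(one_lt_inv₀ h1).2 (by linarith [h.θ_pos]), ?_⟩
            simp
          refine (ENNReal.lintegral_mul_le_Lp_mul_Lq volume hc
            (by fun_prop : Measurable fun y => ‖rieszFar n α (x - y)‖ₑ).aemeasurable
            hg.enorm).trans_eq ?_
          rw [eLpNorm_ofReal_eq (inv_pos.2 h1), eLpNorm_ofReal_eq (inv_pos.2 h.θ_pos),
            lintegral_sub_left_eq_self (fun y => ‖rieszFar n α y‖ₑ ^ (1 - θ)⁻¹) x]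

lemma rpow_sub_one_le (h : Admissible n α p s θ) {M a : ℝ} (ha : 0 ≤ a) (haM : a ≤ M) :
    a ^ (p - 1) ≤ M ^ (p - 1) :=
  Real.rpow_le_rpow ha haM (by linarith [h.p_ge])

/-- In `|u|^{p-1} = |u|^{p-1-sθ} |u|^{sθ}` the first factor is bounded because `sθ ≤ p-1`, and the
second has `L^{1/θ}` norm `‖u‖_s^{sθ}`. -/
lemma eLpNorm_rpow_sub_one_le (h : Admissible n α p s θ) {M : ℝ} (hM : 0 ≤ M)
    (hu : Bounded s M u) :
    eLpNorm (fun x => |u x| ^ (p - 1)) (ENNReal.ofReal θ⁻¹) volume ≤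
      ENNReal.ofReal (M ^ (p - 1 - s * θ) * M ^ (s * θ)) := by
  have hsθ : 0 < s * θ := mul_pos h.s_pos h.θ_pos
  have h1 : ∀ᵐ x, ‖|u x| ^ (p - 1)‖ ≤ M ^ (p - 1 - s * θ) * ‖‖u x‖ ^ (s * θ)‖ := by
    filter_upwards [hu.abs_le] with x hx
    rw [Real.norm_of_nonneg (by positivity), Real.norm_of_nonneg (by positivity),
      Real.norm_eq_abs]
    calc |u x| ^ (p - 1) = |u x| ^ (p - 1 - s * θ) * |u x| ^ (s * θ) := by
          rw [← Real.rpow_add_of_nonneg (abs_nonneg _) (by linarith [h.sθ_le]) hsθ.le,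
            sub_add_cancel]
      _ ≤ _ := by
          refine mul_le_mul_of_nonneg_right ?_ (by positivity)
          exact Real.rpow_le_rpow (abs_nonneg _) hx (by linarith [h.sθ_le])
  refine (eLpNorm_le_mul_eLpNorm_of_ae_le_mul h1 _).trans ?_
  rw [eLpNorm_norm_rpow _ hsθ, ← ENNReal.ofReal_mul (inv_pos.2 h.θ_pos).le,
    ENNReal.ofReal_mul (by positivity : 0 ≤ M ^ (p - 1 - s * θ))]
  have e : θ⁻¹ * (s * θ) = s := by have := h.θ_pos.ne'; field_simp
  rw [e, ← ENNReal.ofReal_rpow_of_nonneg hM hsθ.le]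
  exact mul_le_mul_right (ENNReal.rpow_le_rpow hu.eLpNorm_le hsθ.le) _

/-- The local Lipschitz constant of `u ↦ |u|^p` from `L^s` to `L^{1/(1/s+θ)}`. -/
lemma eLpNorm_rpow_sub_le (h : Admissible n α p s θ) {M : ℝ} (hM : 0 ≤ M)
    (hu : Bounded s M u) (hv : Bounded s M v) :
    eLpNorm (fun x => |u x| ^ p - |v x| ^ p) (ENNReal.ofReal s) volume ≤
      ENNReal.ofReal (p * (M ^ (p - 1) + M ^ (p - 1))) *
        eLpNorm (fun x => u x - v x) (ENNReal.ofReal s) volume ∧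
    eLpNorm (fun x => |u x| ^ p - |v x| ^ p) (ENNReal.ofReal (1 / s + θ)⁻¹) volume ≤
      ENNReal.ofReal (p * (M ^ (p - 1 - s * θ) * M ^ (s * θ) +
        M ^ (p - 1 - s * θ) * M ^ (s * θ))) *
        eLpNorm (fun x => u x - v x) (ENNReal.ofReal s) volume := by
  have hp0 : 0 ≤ p := by linarith [h.p_ge]
  have hpt : ∀ x, ‖|u x| ^ p - |v x| ^ p‖ ≤
      p * (|u x| ^ (p - 1) + |v x| ^ (p - 1)) * ‖u x - v x‖ := fun x => by
    refine (abs_rpow_sub_rpow_le h.p_ge (abs_nonneg _) (abs_nonneg _)).trans ?_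
    exact mul_le_mul_of_nonneg_left (abs_abs_sub_abs_le _ _) (by positivity)
  have mu := hu.meas.aemeasurable
  have mv := hv.meas.aemeasurable
  have m1 : AEStronglyMeasurable fun x => |u x| ^ (p - 1) :=
    AEMeasurable.aestronglyMeasurable (by fun_prop)
  have m2 : AEStronglyMeasurable fun x => |v x| ^ (p - 1) :=
    AEMeasurable.aestronglyMeasurable (by fun_prop)
  constructor
  · refine eLpNorm_le_mul_eLpNorm_of_ae_le_mul ?_ _
    filter_upwards [hu.abs_le, hv.abs_le] with x h1 h2
    refine (hpt x).trans ?_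
    refine mul_le_mul_of_nonneg_right (mul_le_mul_of_nonneg_left ?_ hp0) (norm_nonneg _)
    exact add_le_add (h.rpow_sub_one_le (abs_nonneg _) h1) (h.rpow_sub_one_le (abs_nonneg _) h2)
  · set H : EuclideanSpace ℝ (Fin n) → ℝ := fun x => p * (|u x| ^ (p - 1) + |v x| ^ (p - 1))
    have mH : AEStronglyMeasurable H := (m1.add m2).const_mul p
    have hH0 : ∀ x, 0 ≤ H x := fun x => by positivity
    have hs0 := h.s_pos
    have hθ0 := h.θ_pos
    -- Hölder between `|u|^{p-1} + |v|^{p-1}` in `L^{1/θ}` and `u - v` in `L^s`.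
    have : ENNReal.HolderTriple (ENNReal.ofReal θ⁻¹) (ENNReal.ofReal s)
        (ENNReal.ofReal (1 / s + θ)⁻¹) := by
      constructor
      rw [← ENNReal.ofReal_inv_of_pos (by positivity), ← ENNReal.ofReal_inv_of_pos hs0,
        ← ENNReal.ofReal_inv_of_pos (by positivity), ← ENNReal.ofReal_add (by positivity)
        (by positivity)]
      congr 1
      simp only [inv_inv, one_div]
      ring
    have h1 : eLpNorm (fun x => |u x| ^ p - |v x| ^ p) (ENNReal.ofReal (1 / s + θ)⁻¹) volume ≤
        eLpNorm (H • fun x => u x - v x) (ENNReal.ofReal (1 / s + θ)⁻¹) volume := by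
      refine eLpNorm_mono fun x => (hpt x).trans_eq ?_
      rw [Pi.smul_apply', norm_smul, Real.norm_of_nonneg (hH0 x)]
    refine h1.trans ((eLpNorm_smul_le_mul_eLpNorm (p := ENNReal.ofReal θ⁻¹)
      (q := ENNReal.ofReal s) (hu.meas.sub hv.meas) mH).trans ?_)
    refine mul_le_mul_left ?_ _
    have hH : H = p • ((fun x => |u x| ^ (p - 1)) + fun x => |v x| ^ (p - 1)) := rfl
    rw [hH, eLpNorm_const_smul, Real.enorm_of_nonneg hp0, ENNReal.ofReal_mul hp0]
    refine mul_le_mul_right ((eLpNorm_add_le m1 m2 ?_).trans ?_) _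
    · rw [ENNReal.one_le_ofReal]
      exact (one_le_inv₀ hθ0).2 h.θ_lt_one.le
    · rw [ENNReal.ofReal_add (by positivity) (by positivity)]
      exact add_le_add (h.eLpNorm_rpow_sub_one_le hM hu) (h.eLpNorm_rpow_sub_one_le hM hv)

lemma memLp_rpow_sub (h : Admissible n α p s θ) {M : ℝ} (hM : 0 ≤ M)
    (hu : Bounded s M u) (hv : Bounded s M v) :
    MemLp (fun x => |u x| ^ p - |v x| ^ p) (ENNReal.ofReal s) ∧
      MemLp (fun x => |u x| ^ p - |v x| ^ p) (ENNReal.ofReal (1 / s + θ)⁻¹) := by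
  have mu := hu.meas.aemeasurable
  have mv := hv.meas.aemeasurable
  have m : AEStronglyMeasurable fun x => |u x| ^ p - |v x| ^ p :=
    AEMeasurable.aestronglyMeasurable (by fun_prop)
  have hfin : eLpNorm (fun x => u x - v x) (ENNReal.ofReal s) volume < ∞ :=
    (MemLp.sub ⟨hu.meas, hu.eLpNorm_le.trans_lt ENNReal.ofReal_lt_top⟩
      ⟨hv.meas, hv.eLpNorm_le.trans_lt ENNReal.ofReal_lt_top⟩).2
  obtain ⟨h1, h2⟩ := h.eLpNorm_rpow_sub_le hM hu hv
  exact ⟨⟨m, h1.trans_lt (ENNReal.mul_lt_top ENNReal.ofReal_lt_top hfin)⟩,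
    ⟨m, h2.trans_lt (ENNReal.mul_lt_top ENNReal.ofReal_lt_top hfin)⟩⟩

lemma bounded_zero {M : ℝ} (hM : 0 ≤ M) :
    Bounded s M (fun _ : EuclideanSpace ℝ (Fin n) => (0 : ℝ)) :=
  ⟨aestronglyMeasurable_const, Eventually.of_forall fun _ => by simpa using hM, by simp⟩

lemma memLp_rpow (h : Admissible n α p s θ) {M : ℝ} (hM : 0 ≤ M) (hu : Bounded s M u) :
    MemLp (fun x => |u x| ^ p) (ENNReal.ofReal s) ∧
      MemLp (fun x => |u x| ^ p) (ENNReal.ofReal (1 / s + θ)⁻¹) := by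
  have hp : p ≠ 0 := by linarith [h.p_ge]
  simpa [Real.zero_rpow hp] using h.memLp_rpow_sub hM hu (bounded_zero hM)

lemma memLp_rieszPotential (h : Admissible n α p s θ) {M : ℝ} (hM : 0 ≤ M)
    (hu : Bounded s M u) :
    MemLp (rieszPotential α fun y => |u y| ^ p) (ENNReal.ofReal s) := by
  obtain ⟨h1, h2⟩ := h.memLp_rpow hM hu
  have e : (rieszPotential α fun y => |u y| ^ p) =
      fun x => rieszConst n α * conv (rieszKernel n α) (fun y => |u y| ^ p) x :=
    funext fun x => rieszPotential_eq _ x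
  rw [e]
  refine MemLp.const_mul ⟨aestronglyMeasurable_conv measurable_rieszKernel h1.1, ?_⟩ _
  refine (h.eLpNorm_conv_riesz_le h1 h2).trans_lt (ENNReal.add_lt_top.2 ⟨?_, ?_⟩)
  · exact ENNReal.mul_lt_top
      (memLp_one_iff_integrable.2 (integrable_rieszNear h.α_pos h.α_lt)).2 h1.2
  · exact ENNReal.mul_lt_top h.memLp_far.2 h2.2

/-- The nonlinearity is locally Lipschitz in `L^s`. -/
lemma exists_lipschitz_rieszPotential (h : Admissible n α p s θ) {M : ℝ} (hM : 0 ≤ M) :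
    ∃ L : ℝ, 0 ≤ L ∧ ∀ u v : EuclideanSpace ℝ (Fin n) → ℝ, Bounded s M u → Bounded s M v →
      eLpNorm (fun x => rieszPotential α (fun y => |u y| ^ p) x -
        rieszPotential α (fun y => |v y| ^ p) x) (ENNReal.ofReal s) volume ≤
        ENNReal.ofReal L * eLpNorm (fun x => u x - v x) (ENNReal.ofReal s) volume := by
  have hA := (rieszConst_pos h.α_pos h.α_lt).le
  have hN := (memLp_one_iff_integrable.2 (integrable_rieszNear h.α_pos h.α_lt)).2
  have hF := h.memLp_far.2
  set N := (eLpNorm (rieszNear n α) 1 volume).toReal with hNdef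
  set F := (eLpNorm (rieszFar n α) (ENNReal.ofReal (1 - θ)⁻¹) volume).toReal with hFdef
  set a := p * (M ^ (p - 1) + M ^ (p - 1)) with ha
  set b := p * (M ^ (p - 1 - s * θ) * M ^ (s * θ) + M ^ (p - 1 - s * θ) * M ^ (s * θ)) with hb
  have hp0 : 0 ≤ p := by linarith [h.p_ge]
  have ha0 : 0 ≤ a := by positivity
  have hb0 : 0 ≤ b := by positivity
  have hN0 : 0 ≤ N := ENNReal.toReal_nonneg
  have hF0 : 0 ≤ F := ENNReal.toReal_nonneg
  refine ⟨rieszConst n α * (N * a + F * b), by positivity, fun u v hu hv => ?_⟩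
  obtain ⟨hg1, hg2⟩ := h.memLp_rpow_sub hM hu hv
  obtain ⟨hb1, hb2⟩ := h.eLpNorm_rpow_sub_le hM hu hv
  obtain ⟨hu1, hu2⟩ := h.memLp_rpow hM hu
  obtain ⟨hv1, hv2⟩ := h.memLp_rpow hM hv
  have e : (fun x => rieszPotential α (fun y => |u y| ^ p) x -
      rieszPotential α (fun y => |v y| ^ p) x) =ᵐ[volume]
      rieszConst n α • conv (rieszKernel n α) fun y => |u y| ^ p - |v y| ^ p := by
    filter_upwards [h.ae_integrable_kernel hu1 hu2, h.ae_integrable_kernel hv1 hv2] with x h1 h2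
    simp only [rieszPotential_eq, Pi.smul_apply, smul_eq_mul, conv, ← mul_sub]
    rw [← integral_sub h1 h2]
    simp only [mul_sub]
  rw [eLpNorm_congr_ae e, eLpNorm_const_smul, Real.enorm_of_nonneg hA,
    ENNReal.ofReal_mul hA, mul_assoc]
  refine mul_le_mul_right ((h.eLpNorm_conv_riesz_le hg1 hg2).trans ?_) _
  rw [ENNReal.ofReal_add (by positivity) (by positivity), ENNReal.ofReal_mul hN0,
    ENNReal.ofReal_mul hF0, hNdef, hFdef, ENNReal.ofReal_toReal hN.ne,
    ENNReal.ofReal_toReal hF.ne, add_mul, mul_assoc, mul_assoc]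
  exact add_le_add (mul_le_mul_right hb1 _) (mul_le_mul_right hb2 _)

/-- The near part is controlled by `|u|^p ≤ M^p`. For the far part, `|u|^p ≤ M |u|^{p-1}` lies in
`L^{1/θ}`, the exponent conjugate to that of the kernel. -/
lemma exists_abs_rieszPotential_le (h : Admissible n α p s θ) {M : ℝ} (hM : 0 ≤ M) :
    ∃ C : ℝ, 0 ≤ C ∧ ∀ u : EuclideanSpace ℝ (Fin n) → ℝ, Bounded s M u →
      ∀ x, |rieszPotential α (fun y => |u y| ^ p) x| ≤ C := by
  have hA := (rieszConst_pos h.α_pos h.α_lt).le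
  have hN := (memLp_one_iff_integrable.2 (integrable_rieszNear h.α_pos h.α_lt)).2
  have hF := h.memLp_far.2
  set B : ℝ≥0∞ := eLpNorm (rieszNear n α) 1 volume * ENNReal.ofReal (M ^ p) +
    eLpNorm (rieszFar n α) (ENNReal.ofReal (1 - θ)⁻¹) volume *
      (ENNReal.ofReal M * ENNReal.ofReal (M ^ (p - 1 - s * θ) * M ^ (s * θ))) with hB
  have hBfin : B ≠ ∞ := (ENNReal.add_lt_top.2 ⟨ENNReal.mul_lt_top hN ENNReal.ofReal_lt_top,
    ENNReal.mul_lt_top hF (ENNReal.mul_lt_top ENNReal.ofReal_lt_top ENNReal.ofReal_lt_top)⟩).ne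
  refine ⟨rieszConst n α * B.toReal, mul_nonneg hA ENNReal.toReal_nonneg, fun u hu x => ?_⟩
  have hp0 : 0 ≤ p := by linarith [h.p_ge]
  have h1 : ∀ᵐ y, |(|u y| ^ p)| ≤ M ^ p := by
    filter_upwards [hu.abs_le] with y hy
    rw [abs_of_nonneg (by positivity)]
    exact Real.rpow_le_rpow (abs_nonneg _) hy hp0
  have h2 : eLpNorm (fun y => |u y| ^ p) (ENNReal.ofReal θ⁻¹) volume ≤
      ENNReal.ofReal M * ENNReal.ofReal (M ^ (p - 1 - s * θ) * M ^ (s * θ)) := by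
    refine (eLpNorm_le_mul_eLpNorm_of_ae_le_mul (g := fun y => |u y| ^ (p - 1)) (c := M) ?_
      _).trans (mul_le_mul_right (h.eLpNorm_rpow_sub_one_le hM hu) _)
    filter_upwards [hu.abs_le] with y hy
    rw [Real.norm_of_nonneg (by positivity), Real.norm_of_nonneg (by positivity)]
    have e : |u y| ^ p = |u y| * |u y| ^ (p - 1) := by
      rw [← Real.rpow_one_add' (abs_nonneg _) (by linarith [h.p_ge]), add_sub_cancel]
    rw [e]
    exact mul_le_mul_of_nonneg_right hy (by positivity)
  have hm : AEStronglyMeasurable fun y => |u y| ^ p := (h.memLp_rpow hM hu).1.1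
  have h3 : ‖conv (rieszKernel n α) (fun y => |u y| ^ p) x‖ₑ ≤ B :=
    (h.enorm_conv_riesz_le hm h1 x).trans
      (add_le_add le_rfl (mul_le_mul_right h2 _))
  rw [rieszPotential_eq, abs_mul, abs_of_nonneg hA]
  refine mul_le_mul_of_nonneg_left ?_ hA
  have h4 := ENNReal.toReal_mono hBfin h3
  rwa [toReal_enorm] at h4

lemma rieszPotential_nonneg (h : Admissible n α p s θ) (x : EuclideanSpace ℝ (Fin n)) :
    0 ≤ rieszPotential α (fun y => |u y| ^ p) x :=
  mul_nonneg (rieszConst_pos h.α_pos h.α_lt).le (integral_nonneg fun y => by positivity)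

end Admissible

end Riesz

/-! ### Pointwise constraints as closed convex sets of `L^q` -/

section AeConstraint

variable {V : Type*} [MeasurableSpace V] {μ : Measure V} {q : ℝ≥0∞}

lemma convex_setOf_ae_mem {A : Set ℝ} (hA : Convex ℝ A) :
    Convex ℝ {u : Lp ℝ q μ | ∀ᵐ x ∂μ, u x ∈ A} := by
  intro u hu v hv a b ha hb hab
  filter_upwards [hu, hv, Lp.coeFn_add (a • u) (b • v), Lp.coeFn_smul a u, Lp.coeFn_smul b v]
    with x h1 h2 h3 h4 h5
  rw [h3, Pi.add_apply, h4, h5]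
  exact hA h1 h2 ha hb hab

variable [hq : Fact (1 ≤ q)]

/-- Norm convergence implies convergence in measure, hence almost everywhere along a subsequence.
This is why sup bounds and signs survive limits taken only in `L^s`. -/
lemma isClosed_setOf_ae_mem {A : Set ℝ} (hA : IsClosed A) :
    IsClosed {u : Lp ℝ q μ | ∀ᵐ x ∂μ, u x ∈ A} := by
  refine IsSeqClosed.isClosed fun u v hu huv => ?_
  obtain ⟨ns, _, hlim⟩ := (tendstoInMeasure_of_tendsto_Lp huv).exists_seq_tendsto_ae
  have hall : ∀ᵐ x ∂μ, ∀ i, u (ns i) x ∈ A := ae_all_iff.2 fun i => hu (ns i)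
  filter_upwards [hlim, hall] with x h1 h2
  exact hA.mem_of_tendsto h1 (Eventually.of_forall h2)

lemma integral_nonneg_ae {t : ℝ} (ht : 0 ≤ t) {g : ℝ → Lp ℝ q μ}
    (hg : ∀ τ ∈ Ioo 0 t, ∀ᵐ x ∂μ, 0 ≤ g τ x) (hi : IntervalIntegrable g volume 0 t) :
    ∀ᵐ x ∂μ, 0 ≤ (∫ τ in (0 : ℝ)..t, g τ) x := by
  rcases ht.eq_or_lt with rfl | ht
  · rw [intervalIntegral.integral_same]
    filter_upwards [Lp.coeFn_zero ℝ q μ] with x hx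
    rw [hx]; rfl
  have h2 := (convex_setOf_ae_mem (μ := μ) (q := q) (convex_Ici (0 : ℝ))).set_average_mem
    (isClosed_setOf_ae_mem isClosed_Ici) (μ := volume) (t := Ioo 0 t) (f := g)
    (by simpa using ht) (by simp) ((ae_restrict_iff' measurableSet_Ioo).2
    (Eventually.of_forall hg)) (hi.1.mono_set Ioo_subset_Ioc_self)
  rw [setAverage_eq, ← integral_Ioc_eq_integral_Ioo,
    ← intervalIntegral.integral_of_le ht.le] at h2
  filter_upwards [h2, Lp.coeFn_smul (volume.real (Ioo 0 t))⁻¹ (∫ τ in (0 : ℝ)..t, g τ)]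
    with x h2 h4
  rw [h4, Pi.smul_apply, smul_eq_mul, mem_Ici] at h2
  have hpos : 0 < (volume.real (Ioo 0 t))⁻¹ := by simpa [ht.le] using ht
  exact nonneg_of_mul_nonneg_right h2 hpos

end AeConstraint

/-! ### The concrete problem in `L^s` -/

section Problem

variable {n : ℕ} {s : ℝ}

variable (n s) in
/-- The ball of radius `M` of `L^s ∩ L^∞`, as a subset of `L^s`. -/
def lpBall (M : ℝ) : Set (Lp ℝ (ENNReal.ofReal s) (volume : Measure (EuclideanSpace ℝ (Fin n)))) :=
  {u | ‖u‖ ≤ M ∧ ∀ᵐ x, u x ∈ Icc (-M) M}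

lemma mem_lpBall {M : ℝ}
    {u : Lp ℝ (ENNReal.ofReal s) (volume : Measure (EuclideanSpace ℝ (Fin n)))} :
    u ∈ lpBall n s M ↔ ‖u‖ ≤ M ∧ ∀ᵐ x, |u x| ≤ M := by
  simp only [lpBall, mem_ofPred_eq, mem_Icc, abs_le]

lemma bounded_of_mem_lpBall {M : ℝ}
    {u : Lp ℝ (ENNReal.ofReal s) (volume : Measure (EuclideanSpace ℝ (Fin n)))}
    (hu : u ∈ lpBall n s M) : Bounded s M u := by
  rw [mem_lpBall] at hu
  refine ⟨(Lp.memLp u).1, hu.2, ?_⟩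
  rw [← ENNReal.ofReal_toReal (Lp.memLp u).2.ne]
  exact ENNReal.ofReal_le_ofReal hu.1

variable [hs : Fact (1 ≤ ENNReal.ofReal s)]

lemma isClosed_lpBall (M : ℝ) : IsClosed (lpBall n s M) :=
  (isClosed_le continuous_norm continuous_const).inter (isClosed_setOf_ae_mem isClosed_Icc)

lemma convex_lpBall (M : ℝ) : Convex ℝ (lpBall n s M) := by
  have h : Convex ℝ
      {u : Lp ℝ (ENNReal.ofReal s) (volume : Measure (EuclideanSpace ℝ (Fin n))) | ‖u‖ ≤ M} := by
    have := convex_closedBall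
      (0 : Lp ℝ (ENNReal.ofReal s) (volume : Measure (EuclideanSpace ℝ (Fin n)))) M
    simpa [Metric.closedBall] using this
  exact h.inter (convex_setOf_ae_mem (convex_Icc _ _))

lemma nonneg_of_mem_lpBall {M : ℝ}
    {u : Lp ℝ (ENNReal.ofReal s) (volume : Measure (EuclideanSpace ℝ (Fin n)))}
    (hu : u ∈ lpBall n s M) : 0 ≤ M := (norm_nonneg _).trans hu.1

open Classical in
variable (n s) in
/-- The nonlinearity `u ↦ I_α(|u|^p)` on `L^s`, with value `0` where it is not defined. -/
def rieszNonlinearity (α p : ℝ)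
    (u : Lp ℝ (ENNReal.ofReal s) (volume : Measure (EuclideanSpace ℝ (Fin n)))) :
    Lp ℝ (ENNReal.ofReal s) (volume : Measure (EuclideanSpace ℝ (Fin n))) :=
  if h : MemLp (rieszPotential α fun y => |u y| ^ p) (ENNReal.ofReal s) volume then h.toLp _
  else 0

variable {α β p θ : ℝ}

lemma rieszNonlinearity_coeFn (h : Admissible n α p s θ) {M : ℝ}
    {u : Lp ℝ (ENNReal.ofReal s) (volume : Measure (EuclideanSpace ℝ (Fin n)))}
    (hu : u ∈ lpBall n s M) :
    rieszNonlinearity n s α p u =ᵐ[volume] rieszPotential α fun y => |u y| ^ p := by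
  have hm := h.memLp_rieszPotential (nonneg_of_mem_lpBall hu) (bounded_of_mem_lpBall hu)
  rw [rieszNonlinearity, dif_pos hm]
  exact hm.coeFn_toLp

lemma exists_lipschitz_rieszNonlinearity (h : Admissible n α p s θ) (M : ℝ) :
    ∃ L, 0 ≤ L ∧ ∀ u ∈ lpBall n s M, ∀ v ∈ lpBall n s M,
      ‖rieszNonlinearity n s α p u - rieszNonlinearity n s α p v‖ ≤ L * ‖u - v‖ := by
  by_cases hM : 0 ≤ M
  swap
  · exact ⟨0, le_rfl, fun u hu => absurd (nonneg_of_mem_lpBall hu) hM⟩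
  obtain ⟨L, hL0, hL⟩ := h.exists_lipschitz_rieszPotential hM
  refine ⟨L, hL0, fun u hu v hv => ?_⟩
  have h1 := hL u v (bounded_of_mem_lpBall hu) (bounded_of_mem_lpBall hv)
  have e1 : (rieszNonlinearity n s α p u - rieszNonlinearity n s α p v :
      Lp ℝ (ENNReal.ofReal s) volume) =ᵐ[volume] fun x =>
      rieszPotential α (fun y => |u y| ^ p) x - rieszPotential α (fun y => |v y| ^ p) x := by
    filter_upwards [Lp.coeFn_sub (rieszNonlinearity n s α p u) (rieszNonlinearity n s α p v),
      rieszNonlinearity_coeFn h hu, rieszNonlinearity_coeFn h hv] with x h1 h2 h3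
    rw [h1, Pi.sub_apply, h2, h3]
  rw [← eLpNorm_congr_ae e1, show (fun x => u x - v x) = ⇑u - ⇑v from rfl,
    ← eLpNorm_congr_ae (Lp.coeFn_sub u v)] at h1
  have h2 := ENNReal.toReal_mono (ENNReal.mul_lt_top ENNReal.ofReal_lt_top
    (Lp.memLp (u - v)).2).ne h1
  rwa [ENNReal.toReal_mul, ENNReal.toReal_ofReal hL0] at h2

/-- The `L^s` bound comes from comparing with `u = 0` through the Lipschitz estimate, the sup bound
from the pointwise estimate. -/
lemma exists_rieszNonlinearity_mem (h : Admissible n α p s θ) (M : ℝ) :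
    ∃ C, 0 ≤ C ∧ ∀ u ∈ lpBall n s M, rieszNonlinearity n s α p u ∈ lpBall n s C := by
  by_cases hM : 0 ≤ M
  swap
  · exact ⟨0, le_rfl, fun u hu => absurd (nonneg_of_mem_lpBall hu) hM⟩
  obtain ⟨C, hC0, hC⟩ := h.exists_abs_rieszPotential_le hM
  obtain ⟨L, hL0, hL⟩ := exists_lipschitz_rieszNonlinearity h M
  have h0 : (0 : Lp ℝ (ENNReal.ofReal s) (volume : Measure (EuclideanSpace ℝ (Fin n)))) ∈
      lpBall n s M := by
    rw [mem_lpBall]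
    refine ⟨by simpa using hM, ?_⟩
    filter_upwards [Lp.coeFn_zero ℝ (ENNReal.ofReal s)
      (volume : Measure (EuclideanSpace ℝ (Fin n)))] with x hx
    rw [hx]; simpa using hM
  set D := ‖rieszNonlinearity n s α p 0‖ with hD
  refine ⟨max C (L * M + D), hC0.trans (le_max_left _ _), fun u hu => ?_⟩
  rw [mem_lpBall]
  constructor
  · refine le_trans ?_ (le_max_right _ _)
    have h1 := hL u hu 0 h0
    rw [sub_zero] at h1
    have h2 := norm_sub_norm_le (rieszNonlinearity n s α p u) (rieszNonlinearity n s α p 0)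
    have h3 := mul_le_mul_of_nonneg_left hu.1 hL0
    linarith
  · filter_upwards [rieszNonlinearity_coeFn h hu] with x hx
    rw [hx]
    exact (hC u (bounded_of_mem_lpBall hu) x).trans (le_max_left _ _)

variable [NeZero n]

/-- The fractional heat equation with Riesz potential nonlinearity, as a semilinear problem in
`L^s(ℝⁿ)`. -/
def rieszProblem (hβ : 0 < β) (hβ2 : β ≤ 2) (h : Admissible n α p s θ) :
    SemilinearProblem (Lp ℝ (ENNReal.ofReal s) (volume : Measure (EuclideanSpace ℝ (Fin n)))) where
  S := heatOp n s hβ hβ2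
  B := lpBall n s
  N := rieszNonlinearity n s α p
  S_zero x := by rw [heatOp_of_nonpos le_rfl]; rfl
  S_add _ _ ha hb x := heatOp_add ha hb x
  continuous_S := continuous_heatOp
  norm_S_le := norm_heatOp_le
  isClosed_B := isClosed_lpBall
  convex_B := convex_lpBall
  mono_B a b hab u hu := by
    rw [mem_lpBall] at hu ⊢
    exact ⟨hu.1.trans hab, hu.2.mono fun x hx => hx.trans hab⟩
  zero_mem_B M hM := by
    rw [mem_lpBall]
    refine ⟨by simpa using hM, ?_⟩
    filter_upwards [Lp.coeFn_zero ℝ (ENNReal.ofReal s)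
      (volume : Measure (EuclideanSpace ℝ (Fin n)))] with x hx
    rw [hx]; simpa using hM
  add_mem_B a b u v hu hv := by
    rw [mem_lpBall] at hu hv ⊢
    refine ⟨(norm_add_le _ _).trans (add_le_add hu.1 hv.1), ?_⟩
    filter_upwards [hu.2, hv.2, Lp.coeFn_add u v] with x h1 h2 h3
    rw [h3]
    exact (abs_add_le _ _).trans (add_le_add h1 h2)
  smul_mem_B c a u hc hu := by
    rw [mem_lpBall] at hu ⊢
    refine ⟨?_, ?_⟩
    · rw [norm_smul, Real.norm_of_nonneg hc]
      exact mul_le_mul_of_nonneg_left hu.1 hc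
    · filter_upwards [hu.2, Lp.coeFn_smul c u] with x h1 h2
      rw [h2, Pi.smul_apply, smul_eq_mul, abs_mul, abs_of_nonneg hc]
      exact mul_le_mul_of_nonneg_left h1 hc
  S_mem_B t a u hu := by
    rw [mem_lpBall] at hu ⊢
    exact ⟨(norm_heatOp_le t u).trans hu.1, heatOp_abs_le hu.2⟩
  lipschitz_N := exists_lipschitz_rieszNonlinearity h
  N_mem_B := exists_rieszNonlinearity_mem h

variable {hβ : 0 < β} {hβ2 : β ≤ 2} {h : Admissible n α p s θ}
  {U₀ : Lp ℝ (ENNReal.ofReal s) (volume : Measure (EuclideanSpace ℝ (Fin n)))}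
  {u : ℝ → Lp ℝ (ENNReal.ofReal s) (volume : Measure (EuclideanSpace ℝ (Fin n)))} {T : ℝ}

/-- This and the next two lemmas restate abstract facts with `lpBall`, `heatOp` and
`rieszNonlinearity` visible. -/
lemma SemilinearProblem.IsMild.exists_mem_lpBall (hu : (rieszProblem hβ hβ2 h).IsMild U₀ T u) :
    ∃ M, ∀ t ∈ Icc 0 T, u t ∈ lpBall n s M := hu.bounded

lemma SemilinearProblem.IsMild.duhamel_heatOp (hu : (rieszProblem hβ hβ2 h).IsMild U₀ T u) {t : ℝ}
    (ht : t ∈ Icc 0 T) : u t = heatOp n s hβ hβ2 t U₀ +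
      ∫ τ in (0 : ℝ)..t, heatOp n s hβ hβ2 (t - τ) (rieszNonlinearity n s α p (u τ)) :=
  hu.duhamel t ht

lemma SemilinearProblem.IsMild.intervalIntegrable_heatOp (hu : (rieszProblem hβ hβ2 h).IsMild U₀ T u) {t : ℝ}
    (ht : t ∈ Icc 0 T) : IntervalIntegrable
      (fun τ => heatOp n s hβ hβ2 (t - τ) (rieszNonlinearity n s α p (u τ))) volume 0 t :=
  hu.intervalIntegrable t ⟨le_rfl, ht.1.trans ht.2⟩ ht

/-- No comparison principle is needed: the source `I_α(|u|^p)` is nonnegative whatever the sign of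
`u`, and the semigroup preserves positivity. -/
lemma SemilinearProblem.IsMild.nonneg (hu : (rieszProblem hβ hβ2 h).IsMild U₀ T u) (hU₀ : ∀ᵐ x, 0 ≤ U₀ x)
    {t : ℝ} (ht : t ∈ Icc 0 T) : ∀ᵐ x, 0 ≤ u t x := by
  obtain ⟨M, hM⟩ := hu.exists_mem_lpBall
  have h2 := integral_nonneg_ae ht.1 (fun τ hτ => heatOp_nonneg ((rieszNonlinearity_coeFn h
    (hM τ ⟨hτ.1.le, hτ.2.le.trans ht.2⟩)).mono fun x hx => by
      rw [hx]; exact h.rieszPotential_nonneg x)) (hu.intervalIntegrable_heatOp ht)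
  rw [hu.duhamel_heatOp ht]
  filter_upwards [heatOp_nonneg (hβ := hβ) (hβ2 := hβ2) (t := t) hU₀, h2, Lp.coeFn_add
    (heatOp n s hβ hβ2 t U₀) (∫ τ in (0 : ℝ)..t, heatOp n s hβ hβ2 (t - τ)
      (rieszNonlinearity n s α p (u τ)))] with x h1 h2 h3
  rw [h3]
  exact add_nonneg h1 h2

/-- Mild solutions are continuous into `L^∞` at positive times. -/
lemma SemilinearProblem.IsMild.eventually_abs_sub_le (hu : (rieszProblem hβ hβ2 h).IsMild U₀ T u) {t₀ : ℝ}
    (ht₀ : t₀ ∈ Ioo 0 T) {ε : ℝ} (hε : 0 < ε) :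
    ∀ᶠ t in 𝓝 t₀, ∀ᵐ x, |u t x - u t₀ x| ≤ ε := by
  obtain ⟨M, hM⟩ := hu.bounded
  obtain ⟨C, hC0, hC⟩ := hu.exists_sub_S_mem_B
  -- Restart at a time `a` just before `t₀`. The Duhamel remainders at `t` and `t₀` are at most `(t
  -- - a) C` and `(t₀ - a) C` in sup norm, and the linear parts differ by at most `M` times the `L¹`
  -- distance of two kernels at positive times.
  obtain ⟨a, ha0, hat, haC⟩ : ∃ a, 0 < a ∧ a < t₀ ∧ (t₀ - a) * C + (t₀ - a) * C < ε := by
    have hlim : Tendsto (fun a : ℝ => (t₀ - a) * C + (t₀ - a) * C) (𝓝[<] t₀) (𝓝 0) := by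
      have : Continuous fun a : ℝ => (t₀ - a) * C + (t₀ - a) * C := by fun_prop
      simpa using (this.tendsto t₀).mono_left nhdsWithin_le_nhds
    obtain ⟨a, h1, h2⟩ := ((hlim.eventually (gt_mem_nhds hε)).and
      (Ioo_mem_nhdsLT ht₀.1)).exists
    exact ⟨a, h2.1, h2.2, h1⟩
  have hωlim : Tendsto (fun t => (t - a) * C + (t₀ - a) * C +
      (∫ x : EuclideanSpace ℝ (Fin n), |heatKernel β (t - a) x - heatKernel β (t₀ - a) x|) * M)
      (𝓝 t₀) (𝓝 ((t₀ - a) * C + (t₀ - a) * C + 0 * M)) := by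
    have h1 : Tendsto (fun t => t - a) (𝓝 t₀) (𝓝 (t₀ - a)) :=
      tendsto_id.sub_const a
    refine ((h1.mul_const C).add_const _).add (Tendsto.mul_const M ?_)
    exact (tendsto_integral_abs_heatKernel_sub (n := n) hβ hβ2 (sub_pos.2 hat)).comp h1
  rw [zero_mul, add_zero] at hωlim
  filter_upwards [hωlim.eventually (gt_mem_nhds haC), Ioo_mem_nhds hat ht₀.2] with t h1 h2
  have b1 := (mem_lpBall.1 (hC a t ha0.le h2.1.le h2.2.le)).2
  have b2 := (mem_lpBall.1 (hC a t₀ ha0.le hat.le ht₀.2.le)).2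
  have b3 := heatOp_sub_abs_le (hβ := hβ) (hβ2 := hβ2) (sub_pos.2 hat) (sub_pos.2 h2.1)
    (mem_lpBall.1 (hM a ⟨ha0.le, hat.le.trans ht₀.2.le⟩)).2
  filter_upwards [b1, b2, b3, Lp.coeFn_sub (u t) (heatOp n s hβ hβ2 (t - a) (u a)),
    Lp.coeFn_sub (u t₀) (heatOp n s hβ hβ2 (t₀ - a) (u a)),
    Lp.coeFn_sub (heatOp n s hβ hβ2 (t - a) (u a)) (heatOp n s hβ hβ2 (t₀ - a) (u a))]
    with x c1 c2 c3 c4 c5 c6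
  change |(u t - heatOp n s hβ hβ2 (t - a) (u a) : Lp ℝ (ENNReal.ofReal s) volume) x| ≤ _ at c1
  change |(u t₀ - heatOp n s hβ hβ2 (t₀ - a) (u a) : Lp ℝ (ENNReal.ofReal s) volume) x| ≤ _ at c2
  rw [c4, Pi.sub_apply, abs_le] at c1
  rw [c5, Pi.sub_apply, abs_le] at c2
  rw [c6, Pi.sub_apply, abs_le] at c3
  rw [abs_le]
  constructor <;> linarith [c1.1, c1.2, c2.1, c2.2, c3.1, c3.2]

end Problem

/-! ### Abstract mild solutions and `IsMildSolution` -/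

section Equivalence

variable {n : ℕ} {s α β p θ T : ℝ} [hs : Fact (1 ≤ ENNReal.ofReal s)]
  {u₀ : EuclideanSpace ℝ (Fin n) → ℝ} {hu₀ : MemLp u₀ (ENNReal.ofReal s) volume}
  {u : ℝ → Lp ℝ (ENNReal.ofReal s) (volume : Measure (EuclideanSpace ℝ (Fin n)))}

/-- A continuous curve in `L^s` that belongs to `L^∞(0,T; L^∞)` is bounded in `L^s ∩ L^∞` at every
time. -/
lemma MemLinftyLinfty.exists_mem_lpBall (hT : 0 < T) (hc : ContinuousOn u (Icc 0 T))
    (hu : MemLinftyLinfty T u) : ∃ M, ∀ t ∈ Icc 0 T, u t ∈ lpBall n s M := by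
  obtain ⟨K, hK⟩ := isCompact_Icc.exists_bound_of_continuousOn hc
  obtain ⟨v, hv, huv⟩ := hu
  set R : ℝ := (eLpNormEssSup v (volume.restrict (Ioo 0 T))).toReal with hR
  have hfin : eLpNormEssSup v (volume.restrict (Ioo 0 T)) ≠ ∞ := by
    have := hv.2
    rw [eLpNorm_exponent_top] at this
    exact this.ne
  have hvR : ∀ᵐ t ∂(volume.restrict (Ioo 0 T)), ‖v t‖ ≤ R := by
    filter_upwards [ae_le_eLpNormEssSup (f := v) (μ := volume.restrict (Ioo 0 T))] with t ht
    have := ENNReal.toReal_mono hfin ht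
    rwa [toReal_enorm] at this
  let D : Set (Lp ℝ (ENNReal.ofReal s) (volume : Measure (EuclideanSpace ℝ (Fin n)))) :=
    {w | ∀ᵐ x, w x ∈ Icc (-R) R}
  have hD : IsClosed D := isClosed_setOf_ae_mem isClosed_Icc
  have hmem : ∀ᵐ t ∂(volume.restrict (Ioo 0 T)), u t ∈ D := by
    filter_upwards [hvR, huv] with t h1 h2
    have h3 : ∀ᵐ x, ‖v t x‖ₑ ≤ eLpNormEssSup (v t) volume := ae_le_eLpNormEssSup
    have hfin' : eLpNormEssSup (v t) volume ≠ ∞ := by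
      have := (Lp.memLp (v t)).2
      rw [eLpNorm_exponent_top] at this
      exact this.ne
    filter_upwards [h2, h3] with x h4 h5
    rw [h4, mem_Icc, ← abs_le]
    have h6 := ENNReal.toReal_mono hfin' h5
    rw [toReal_enorm] at h6
    refine h6.trans (le_trans ?_ h1)
    rw [Lp.norm_def, eLpNorm_exponent_top]
  -- Needed because the infimum distance to the empty set is `0` by convention.
  have hDne : D.Nonempty := by
    have : (ae (volume.restrict (Ioo (0 : ℝ) T))).NeBot := by
      rw [ae_neBot, Ne, Measure.restrict_eq_zero]
      simpa using hT
    obtain ⟨t, ht⟩ := hmem.exists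
    exact ⟨_, ht⟩
  -- The distance from `u t` to `D` is continuous in time and vanishes almost everywhere, so it
  -- vanishes on all of `[0,T]`; as `D` is closed, the bound holds at every time.
  have hmem' : (fun t => Metric.infDist (u t) D) =ᵐ[volume.restrict (Icc 0 T)] fun _ => 0 := by
    rw [← Measure.restrict_congr_set Ioo_ae_eq_Icc]
    exact hmem.mono fun t ht => Metric.infDist_zero_of_mem ht
  have hall := Measure.eqOn_Icc_of_ae_eq volume hT.ne hmem'
    ((Metric.continuous_infDist_pt D).comp_continuousOn hc) continuousOn_const
  refine ⟨max K R, fun t ht => mem_lpBall.2 ⟨(hK t ht).trans (le_max_left _ _), ?_⟩⟩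
  have hut : ∀ᵐ x, u t x ∈ Icc (-R) R := (hD.mem_iff_infDist_zero hDne).2 (hall ht)
  exact hut.mono fun x hx => (abs_le.2 hx).trans (le_max_right _ _)

variable [NeZero n] {hβ : 0 < β} {hβ2 : β ≤ 2} {h : Admissible n α p s θ}

lemma IsMildSolution.isMild (hT : 0 < T) (hu : IsMildSolution α β p s u₀ T u) :
    (rieszProblem hβ hβ2 h).IsMild (hu₀.toLp u₀) T u where
  continuousOn := hu.continuousOn
  bounded := MemLinftyLinfty.exists_mem_lpBall hT hu.continuousOn hu.memLinfty
  duhamel t ht := by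
    obtain ⟨M, hM⟩ := MemLinftyLinfty.exists_mem_lpBall hT hu.continuousOn hu.memLinfty
    -- The abstract formula includes time `0`, where it reduces to the initial condition.
    rcases ht.1.eq_or_lt with rfl | ht0
    · rw [intervalIntegral.integral_same, add_zero, (rieszProblem hβ hβ2 h).S_zero]
      exact Lp.ext (hu.initial.trans hu₀.coeFn_toLp.symm)
    obtain ⟨F, hF, -, hut⟩ := hu.duhamel t ⟨ht0, ht.2⟩
    have e : ∫ τ in (0 : ℝ)..t, heatOp n s hβ hβ2 (t - τ) (rieszNonlinearity n s α p (u τ)) =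
        ∫ τ in (0 : ℝ)..t, F τ := by
      rw [intervalIntegral.integral_of_le ht0.le, intervalIntegral.integral_of_le ht0.le,
        integral_Ioc_eq_integral_Ioo, integral_Ioc_eq_integral_Ioo]
      refine integral_congr_ae ?_
      filter_upwards [hF, ae_restrict_mem measurableSet_Ioo] with τ h1 hτ
      refine Lp.ext (EventuallyEq.trans ?_ h1.symm)
      refine (heatOp_coeFn (sub_pos.2 hτ.2) _).trans ?_
      exact EventuallyEq.of_eq (conv_congr (rieszNonlinearity_coeFn h
        (hM τ ⟨hτ.1.le, hτ.2.le.trans ht.2⟩)))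
    change u t = heatOp n s hβ hβ2 t (hu₀.toLp u₀) +
      ∫ τ in (0 : ℝ)..t, heatOp n s hβ hβ2 (t - τ) (rieszNonlinearity n s α p (u τ))
    rw [e]
    refine Lp.ext (hut.trans ?_)
    have e0 : heatSemigroup β t (hu₀.toLp u₀) = heatSemigroup β t u₀ := conv_congr hu₀.coeFn_toLp
    filter_upwards [Lp.coeFn_add (heatOp n s hβ hβ2 t (hu₀.toLp u₀)) (∫ τ in (0 : ℝ)..t, F τ),
      heatOp_coeFn (hβ := hβ) (hβ2 := hβ2) ht0 (hu₀.toLp u₀)] with x h1 h2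
    rw [h1, Pi.add_apply, h2, e0]

/-- `L^∞` is not separable, so boundedness alone does not make the curve strongly measurable into
it. Continuity into `L^∞` on the open interval does; at time `0` it may fail. -/
lemma SemilinearProblem.IsMild.memLinftyLinfty
    {U₀ : Lp ℝ (ENNReal.ofReal s) (volume : Measure (EuclideanSpace ℝ (Fin n)))}
    (hu : (rieszProblem hβ hβ2 h).IsMild U₀ T u) : MemLinftyLinfty T u := by
  classical
  obtain ⟨M, hM⟩ := hu.exists_mem_lpBall
  let v : ℝ → Lp ℝ ∞ (volume : Measure (EuclideanSpace ℝ (Fin n))) := fun t =>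
    if hm : MemLp (u t) ∞ volume then hm.toLp _ else 0
  have hv : ∀ t ∈ Icc 0 T, v t =ᵐ[volume] u t := fun t ht => by
    have hm : MemLp (u t) ∞ volume := memLp_top_of_bound (Lp.memLp (u t)).1 M
      (mem_lpBall.1 (hM t ht)).2
    simp only [v, dif_pos hm]
    exact hm.coeFn_toLp
  have hnorm : ∀ (w : Lp ℝ ∞ (volume : Measure (EuclideanSpace ℝ (Fin n)))) (C : ℝ), 0 ≤ C →
      (∀ᵐ x, |w x| ≤ C) → ‖w‖ ≤ C := fun w C hC hw => by
    rw [Lp.norm_def, eLpNorm_exponent_top]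
    exact ENNReal.toReal_le_of_le_ofReal hC (eLpNormEssSup_le_of_ae_bound hw)
  have hcont : ContinuousOn v (Ioo 0 T) := by
    intro t₀ ht₀
    refine ContinuousAt.continuousWithinAt ?_
    rw [Metric.continuousAt_iff']
    intro ε hε
    filter_upwards [hu.eventually_abs_sub_le ht₀ (half_pos hε), Ioo_mem_nhds ht₀.1 ht₀.2]
      with t h1 h2
    rw [dist_eq_norm]
    refine lt_of_le_of_lt (hnorm _ (ε / 2) (by positivity) ?_) (half_lt_self hε)
    filter_upwards [h1, Lp.coeFn_sub (v t) (v t₀), hv t ⟨h2.1.le, h2.2.le⟩,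
      hv t₀ ⟨ht₀.1.le, ht₀.2.le⟩] with x h1 h2 h3 h4
    rwa [h2, Pi.sub_apply, h3, h4]
  refine ⟨v, ?_, (ae_restrict_iff' measurableSet_Ioo).2 (Eventually.of_forall fun t ht =>
    (hv t ⟨ht.1.le, ht.2.le⟩).symm)⟩
  refine memLp_top_of_bound (hcont.aestronglyMeasurable measurableSet_Ioo) M
    ((ae_restrict_iff' measurableSet_Ioo).2 (Eventually.of_forall fun t ht => ?_))
  have ht' : t ∈ Icc 0 T := ⟨ht.1.le, ht.2.le⟩
  refine hnorm _ M (nonneg_of_mem_lpBall (hM t ht')) ?_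
  filter_upwards [hv t ht', (mem_lpBall.1 (hM t ht')).2] with x h1 h2
  rwa [h1]

lemma SemilinearProblem.IsMild.isMildSolution (hT : 0 < T)
    (hu : (rieszProblem hβ hβ2 h).IsMild (hu₀.toLp u₀) T u) :
    IsMildSolution α β p s u₀ T u where
  continuousOn := hu.continuousOn
  memLinfty := hu.memLinftyLinfty
  initial := by
    rw [hu.apply_zero hT.le]
    exact hu₀.coeFn_toLp
  duhamel t ht := by
    obtain ⟨M, hM⟩ := hu.exists_mem_lpBall
    have ht' : t ∈ Icc 0 T := ⟨ht.1.le, ht.2⟩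
    refine ⟨fun τ => heatOp n s hβ hβ2 (t - τ) (rieszNonlinearity n s α p (u τ)), ?_,
      hu.intervalIntegrable_heatOp ht', ?_⟩
    · refine (ae_restrict_iff' measurableSet_Ioo).2 (Eventually.of_forall fun τ hτ => ?_)
      refine (heatOp_coeFn (sub_pos.2 hτ.2) _).trans ?_
      exact EventuallyEq.of_eq (conv_congr (rieszNonlinearity_coeFn h
        (hM τ ⟨hτ.1.le, hτ.2.le.trans ht.2⟩)))
    · have e := hu.duhamel_heatOp ht'
      have e0 : heatSemigroup β t (hu₀.toLp u₀) = heatSemigroup β t u₀ :=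
        conv_congr hu₀.coeFn_toLp
      filter_upwards [Lp.coeFn_add (heatOp n s hβ hβ2 t (hu₀.toLp u₀)) (∫ τ in (0 : ℝ)..t,
        heatOp n s hβ hβ2 (t - τ) (rieszNonlinearity n s α p (u τ))),
        heatOp_coeFn (hβ := hβ) (hβ2 := hβ2) ht.1 (hu₀.toLp u₀)] with x h1 h2
      rw [e, h1, Pi.add_apply, h2, e0]

end Equivalence

end RieszHeat

end

/-! ### Assembly of the theorem -/

theorem theorem1p1 (n : ℕ) (α β p s : ℝ)
    (hβ : 0 < β) (hβ2 : β ≤ 2) (hα : 0 < α) (hαn : α < n)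
    (hp : (n : ℝ) / (n - α) < p)
    (hs : (n : ℝ) / (n - α) < s) (hs' : s < n * (p - 1) / α)
    [Fact (1 ≤ ENNReal.ofReal s)]
    (u₀ : EuclideanSpace ℝ (Fin n) → ℝ)
    (hu₀s : MemLp u₀ (ENNReal.ofReal s) volume) (hu₀ : MemLp u₀ ∞ volume) :
    -- local existence and uniqueness
    (∃ T : ℝ, 0 < T ∧
      ∃ u : ℝ → Lp ℝ (ENNReal.ofReal s) (volume : Measure (EuclideanSpace ℝ (Fin n))),
        RieszHeat.IsMildSolution α β p s u₀ T u ∧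
        ∀ v : ℝ → Lp ℝ (ENNReal.ofReal s) (volume : Measure (EuclideanSpace ℝ (Fin n))),
          RieszHeat.IsMildSolution α β p s u₀ T v → EqOn v u (Icc 0 T)) ∧
    -- maximal solution and blow-up alternative
    (∃ Tmax : ℝ≥0∞,
      ∃ u : ℝ → Lp ℝ (ENNReal.ofReal s) (volume : Measure (EuclideanSpace ℝ (Fin n))),
        RieszHeat.IsMaximalMildSolution α β p s u₀ Tmax u ∧
        (Tmax = ∞ ∨
          (Tmax < ∞ ∧
            Tendsto (fun t : ℝ => (eLpNorm (u t) ∞ volume).toReal + ‖u t‖)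
              (𝓝[<] Tmax.toReal) atTop))) ∧
    -- nonnegativity
    ((∀ᵐ x ∂(volume : Measure (EuclideanSpace ℝ (Fin n))), 0 ≤ u₀ x) →
      ∀ T : ℝ, 0 < T →
        ∀ u : ℝ → Lp ℝ (ENNReal.ofReal s) (volume : Measure (EuclideanSpace ℝ (Fin n))),
          RieszHeat.IsMildSolution α β p s u₀ T u →
            ∀ t ∈ Icc 0 T, ∀ᵐ x ∂(volume : Measure (EuclideanSpace ℝ (Fin n))), 0 ≤ u t x) := by
  have : NeZero n := ⟨by
    rintro rfl
    exact absurd (hα.trans hαn) (by simp)⟩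
  obtain ⟨θ, h⟩ := RieszHeat.exists_admissible hα hαn hp hs hs'
  set P := RieszHeat.rieszProblem (n := n) (s := s) hβ hβ2 h with hP
  set U₀ := hu₀s.toLp u₀ with hU₀
  obtain ⟨M, hM0, hM⟩ : ∃ M, 0 ≤ M ∧ U₀ ∈ RieszHeat.lpBall n s M := by
    have hfin : eLpNormEssSup u₀ volume ≠ ∞ := by
      have := hu₀.2
      rw [eLpNorm_exponent_top] at this
      exact this.ne
    refine ⟨max ‖U₀‖ (eLpNormEssSup u₀ volume).toReal, le_max_of_le_left (norm_nonneg _),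
      RieszHeat.mem_lpBall.2 ⟨le_max_left _ _, ?_⟩⟩
    filter_upwards [hu₀s.coeFn_toLp, ae_le_eLpNormEssSup (f := u₀)] with x h1 h2
    rw [hU₀, h1]
    have := ENNReal.toReal_mono hfin h2
    rw [toReal_enorm] at this
    exact this.trans (le_max_right _ _)
  refine ⟨?_, ?_, ?_⟩
  · obtain ⟨T, hT, hex⟩ := P.exists_isMild hM0
    obtain ⟨u, hu⟩ := hex U₀ hM
    exact ⟨T, hT, u, hu.isMildSolution hT, fun v hv => (hv.isMild hT).unique hu⟩
  · obtain ⟨Tmax, U, hpos, hmild, hmax, hblow⟩ := P.exists_maximal hM0 hM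
    refine ⟨Tmax, U, ⟨hpos, fun T hT hTmax => (hmild T hT hTmax).isMildSolution hT,
      fun T hT v hv => hmax T hT v (hv.isMild hT)⟩, ?_⟩
    rcases eq_or_ne Tmax ∞ with htop | htop
    · exact Or.inl htop
    refine Or.inr ⟨htop.lt_top, tendsto_atTop.2 fun R => ?_⟩
    have hpos' : 0 < Tmax.toReal := ENNReal.toReal_pos hpos.ne' htop
    filter_upwards [hblow htop.lt_top (max R 0) (le_max_right _ _), Ioo_mem_nhdsLT hpos']
      with t h1 h2
    -- If the sum of the two norms were below `R`, then `U t` would lie in the ball of radius `max R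
    -- 0`, which it has already left.
    by_contra hlt
    rw [not_le] at hlt
    have htT : ENNReal.ofReal t < Tmax := by
      rw [← ENNReal.ofReal_toReal htop]
      exact (ENNReal.ofReal_lt_ofReal_iff hpos').2 h2.2
    obtain ⟨M', hM'⟩ := (hmild t h2.1 htT).exists_mem_lpBall
    -- Finiteness matters because `toReal` sends an infinite sup norm to `0`.
    have hfin : eLpNormEssSup (U t) volume ≠ ∞ :=
      ((eLpNormEssSup_le_of_ae_bound (RieszHeat.mem_lpBall.1
        (hM' t ⟨h2.1.le, le_rfl⟩)).2).trans_lt ENNReal.ofReal_lt_top).ne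
    rw [eLpNorm_exponent_top] at hlt
    have hE0 : 0 ≤ (eLpNormEssSup (U t) volume).toReal := ENNReal.toReal_nonneg
    refine h1 (RieszHeat.mem_lpBall.2 ⟨?_, ?_⟩)
    · exact le_max_of_le_left (by linarith)
    · filter_upwards [ae_le_eLpNormEssSup (f := U t) (μ := volume)] with x hx
      have := ENNReal.toReal_mono hfin hx
      rw [toReal_enorm] at this
      exact this.trans (le_max_of_le_left (by linarith [norm_nonneg (U t)]))
  · intro hnn T hT u hu t ht
    refine (hu.isMild (hβ := hβ) (hβ2 := hβ2) (h := h) (hu₀ := hu₀s) hT).nonneg ?_ ht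
    filter_upwards [hu₀s.coeFn_toLp, hnn] with x h1 h2
    rwa [h1]
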